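/- **Setting.** For $0<\varepsilon<\tfrac12$ consider the periodic Lorentz gas in $\mathbb R^2$ whose scatterers are the disks of radius $\varepsilon$ centred at the points of $\mathbb Z^2$. The billiard map $T_\varepsilon$ acts on $\mathcal M=\mathbb S^1\times[-\frac\pi2,\frac\pi2]$, $\mathbb S^1=\mathbb R/2\pi\mathbb Z$: a collision $(\theta,\phi)$ takes place at the point $(\varepsilon\sin\theta,\varepsilon\cos\theta)$ of the scatterer (translated to the origin) and $\phi$ is the outgoing angle with the outward normal, positive in the direction of increasing $\theta$; grazing contacts count as collisions. The displacement $\kappa_\varepsilon:\mathcal M\to\mathbb Z^2$ is the difference of lattice points between a collision and the next one, $\tau_{\min}$ is the shortest free flight time, $\mathcal S_0=\{\phi=\pm\frac\pi2\}$ and $\mathcal S_1=\mathcal S_0\cup T_\varepsilon^{-1}\mathcal S_0$. For $r_0>1$ and a fixed integer $k_0\ge1$ the homogeneity strips are $\mathbb H_{\pm k}=\{\,|\pm\frac\pi2-\phi|\in[(k+1)^{-r_0},k^{-r_0})\}$, $k\ge k_0$, together with the remaining central region. Lengths $|\cdot|$ of curves in $\mathcal M$ are with respect to $d\theta^2+d\phi^2$,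 and $|\kappa_\varepsilon|$ is the Euclidean norm. Fix $B$. For $c>0$ and $\nu\ge0$ put $\delta_0=c\,\varepsilon^{\nu}$. An *admissible stable leaf* is a $C^2$ curve $W\subset\mathcal M$, a graph $\phi=w(\theta)$ over a nondegenerate interval, with tangent lines in the stable cone $-1-\varepsilon/\tau_{\min}\le d\phi/d\theta\le-1$, with $|w''|\le B$, contained in a single homogeneity strip, on which $\kappa_\varepsilon$ is constant, and with $|W|\le\delta_0$. The pieces $V_i$ are the connected components of $T_\varepsilon^{-1}W$ after removal of $\mathcal S_1$ and of the boundaries of the homogeneity strips; $\kappa_\varepsilon$ is constant on each $V_i$, and $\kappa_\varepsilon(V_i)$ denotes its value. (A piece consisting of a single point contributes $0$ to the sum below.) **Proposition.** Let $k_0\ge 1$, $B$ and $\eta>0$ be fixed. Consider the estimate $$\sum_i|\kappa_\varepsilon(V_i)|^{\nu}\,\frac{|T_\varepsilon V_i|}{|V_i|}\;\le\;C\left(\varepsilon+\varepsilon^{-\nu}\delta_0\right).\qquad(*)$$ 1. For every $c>0$ and every $\varepsilon_{\max}<\frac12$ there is a constant $C>0$ such that $(*)$ holds for all $r_0>1$,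 all $0\le\nu\le\frac12-\frac1{2r_0}-\eta$, all $0<\varepsilon\le\varepsilon_{\max}$ and every admissible stable leaf $W$. 2. For small $\varepsilon$ the constant does not depend on $c$: there is a constant $C>0$ such that for every $c>0$ there is $\varepsilon_0\in(0,\frac12)$ such that $(*)$ holds for all $r_0>1$, all $0\le\nu\le\frac12-\frac1{2r_0}-\eta$, all $0<\varepsilon\le\varepsilon_0$ and every admissible stable leaf $W$. In particular, for each fixed $r_0$ and each $0\le\nu<\frac12-\frac1{2r_0}$ the constant $C$ is uniform in $\varepsilon$ as $\varepsilon\to0$, although the number of open corridors is unbounded in this limit. -/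

import Mathlib

open Set MeasureTheory
open scoped ENNReal Real

noncomputable section

namespace LorentzGas

/-- The Borel `σ`-algebra on the circle `ℝ / 2πℤ`. -/
instance instMeasurableSpaceAngle : MeasurableSpace Real.Angle := borel Real.Angle

instance instBorelSpaceAngle : BorelSpace Real.Angle := ⟨rfl⟩

/-- The cylinder `𝕊¹ × ℝ` with the Euclidean product metric `dθ² + dφ²`, where `𝕊¹ = ℝ / 2πℤ`.
A collision is a pair `(θ, φ)`: `θ` is the (clockwise) position on the scatterer and `φ` the
outgoing angle with the outward normal, positive in the direction of increasing `θ`. -/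
abbrev Cylinder : Type := WithLp 2 (Real.Angle × ℝ)

/-- The point of the cylinder with coordinates `(θ, φ)`. -/
def point (θ φ : ℝ) : Cylinder := WithLp.toLp 2 ((θ : Real.Angle), φ)

/-- The phase space `𝕊¹ × [-π/2, π/2]` of the billiard map. -/
def phaseSpace : Set Cylinder := {x | x.snd ∈ Icc (-(π / 2)) (π / 2)}

/-- The collision point `(ε sin θ, ε cos θ)` on the scatterer of radius `ε` at the origin.
The plane `ℝ²` is identified with `ℂ`. -/
def position (ε : ℝ) (x : Cylinder) : ℂ := ⟨ε * x.fst.sin, ε * x.fst.cos⟩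

/-- The unit outgoing velocity `cos φ • n + sin φ • t`, for the outward normal
`n = (sin θ, cos θ)` and the tangent vector `t = (cos θ, - sin θ)`. -/
def velocity (x : Cylinder) : ℂ :=
  ⟨Real.cos x.snd * x.fst.sin + Real.sin x.snd * x.fst.cos,
    Real.cos x.snd * x.fst.cos - Real.sin x.snd * x.fst.sin⟩

/-- The lattice point `ℓ ∈ ℤ²` as a point of the plane. -/
def latticePoint (ℓ : ℤ × ℤ) : ℂ := ⟨(ℓ.1 : ℝ), (ℓ.2 : ℝ)⟩

/-- The free flight time `τ(x)`: the first positive time at which the particle is on (or in) one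
of the closed disks of radius `ε` around the lattice points. Grazing contacts are collisions. -/
def flightTime (ε : ℝ) (x : Cylinder) : ℝ :=
  sInf {t : ℝ | 0 < t ∧ ∃ ℓ : ℤ × ℤ, ‖position ε x + (t : ℂ) * velocity x - latticePoint ℓ‖ ≤ ε}

/-- The shortest free flight time. -/
def minFlightTime (ε : ℝ) : ℝ := sInf (flightTime ε '' phaseSpace)

/-- The point of the plane where the next collision takes place. -/
def nextPoint (ε : ℝ) (x : Cylinder) : ℂ := position ε x + (flightTime ε x : ℂ) * velocity x

/-- The displacement function `κ_ε(x) ∈ ℤ²`: the centre of the scatterer of the next collision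
(it is unique, the closed disks being pairwise disjoint for `ε < 1/2`). -/
def displacement (ε : ℝ) (x : Cylinder) : ℤ × ℤ :=
  Classical.epsilon fun ℓ : ℤ × ℤ => ‖nextPoint ε x - latticePoint ℓ‖ ≤ ε

/-- The coordinate `θ` of the next collision, for which
`nextPoint - latticePoint κ = (ε sin θ, ε cos θ)`. -/
def nextAngle (ε : ℝ) (x : Cylinder) : ℝ :=
  Complex.arg ⟨(nextPoint ε x - latticePoint (displacement ε x)).im,
    (nextPoint ε x - latticePoint (displacement ε x)).re⟩

/-- The billiard map `T_ε`. Elastic reflection preserves the component of the velocity along the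
tangent vector `t = (cos θ₁, - sin θ₁)`, and this component is the sine of the new angle `φ₁`. -/
def billiardMap (ε : ℝ) (x : Cylinder) : Cylinder :=
  point (nextAngle ε x)
    (Real.arcsin ((velocity x).re * Real.cos (nextAngle ε x)
      - (velocity x).im * Real.sin (nextAngle ε x)))

/-- The set `S₀` of grazing collisions. -/
def singularSetZero : Set Cylinder := {x | x.snd = π / 2 ∨ x.snd = -(π / 2)}

/-- The discontinuity set `S₁ = S₀ ∪ T_ε⁻¹ S₀`. -/
def singularSetOne (ε : ℝ) : Set Cylinder :=
  singularSetZero ∪ {x ∈ phaseSpace | billiardMap ε x ∈ singularSetZero}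

/-- The homogeneity strip `ℍ_k`, close to `φ = π/2`. -/
def upperStrip (r₀ : ℝ) (k : ℕ) : Set Cylinder :=
  {x | |π / 2 - x.snd| ∈ Ico (((k : ℝ) + 1) ^ (-r₀)) ((k : ℝ) ^ (-r₀))} ∩ phaseSpace

/-- The homogeneity strip `ℍ_{-k}`, close to `φ = -π/2`. -/
def lowerStrip (r₀ : ℝ) (k : ℕ) : Set Cylinder :=
  {x | |-(π / 2) - x.snd| ∈ Ico (((k : ℝ) + 1) ^ (-r₀)) ((k : ℝ) ^ (-r₀))} ∩ phaseSpace

/-- The remaining, central part of the phase space, outside all strips `ℍ_{±k}`, `k ≥ k₀`. -/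
def centralStrip (r₀ : ℝ) (k₀ : ℕ) : Set Cylinder :=
  {x | (k₀ : ℝ) ^ (-r₀) ≤ |π / 2 - x.snd| ∧ (k₀ : ℝ) ^ (-r₀) ≤ |-(π / 2) - x.snd|} ∩ phaseSpace

/-- The union of the boundary curves of the homogeneity strips. -/
def stripBoundaries (r₀ : ℝ) (k₀ : ℕ) : Set Cylinder :=
  {x | ∃ k : ℕ, k₀ ≤ k ∧
    (|π / 2 - x.snd| = (k : ℝ) ^ (-r₀) ∨ |-(π / 2) - x.snd| = (k : ℝ) ^ (-r₀))}

/-- `W` lies in a single homogeneity strip. -/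
def IsHomogeneous (r₀ : ℝ) (k₀ : ℕ) (W : Set Cylinder) : Prop :=
  W ⊆ centralStrip r₀ k₀ ∨ ∃ k : ℕ, k₀ ≤ k ∧ (W ⊆ upperStrip r₀ k ∨ W ⊆ lowerStrip r₀ k)

/-- The length of a curve in the phase space. -/
def length (V : Set Cylinder) : ℝ≥0∞ := μH[1] V

/-- The class of admissible stable leaves of length at most `δ₀`: `C²` curves, given as graphs
`φ = w(θ)` over intervals, with all tangent lines in the stable cone
`-1 - ε/τ_min ≤ dφ/dθ ≤ -1`, with second derivative bounded by `B`, contained in a single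
homogeneity strip, and on which `κ_ε` is constant. -/
def IsAdmissibleStableLeaf (ε r₀ : ℝ) (k₀ : ℕ) (B δ₀ : ℝ) (W : Set Cylinder) : Prop :=
  (∃ (I : Set ℝ) (w : ℝ → ℝ), I.OrdConnected ∧ I.Nontrivial ∧
    W = (fun θ => point θ (w θ)) '' I ∧
    ContDiffOn ℝ 2 w I ∧
    (∀ θ ∈ I, derivWithin w I θ ∈ Icc (-1 - ε / minFlightTime ε) (-1)) ∧
    (∀ θ ∈ I, |iteratedDerivWithin 2 w I θ| ≤ B)) ∧
  IsHomogeneous r₀ k₀ W ∧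
  (∃ ℓ : ℤ × ℤ, ∀ x ∈ W, displacement ε x = ℓ) ∧
  length W ≤ ENNReal.ofReal δ₀

/-- The maximal length `δ₀ = c ε^ν` of admissible stable leaves. -/
def leafSize (c ε ν : ℝ) : ℝ := c * ε ^ ν

/-- The preimage `T_ε⁻¹ W`, cut at the discontinuity set and at the boundaries of the
homogeneity strips. -/
def cutPreimage (ε r₀ : ℝ) (k₀ : ℕ) (W : Set Cylinder) : Set Cylinder :=
  {x ∈ phaseSpace | billiardMap ε x ∈ W} \ (singularSetOne ε ∪ stripBoundaries r₀ k₀)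

/-- The pieces `V_i` of the preimage of `W`: the connected components of the cut preimage. -/
def preimagePieces (ε r₀ : ℝ) (k₀ : ℕ) (W : Set Cylinder) : Set (Set Cylinder) :=
  {V | ∃ x ∈ cutPreimage ε r₀ k₀ W, V = connectedComponentIn (cutPreimage ε r₀ k₀ W) x}

/-- The value of the displacement function on a piece on which it is constant. -/
def pieceDisplacement (ε : ℝ) (V : Set Cylinder) : ℤ × ℤ :=
  Classical.epsilon fun ℓ : ℤ × ℤ => ∀ x ∈ V, displacement ε x = ℓ

/-- The one-step growth sum `∑ |κ_ε(V)|^ν |T_ε V| / |V|` over the pieces `V` of `T_ε⁻¹ W`,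
with values in `[0, ∞]`; `|κ_ε|` is the Euclidean norm. -/
def growthSum (ε r₀ ν : ℝ) (k₀ : ℕ) (W : Set Cylinder) : ℝ≥0∞ :=
  ∑' V : preimagePieces ε r₀ k₀ W,
    ENNReal.ofReal (‖latticePoint (pieceDisplacement ε V)‖ ^ ν) *
      (length (billiardMap ε '' (V : Set Cylinder)) / length (V : Set Cylinder))

end LorentzGas

end

/-! Collisions are followed backwards. Reversing time at `(θ, φ)` gives a ray of direction `(sin α,
cos α)` with `α = θ - φ`, and the preimage on the scatterer `m` has outgoing angle `f` with `ε sin f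
= offset ε φ α m`. Along a stable leaf `φ` decreases while `α` increases at least as fast, so the
reversed rays form a divergent front. The offset of `m` then grows at rate at least of order `(1 -
2ε)|m|` in `α` (`offset_growth_left`, `offset_growth_right`). This has two consequences. Over a
stretch of the front of `α`-width at most `ρ`, the part that sees `m` first is connected
(`visible_between`), so a piece is determined by one of boundedly many stretches, a scatterer `m`
and a homogeneity strip. Moreover the contraction ratio of a piece is at most a constant times `ε
cos f / |m|` (`length_image_le`).

There are two bounds for `cos f`. In the strip of index `k > 0` it is at most `k ^ (-r₀)`. A
scatterer at distance `|m| ≥ 36 / ε` is seen only through a corridor, hence almost tangentially: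
`cos f ≤ √(8 / (ε |m|))` (`far_visible`). The geometric mean with weights `a` and `1 - a`, `a = 1 -
1/r₀ - η`, uses both: the strips are summable because `r₀ (1 - a) = 1 + r₀ η`, and what remains is
the sum of `ε |m| ^ (ν - 1) * grazing ε |m| ^ a` over visible `m` (`growthSum_le_tsum`).

The visible `m` lie in a sector of opening of order `c ε ^ ν` around a reference direction,
thickened by a bounded width, so about `1 + c ε ^ ν n` of them have size `n`. The near ones, `|m| <
36 / ε`, contribute `O(c + √ε)` (`near_sum`). The far ones lie on the rows adjacent to the line of a
lattice vector `e` of the sector with `|e| ≤ 4 / ε`. Each row sums to `O(|e| ^ (-(1 + σ)))`, `σ =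
a/2 - ν ≥ η/2` (`row_sum`), and the sum over `e` is `O(c + ε ^ (η/2))` (`far_sum`). This treats all
corridors at once, however many are open. Since `ε ^ (-ν) δ₀ = c`, the bound `C (c + ε ^ (η/2))` of
`growthSum_le` gives both claims. -/

noncomputable section

namespace LorentzGas

/-! ### Lattice vectors in the frame of a ray -/

/-- The component of the lattice vector `m` along the direction `(sin α, cos α)`. -/
def dotU (m : ℤ × ℤ) (α : ℝ) : ℝ := m.1 * Real.sin α + m.2 * Real.cos α

/-- The component of the lattice vector `m` orthogonal to the direction `(sin α, cos α)`. -/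
def crossU (m : ℤ × ℤ) (α : ℝ) : ℝ := m.1 * Real.cos α - m.2 * Real.sin α

/-- The signed distance from the lattice point `m` to the line of direction `(sin α, cos α)` that
leaves the scatterer at the origin at the angle `φ`. -/
def offset (ε φ α : ℝ) (m : ℤ × ℤ) : ℝ := ε * Real.sin φ - crossU m α

/-- The scatterer `m` is the first one hit, and not tangentially, by the ray of direction
`(sin α, cos α)` that leaves the scatterer at the origin at the angle `φ`. -/
def Visible (ε φ α : ℝ) (m : ℤ × ℤ) : Prop :=
  |offset ε φ α m| < ε ∧ 0 < dotU m α ∧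
    ∀ m', 0 < dotU m' α → dotU m' α < dotU m α → ε < |offset ε φ α m'|

lemma norm_latticePoint_sq (m : ℤ × ℤ) :
    ‖latticePoint m‖ ^ 2 = (m.1 : ℝ) ^ 2 + (m.2 : ℝ) ^ 2 := by
  rw [← Complex.normSq_eq_norm_sq, Complex.normSq_apply]
  simp [latticePoint]; ring

lemma dotU_sq_add_crossU_sq (m : ℤ × ℤ) (α : ℝ) :
    dotU m α ^ 2 + crossU m α ^ 2 = ‖latticePoint m‖ ^ 2 := by
  rw [norm_latticePoint_sq, dotU, crossU]
  linear_combination ((m.1 : ℝ) ^ 2 + (m.2 : ℝ) ^ 2) * Real.sin_sq_add_cos_sq α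

lemma dotU_add (m n : ℤ × ℤ) (α : ℝ) : dotU (m + n) α = dotU m α + dotU n α := by
  simp [dotU]; ring

lemma crossU_add (m n : ℤ × ℤ) (α : ℝ) : crossU (m + n) α = crossU m α + crossU n α := by
  simp [crossU]; ring

lemma dotU_neg (m : ℤ × ℤ) (α : ℝ) : dotU (-m) α = -dotU m α := by
  simp [dotU]; ring

lemma crossU_neg (m : ℤ × ℤ) (α : ℝ) : crossU (-m) α = -crossU m α := by
  simp [crossU]; ring

lemma dotU_sub (m n : ℤ × ℤ) (α : ℝ) : dotU (m - n) α = dotU m α - dotU n α := by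
  simp [dotU]; ring

lemma crossU_sub (m n : ℤ × ℤ) (α : ℝ) : crossU (m - n) α = crossU m α - crossU n α := by
  simp [crossU]; ring

lemma dotU_add_pi (m : ℤ × ℤ) (α : ℝ) : dotU m (α + π) = -dotU m α := by
  simp [dotU]; ring

lemma crossU_add_pi (m : ℤ × ℤ) (α : ℝ) : crossU m (α + π) = -crossU m α := by
  simp [crossU]; ring

lemma dotU_zero (α : ℝ) : dotU 0 α = 0 := by simp [dotU]

lemma crossU_zero (α : ℝ) : crossU 0 α = 0 := by simp [crossU]

lemma one_le_norm_latticePoint {m : ℤ × ℤ} (hm : m ≠ 0) : 1 ≤ ‖latticePoint m‖ := by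
  have h : (1 : ℝ) ≤ ‖latticePoint m‖ ^ 2 := by
    rw [norm_latticePoint_sq]
    have : (1 : ℤ) ≤ m.1 ^ 2 + m.2 ^ 2 := by
      by_contra hc
      have h1 : m.1 = 0 := by nlinarith [sq_nonneg m.1, sq_nonneg m.2]
      have h2 : m.2 = 0 := by nlinarith [sq_nonneg m.1, sq_nonneg m.2]
      exact hm (Prod.ext h1 h2)
    exact_mod_cast this
  nlinarith [norm_nonneg (latticePoint m)]

lemma norm_latticePoint_neg (m : ℤ × ℤ) : ‖latticePoint (-m)‖ = ‖latticePoint m‖ := by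
  have h : latticePoint (-m) = -latticePoint m := by
    apply Complex.ext <;> simp [latticePoint]
  rw [h, norm_neg]

lemma abs_dotU_le (m : ℤ × ℤ) (α : ℝ) : |dotU m α| ≤ ‖latticePoint m‖ := by
  apply abs_le_of_sq_le_sq _ (norm_nonneg _)
  nlinarith [dotU_sq_add_crossU_sq m α, sq_nonneg (crossU m α)]

lemma abs_crossU_le (m : ℤ × ℤ) (α : ℝ) : |crossU m α| ≤ ‖latticePoint m‖ := by
  apply abs_le_of_sq_le_sq _ (norm_nonneg _)
  nlinarith [dotU_sq_add_crossU_sq m α, sq_nonneg (dotU m α)]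

/-- Two closed disks of radius `ε < 1/2` around different lattice points are disjoint. -/
lemma eq_of_mem_disks {ε A B ψ : ℝ} (hε : ε < 1 / 2) (hε0 : 0 < ε) {ℓ ℓ' : ℤ × ℤ}
    (h : (A - dotU ℓ ψ) ^ 2 + (B + crossU ℓ ψ) ^ 2 ≤ ε ^ 2)
    (h' : (A - dotU ℓ' ψ) ^ 2 + (B + crossU ℓ' ψ) ^ 2 ≤ ε ^ 2) : ℓ = ℓ' := by
  by_contra hne
  have h1 := one_le_norm_latticePoint (sub_ne_zero.mpr hne)
  have h2 := dotU_sq_add_crossU_sq (ℓ - ℓ') ψ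
  rw [dotU_sub, crossU_sub] at h2
  have h3 : (1 : ℝ) ≤ ‖latticePoint (ℓ - ℓ')‖ ^ 2 := by nlinarith
  nlinarith [sq_nonneg ((A - dotU ℓ ψ) + (A - dotU ℓ' ψ)),
    sq_nonneg ((B + crossU ℓ ψ) + (B + crossU ℓ' ψ))]

/-! ### Rays in coordinates and the first hit -/

lemma velocity_point (a f : ℝ) : velocity (point a f) = ⟨Real.sin (a + f), Real.cos (a + f)⟩ := by
  apply Complex.ext <;> simp [velocity, point, Real.sin_add, Real.cos_add] <;> ring

lemma position_point (ε a f : ℝ) :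
    position ε (point a f) = ⟨ε * Real.sin a, ε * Real.cos a⟩ := by
  simp [position, point]

lemma exists_point_eq (x : Cylinder) : ∃ a : ℝ, x = point a x.snd := by
  obtain ⟨a, ha⟩ := QuotientAddGroup.mk_surjective x.fst
  refine ⟨a, ?_⟩
  have : x = WithLp.toLp 2 (x.fst, x.snd) := rfl
  rw [this, point, ← ha]
  rfl

lemma ray_sub_latticePoint (ε a f t : ℝ) (ℓ : ℤ × ℤ) :
    position ε (point a f) + (t : ℂ) * velocity (point a f) - latticePoint ℓ =
      ⟨ε * Real.sin a + t * Real.sin (a + f) - ℓ.1, ε * Real.cos a + t * Real.cos (a + f) - ℓ.2⟩ := by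
  rw [velocity_point, position_point]
  apply Complex.ext <;> simp [latticePoint]

/-- Pythagoras in the frame of the ray: the starting point has component `ε cos f` along the
direction and, up to sign, `ε sin f` across it. All hitting conditions below are read in these two
coordinates. -/
lemma norm_ray_sub_sq (ε a f t : ℝ) (ℓ : ℤ × ℤ) :
    ‖position ε (point a f) + (t : ℂ) * velocity (point a f) - latticePoint ℓ‖ ^ 2 =
      (t + ε * Real.cos f - dotU ℓ (a + f)) ^ 2 + (ε * Real.sin f + crossU ℓ (a + f)) ^ 2 := by
  rw [ray_sub_latticePoint, ← Complex.normSq_eq_norm_sq, Complex.normSq_apply]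
  obtain ⟨ψ, rfl⟩ : ∃ ψ, a = ψ - f := ⟨a + f, by ring⟩
  simp only [sub_add_cancel, Real.sin_sub, Real.cos_sub, dotU, crossU]
  have h1 := Real.sin_sq_add_cos_sq ψ
  have h2 := Real.sin_sq_add_cos_sq f
  set s := Real.sin ψ
  set c := Real.cos ψ
  set s' := Real.sin f
  set c' := Real.cos f
  set p : ℝ := (ℓ.1 : ℝ)
  set q : ℝ := (ℓ.2 : ℝ)
  have hs : s ^ 2 = 1 - c ^ 2 := by linarith
  have hs' : s' ^ 2 = 1 - c' ^ 2 := by linarith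
  ring_nf
  simp only [hs, hs']
  ring

lemma norm_ray_sub_le_iff {ε : ℝ} (hε : 0 < ε) (a f t : ℝ) (ℓ : ℤ × ℤ) :
    ‖position ε (point a f) + (t : ℂ) * velocity (point a f) - latticePoint ℓ‖ ≤ ε ↔
      (t + ε * Real.cos f - dotU ℓ (a + f)) ^ 2 + (ε * Real.sin f + crossU ℓ (a + f)) ^ 2
        ≤ ε ^ 2 := by
  rw [← norm_ray_sub_sq, sq_le_sq₀ (norm_nonneg _) hε.le]

lemma finite_norm_latticePoint_le (R : ℝ) : {ℓ : ℤ × ℤ | ‖latticePoint ℓ‖ ≤ R}.Finite := by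
  apply ((Set.finite_Icc (-⌈R⌉) ⌈R⌉).prod (Set.finite_Icc (-⌈R⌉) ⌈R⌉)).subset
  intro ℓ hℓ
  have h1 := (Complex.abs_re_le_norm (latticePoint ℓ)).trans hℓ
  have h2 := (Complex.abs_im_le_norm (latticePoint ℓ)).trans hℓ
  simp only [latticePoint, abs_le] at h1 h2
  have h3 := Int.le_ceil R
  simp only [mem_prod, mem_Icc]
  refine ⟨⟨?_, ?_⟩, ?_, ?_⟩ <;> (rify; linarith)

/-- The times at which the ray of `x` is on or in one of the scatterers. -/
def hitTimes (ε : ℝ) (x : Cylinder) : Set ℝ :=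
  {t : ℝ | 0 < t ∧ ∃ ℓ : ℤ × ℤ, ‖position ε x + (t : ℂ) * velocity x - latticePoint ℓ‖ ≤ ε}

lemma not_hit_zero {ε : ℝ} (hε : 0 < ε) (a : ℝ) {f t : ℝ} (hf : 0 ≤ Real.cos f) (ht : 0 < t) :
    ¬ ‖position ε (point a f) + (t : ℂ) * velocity (point a f) - latticePoint 0‖ ≤ ε := by
  rw [norm_ray_sub_le_iff hε, dotU_zero, crossU_zero]
  intro h
  have := Real.sin_sq_add_cos_sq f
  have : 0 ≤ t * (ε * Real.cos f) := by positivity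
  nlinarith

lemma hit_start {ε : ℝ} (f : ℝ) (ψ : ℝ) :
    (0 + ε * Real.cos f - dotU 0 ψ) ^ 2 + (ε * Real.sin f + crossU 0 ψ) ^ 2 ≤ ε ^ 2 := by
  rw [dotU_zero, crossU_zero]
  nlinarith [Real.sin_sq_add_cos_sq f]

lemma norm_latticePoint_le_of_hit {ε : ℝ} (hε0 : 0 < ε) (hε : ε < 1 / 2) {a f t T : ℝ}
    (ht0 : 0 ≤ t) (ht : t ≤ T) {ℓ : ℤ × ℤ}
    (h : ‖position ε (point a f) + (t : ℂ) * velocity (point a f) - latticePoint ℓ‖ ≤ ε) :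
    ‖latticePoint ℓ‖ ≤ T + 1 := by
  have h1 : ‖position ε (point a f)‖ = ε := by
    have := norm_ray_sub_sq ε a f 0 0
    rw [dotU_zero, crossU_zero] at this
    have h0 : latticePoint 0 = 0 := by apply Complex.ext <;> simp [latticePoint]
    simp only [h0, Complex.ofReal_zero, zero_mul, add_zero, sub_zero, zero_add] at this
    have h2 : ‖position ε (point a f)‖ ^ 2 = ε ^ 2 := by
      rw [this]; linear_combination ε ^ 2 * Real.sin_sq_add_cos_sq f
    exact (sq_eq_sq₀ (norm_nonneg _) hε0.le).mp h2
  have h2 : ‖velocity (point a f)‖ = 1 := by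
    rw [velocity_point]
    have : ‖(⟨Real.sin (a + f), Real.cos (a + f)⟩ : ℂ)‖ ^ 2 = 1 ^ 2 := by
      rw [← Complex.normSq_eq_norm_sq, Complex.normSq_apply]
      nlinarith [Real.sin_sq_add_cos_sq (a + f)]
    exact (sq_eq_sq₀ (norm_nonneg _) zero_le_one).mp this
  have h3 : ‖(t : ℂ) * velocity (point a f)‖ = t := by
    rw [norm_mul, h2, mul_one, Complex.norm_real, Real.norm_of_nonneg ht0]
  have h4 : latticePoint ℓ = position ε (point a f) + (t : ℂ) * velocity (point a f) -
      (position ε (point a f) + (t : ℂ) * velocity (point a f) - latticePoint ℓ) := by ring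
  have h5 : ‖latticePoint ℓ‖ ≤ (ε + t) + ε := by
    rw [h4]
    refine (norm_sub_le _ _).trans (add_le_add ((norm_add_le _ _).trans ?_) h)
    rw [h1, h3]
  linarith

/-- The first collision takes place: the infimum in the definition of the flight time is attained. -/
lemma isLeast_flightTime {ε : ℝ} (hε0 : 0 < ε) (hε : ε < 1 / 2) {a f : ℝ} (hf : 0 ≤ Real.cos f)
    (hne : (hitTimes ε (point a f)).Nonempty) :
    IsLeast (hitTimes ε (point a f)) (flightTime ε (point a f)) := by
  obtain ⟨T, hT0, ℓT, hℓT⟩ := hne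
  set F : Set (ℤ × ℤ) := {ℓ | ‖latticePoint ℓ‖ ≤ T + 1} \ {0} with hF
  have hFfin : F.Finite := (finite_norm_latticePoint_le _).subset sdiff_subset
  -- Up to time `T` only finitely many disks can be met, so the hitting times form a compact set
  -- once the disk of departure is left out. Time `0` does not belong to it, since no other disk
  -- contains the starting point.
  set K : Set ℝ := Icc 0 T ∩ ⋃ ℓ ∈ F,
    {t : ℝ | ‖position ε (point a f) + (t : ℂ) * velocity (point a f) - latticePoint ℓ‖ ≤ ε} with hK
  have hKc : IsCompact K := by
    apply isCompact_Icc.inter_right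
    apply hFfin.isClosed_biUnion
    intro ℓ _
    exact isClosed_le (by fun_prop) continuous_const
  have hmem : ∀ t, 0 < t → t ≤ T → ∀ ℓ,
      ‖position ε (point a f) + (t : ℂ) * velocity (point a f) - latticePoint ℓ‖ ≤ ε → t ∈ K := by
    intro t h0 h1 ℓ hℓ
    refine ⟨⟨h0.le, h1⟩, mem_biUnion (x := ℓ) ⟨?_, ?_⟩ hℓ⟩
    · exact norm_latticePoint_le_of_hit hε0 hε h0.le h1 hℓ
    · rintro rfl
      exact not_hit_zero hε0 a hf h0 hℓ
  have hKS : ∀ t ∈ K, t ∈ hitTimes ε (point a f) := by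
    rintro t ⟨⟨h0, h1⟩, h2⟩
    simp only [mem_iUnion] at h2
    obtain ⟨ℓ, hℓ, h3⟩ := h2
    refine ⟨lt_of_le_of_ne h0 ?_, ℓ, h3⟩
    rintro rfl
    have h3 := (norm_ray_sub_le_iff hε0 _ _ _ _).mp h3
    exact hℓ.2 (eq_of_mem_disks hε hε0 h3 (hit_start f _))
  obtain ⟨t₀, ht₀⟩ := hKc.exists_isLeast ⟨T, hmem T hT0 le_rfl ℓT hℓT⟩
  have hl : IsLeast (hitTimes ε (point a f)) t₀ := by
    refine ⟨hKS _ ht₀.1, ?_⟩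
    rintro t ⟨ht, ℓ, hℓ⟩
    by_cases h : t ≤ T
    · exact ht₀.2 (hmem t ht h ℓ hℓ)
    · exact ht₀.1.1.2.trans (not_le.mp h).le
  have : flightTime ε (point a f) = t₀ := hl.csInf_eq
  rwa [this]

/-! ### Dirichlet approximation of directions -/

/-- Dirichlet's theorem for the slope `c / s`, with `1/2 ≤ s ^ 2` to make the division harmless. The
factor `|s|` is kept in the bound `|s| / (n + 1)` of the transverse component and cancels against
`|s|` in the bound of the longitudinal one; this makes the product at most `1`. -/
lemma exists_coprime_approx {s c : ℝ} (h1 : s ^ 2 + c ^ 2 = 1) (h2 : 1 / 2 ≤ s ^ 2) (n : ℕ)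
    (hn : 0 < n) : ∃ k j : ℤ, IsCoprime k j ∧ |k * c - j * s| ≤ 1 / (n + 1) ∧
      |k * s + j * c| * |k * c - j * s| ≤ 1 ∧ |k * s + j * c| ≤ 2 * (n + 1) := by
  obtain ⟨q, hq, hqn⟩ := Real.exists_rat_abs_sub_le_and_den_le (c / s) hn
  have hs0 : s ≠ 0 := by rintro rfl; norm_num at h2
  have hs : 1 / 2 ≤ |s| := by
    by_contra hc
    have : |s| ^ 2 < 1 / 2 := by nlinarith [abs_nonneg s]
    rw [sq_abs] at this; linarith
  have hs1 : |s| ≤ 1 := abs_le_of_sq_le_sq (by nlinarith [sq_nonneg c]) zero_le_one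
  have hc1 : |c| ≤ 1 := abs_le_of_sq_le_sq (by nlinarith [sq_nonneg s]) zero_le_one
  have hd : (0 : ℝ) < q.den := by exact_mod_cast q.den_pos
  have hn1 : (0 : ℝ) < n + 1 := by positivity
  have hcr : |(q.den : ℤ) * c - q.num * s| ≤ |s| / (n + 1) := by
    have e : ((q.den : ℤ) : ℝ) * c - q.num * s = s * (q.den * (c / s - q)) := by
      have : (q.num : ℝ) = q.den * q := by
        have := Rat.mul_den_eq_num q
        rw [mul_comm] at this; exact_mod_cast this.symm
      rw [this]; push_cast; field_simp
    rw [e, abs_mul, abs_mul, abs_of_pos hd, div_eq_mul_inv]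
    refine mul_le_mul_of_nonneg_left ?_ (abs_nonneg s)
    calc (q.den : ℝ) * |c / s - q| ≤ q.den * (1 / ((n + 1) * q.den)) := by gcongr
      _ = (n + 1 : ℝ)⁻¹ := by field_simp
  have hcr1 : |(q.den : ℤ) * c - q.num * s| ≤ 1 / (n + 1) := hcr.trans (by gcongr)
  have hcr2 : |(q.den : ℤ) * c - q.num * s| ≤ 1 := hcr1.trans (by
    rw [div_le_one hn1]; linarith [(Nat.cast_nonneg n : (0 : ℝ) ≤ n)])
  have hds : |(q.den : ℤ) * s + q.num * c| * |s| ≤ n + 1 := by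
    rw [← abs_mul]
    have e : (((q.den : ℤ) : ℝ) * s + q.num * c) * s =
      q.den - ((q.den : ℤ) * c - q.num * s) * c := by
      push_cast
      linear_combination (q.den : ℝ) * h1
    rw [e]
    refine (abs_sub _ _).trans ?_
    rw [abs_mul, abs_of_pos hd]
    have h3 : (q.den : ℝ) ≤ n := by exact_mod_cast hqn
    have h4 : |(q.den : ℤ) * c - q.num * s| * |c| ≤ 1 * 1 := by gcongr
    linarith
  refine ⟨q.den, q.num, ?_, hcr1, ?_, ?_⟩
  · rw [Int.isCoprime_iff_gcd_eq_one, Int.gcd_comm]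
    exact q.reduced
  · calc _ ≤ |(q.den : ℤ) * s + q.num * c| * (|s| / (n + 1)) := by gcongr
      _ = (|(q.den : ℤ) * s + q.num * c| * |s|) / (n + 1) := by ring
      _ ≤ 1 := by rw [div_le_one hn1]; exact hds
  · nlinarith [abs_nonneg (((q.den : ℤ) : ℝ) * s + q.num * c)]

/-- Dirichlet's theorem: a primitive lattice vector close to the direction `(sin α, cos α)`. -/
lemma exists_lattice_approx (α : ℝ) (n : ℕ) (hn : 0 < n) : ∃ e : ℤ × ℤ, IsCoprime e.1 e.2 ∧
    0 < dotU e α ∧ |crossU e α| ≤ 1 / (n + 1) ∧ dotU e α * |crossU e α| ≤ 1 ∧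
      dotU e α ≤ 2 * (n + 1) := by
  obtain ⟨e, h0, h1, h2, h3⟩ : ∃ e : ℤ × ℤ, IsCoprime e.1 e.2 ∧ |crossU e α| ≤ 1 / (n + 1) ∧
      |dotU e α| * |crossU e α| ≤ 1 ∧ |dotU e α| ≤ 2 * (n + 1) := by
    have hsc := Real.sin_sq_add_cos_sq α
    rcases le_total (1 / 2) (Real.sin α ^ 2) with h | h
    · obtain ⟨k, j, h0, h1, h2, h3⟩ := exists_coprime_approx hsc h n hn
      exact ⟨(k, j), h0, h1, h2, h3⟩
    · obtain ⟨k, j, h0, h1, h2, h3⟩ := exists_coprime_approx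
        (s := Real.cos α) (c := Real.sin α) (by linarith) (by linarith) n hn
      have e1 : crossU (j, k) α = -(k * Real.sin α - j * Real.cos α) := by simp [crossU]
      have e2 : dotU (j, k) α = k * Real.cos α + j * Real.sin α := by simp [dotU]; ring
      refine ⟨(j, k), h0.symm, ?_⟩
      rw [e1, e2, abs_neg]
      exact ⟨h1, h2, h3⟩
  have hd0 : dotU e α ≠ 0 := by
    intro hd
    have he : e ≠ 0 := by
      rintro rfl
      exact not_isCoprime_zero_zero h0
    have h4 := dotU_sq_add_crossU_sq e α
    have h5 := one_le_norm_latticePoint he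
    have h6 : (1 : ℝ) / (n + 1) ≤ 1 / 2 := by
      have : (1 : ℝ) ≤ n := by exact_mod_cast hn
      gcongr; linarith
    rw [hd] at h4
    have h7 : |crossU e α| ^ 2 = crossU e α ^ 2 := sq_abs _
    nlinarith [abs_nonneg (crossU e α)]
  rcases lt_or_gt_of_ne hd0 with h | h
  · refine ⟨-e, h0.neg_neg, ?_, ?_, ?_, ?_⟩
    · rw [dotU_neg]; linarith
    · rwa [crossU_neg, abs_neg]
    · rwa [crossU_neg, abs_neg, dotU_neg, ← abs_of_neg h]
    · rwa [dotU_neg, ← abs_of_neg h]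
  · rw [abs_of_pos h] at h2 h3
    exact ⟨e, h0, h, h1, h2, h3⟩

/-- A ray that does not start tangentially does not escape to infinity. -/
lemma hitTimes_nonempty {ε : ℝ} (hε0 : 0 < ε) (hε : ε < 1 / 2) {a f : ℝ} (hf : 0 < Real.cos f) :
    (hitTimes ε (point a f)).Nonempty := by
  have hs : |Real.sin f| < 1 := by
    apply abs_lt_of_sq_lt_sq _ zero_le_one
    nlinarith [Real.sin_sq_add_cos_sq f]
  have hδ : 0 < ε - ε * |Real.sin f| := by nlinarith
  obtain ⟨n, hn⟩ := exists_nat_one_div_lt (K := ℝ) hδ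
  obtain ⟨e, h0, h1, h2, -, -⟩ := exists_lattice_approx (a + f) (n + 1) n.succ_pos
  have h3 : |crossU e (a + f)| ≤ ε - ε * |Real.sin f| := by
    refine h2.trans (le_trans ?_ hn.le)
    push_cast
    gcongr; linarith
  have he : e ≠ 0 := by
    rintro rfl
    exact not_isCoprime_zero_zero h0
  have h5 : ε < dotU e (a + f) := by
    have h4 := dotU_sq_add_crossU_sq e (a + f)
    have h5 := one_le_norm_latticePoint he
    have h6 : |crossU e (a + f)| ^ 2 = crossU e (a + f) ^ 2 := sq_abs _
    have h7 : |crossU e (a + f)| ≤ ε := by nlinarith [abs_nonneg (Real.sin f)]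
    nlinarith [abs_nonneg (crossU e (a + f))]
  refine ⟨dotU e (a + f) - ε * Real.cos f, ?_, e, ?_⟩
  · nlinarith [Real.cos_le_one f]
  · rw [norm_ray_sub_le_iff hε0]
    have h8 : |ε * Real.sin f + crossU e (a + f)| ≤ ε := by
      refine (abs_add_le _ _).trans ?_
      rw [abs_mul, abs_of_pos hε0]; linarith
    have h9 := sq_le_sq' (neg_le_of_abs_le h8) (le_of_abs_le h8)
    nlinarith

/-! ### Collisions and their time reversal -/

lemma point_eq_point_iff {a f b g : ℝ} :
    point a f = point b g ↔ (a : Real.Angle) = (b : Real.Angle) ∧ f = g := by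
  unfold point
  rw [WithLp.toLp_injective 2 |>.eq_iff, Prod.mk.injEq]

lemma displacement_spec {ε : ℝ} {x : Cylinder} {ℓ : ℤ × ℤ}
    (h : ‖nextPoint ε x - latticePoint ℓ‖ ≤ ε) :
    ‖nextPoint ε x - latticePoint (displacement ε x)‖ ≤ ε :=
  Classical.epsilon_spec (p := fun ℓ : ℤ × ℤ => ‖nextPoint ε x - latticePoint ℓ‖ ≤ ε) ⟨ℓ, h⟩

lemma displacement_eq {ε : ℝ} (hε0 : 0 < ε) (hε : ε < 1 / 2) {x : Cylinder} {ℓ : ℤ × ℤ}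
    (h : ‖nextPoint ε x - latticePoint ℓ‖ ≤ ε) : displacement ε x = ℓ := by
  have h' := displacement_spec h
  obtain ⟨a, ha⟩ := exists_point_eq x
  rw [ha] at h h' ⊢
  rw [nextPoint, norm_ray_sub_le_iff hε0] at h h'
  exact eq_of_mem_disks hε hε0 h' h

lemma sq_add_sq_le_of_chord {ε u f : ℝ} (h1 : -(ε * Real.cos f) ≤ u) (h2 : u ≤ ε * Real.cos f) :
    u ^ 2 + (ε * Real.sin f) ^ 2 ≤ ε ^ 2 := by
  have h3 := sq_le_sq' h1 h2
  have h4 : ε ^ 2 = (ε * Real.cos f) ^ 2 + (ε * Real.sin f) ^ 2 := by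
    linear_combination -ε ^ 2 * Real.sin_sq_add_cos_sq f
  linarith

/-- A ray that enters a disk for the first time at time `τ` meets its boundary from outside. -/
lemma eq_and_nonpos_of_first_hit {ε τ A B : ℝ} (hτ : 0 < τ)
    (h : (τ + A) ^ 2 + B ^ 2 ≤ ε ^ 2)
    (h' : ∀ t, 0 < t → t < τ → ¬ (t + A) ^ 2 + B ^ 2 ≤ ε ^ 2) :
    (τ + A) ^ 2 + B ^ 2 = ε ^ 2 ∧ τ + A ≤ 0 := by
  have h1 : τ + A ≤ 0 := by
    by_contra hc
    push Not at hc
    -- If the ray is past its closest point at time `τ`, then a slightly earlier positive time is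
    -- nearer to the centre, hence also a hit.
    refine h' (max (τ / 2) (-A)) (by positivity) (max_lt (by linarith) (by linarith)) ?_
    have h2 : 0 ≤ max (τ / 2) (-A) + A := by linarith [le_max_right (τ / 2) (-A)]
    have h3 : max (τ / 2) (-A) + A ≤ τ + A := by
      linarith [max_le (by linarith : τ / 2 ≤ τ) (by linarith : -A ≤ τ)]
    nlinarith
  refine ⟨le_antisymm h ?_, h1⟩
  by_contra hc
  push Not at hc
  have hr : -(τ + A) < √(ε ^ 2 - B ^ 2) := by
    apply Real.lt_sqrt_of_sq_lt
    nlinarith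
  have hr2 : √(ε ^ 2 - B ^ 2) ^ 2 = ε ^ 2 - B ^ 2 := Real.sq_sqrt (by nlinarith [sq_nonneg (τ + A)])
  set r := √(ε ^ 2 - B ^ 2)
  -- `-A - r` is the time at which the full line enters the disk. It precedes `τ` if the point at
  -- time `τ` is interior.
  refine h' (max (τ / 2) (-A - r)) (by positivity) (max_lt (by linarith) (by linarith)) ?_
  have h2 : -r ≤ max (τ / 2) (-A - r) + A := by linarith [le_max_right (τ / 2) (-A - r)]
  have h3 : max (τ / 2) (-A - r) + A ≤ τ + A := by
    linarith [max_le (by linarith : τ / 2 ≤ τ) (by linarith : -A - r ≤ τ)]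
  nlinarith

/-- The geometry of a collision `T (a, f) = (θ, φ)`, seen from the scatterer of arrival. -/
lemma collision_spec {ε : ℝ} (hε0 : 0 < ε) (hε : ε < 1 / 2) {a f θ φ : ℝ} (hf : 0 ≤ Real.cos f)
    (hne : (hitTimes ε (point a f)).Nonempty) (hT : billiardMap ε (point a f) = point θ φ) :
    ε * Real.sin f = offset ε φ (θ - φ) (-displacement ε (point a f)) ∧
    0 < flightTime ε (point a f) ∧
    flightTime ε (point a f) =
      dotU (-displacement ε (point a f)) (θ - φ) - ε * Real.cos f - ε * Real.cos φ ∧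
    (∀ m', 0 < dotU m' (θ - φ) → dotU m' (θ - φ) < dotU (-displacement ε (point a f)) (θ - φ) →
      ε < |offset ε φ (θ - φ) m'|) ∧
    (a : Real.Angle) = ((θ - φ + π - f : ℝ) : Real.Angle) ∧ φ ∈ Icc (-(π / 2)) (π / 2) := by
  obtain ⟨⟨hτ, ℓ₀, hℓ₀⟩, hleast⟩ := isLeast_flightTime hε0 hε hf hne
  set τ := flightTime ε (point a f) with hτdef
  have hhit : ‖nextPoint ε (point a f) - latticePoint (displacement ε (point a f))‖ ≤ ε :=
    displacement_spec hℓ₀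
  set ℓ := displacement ε (point a f) with hℓdef
  rw [billiardMap, point_eq_point_iff] at hT
  obtain ⟨hN, hφ⟩ := hT
  set N := nextAngle ε (point a f) with hNdef
  have hsN : Real.sin N = Real.sin θ := by
    rw [← Real.Angle.sin_coe, hN, Real.Angle.sin_coe]
  have hcN : Real.cos N = Real.cos θ := by
    rw [← Real.Angle.cos_coe, hN, Real.Angle.cos_coe]
  have hhit' := (norm_ray_sub_le_iff hε0 _ _ _ _).mp hhit
  have hfirst := eq_and_nonpos_of_first_hit (A := ε * Real.cos f - dotU ℓ (a + f))
    (B := ε * Real.sin f + crossU ℓ (a + f)) hτ (by rw [← add_sub_assoc]; exact hhit') (by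
      intro t h0 h1 h2
      rw [← add_sub_assoc, ← norm_ray_sub_le_iff hε0] at h2
      exact absurd (hleast ⟨h0, ℓ, h2⟩) (not_le.mpr h1))
  obtain ⟨heq, hin⟩ := hfirst
  have hnorm : ‖nextPoint ε (point a f) - latticePoint ℓ‖ = ε := by
    refine (sq_eq_sq₀ (norm_nonneg _) hε0.le).mp ?_
    rw [nextPoint, norm_ray_sub_sq, ← heq]; ring
  have hval : nextPoint ε (point a f) - latticePoint ℓ =
      ⟨ε * Real.sin a + τ * Real.sin (a + f) - ℓ.1, ε * Real.cos a + τ * Real.cos (a + f) - ℓ.2⟩ :=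
    ray_sub_latticePoint ε a f τ ℓ
  set z : ℂ := ⟨(nextPoint ε (point a f) - latticePoint ℓ).im,
    (nextPoint ε (point a f) - latticePoint ℓ).re⟩ with hz
  have hznorm : ‖z‖ = ε := by
    rw [← hnorm]
    refine (sq_eq_sq₀ (norm_nonneg _) (norm_nonneg _)).mp ?_
    rw [← Complex.normSq_eq_norm_sq, ← Complex.normSq_eq_norm_sq, Complex.normSq_apply,
      Complex.normSq_apply]
    simp [hz]; ring
  have hz0 : z ≠ 0 := by rw [← norm_ne_zero_iff, hznorm]; exact hε0.ne'
  have hNz : N = Complex.arg z := rfl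
  have e1 : ε * Real.cos a + τ * Real.cos (a + f) - ℓ.2 = ε * Real.cos θ := by
    rw [← hcN, hNz, Complex.cos_arg hz0, hznorm, hz, hval]; field_simp
  have e2 : ε * Real.sin a + τ * Real.sin (a + f) - ℓ.1 = ε * Real.sin θ := by
    rw [← hsN, hNz, Complex.sin_arg, hznorm, hz, hval]; field_simp
  rw [hcN, hsN, velocity_point] at hφ
  obtain ⟨ψ, hψ⟩ : ∃ ψ, ψ = a + f := ⟨_, rfl⟩
  have ha : a = ψ - f := by rw [hψ]; ring
  rw [← hψ] at e1 e2 hin heq hφ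
  rw [ha, Real.cos_sub] at e1
  rw [ha, Real.sin_sub] at e2
  have hψ1 := Real.sin_sq_add_cos_sq ψ
  have hal : τ + (ε * Real.cos f - dotU ℓ ψ) = ε * Real.cos (ψ - θ) := by
    rw [Real.cos_sub, dotU]
    linear_combination Real.sin ψ * e2 + Real.cos ψ * e1 - (ε * Real.cos f + τ) * hψ1
  have hcr : ε * Real.sin f + crossU ℓ ψ = ε * Real.sin (ψ - θ) := by
    rw [Real.sin_sub, crossU]
    linear_combination -Real.cos ψ * e2 + Real.sin ψ * e1 - ε * Real.sin f * hψ1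
  have hsφ : Real.sin φ = Real.sin (ψ - θ) := by
    have : Real.sin ψ * Real.cos θ - Real.cos ψ * Real.sin θ = Real.sin (ψ - θ) := by
      rw [Real.sin_sub]
    simp only [this] at hφ
    rw [← hφ, Real.sin_arcsin (Real.neg_one_le_sin _) (Real.sin_le_one _)]
  have hφI : φ ∈ Icc (-(π / 2)) (π / 2) := by
    rw [← hφ]; exact ⟨Real.neg_pi_div_two_le_arcsin _, Real.arcsin_le_pi_div_two _⟩
  have hcφ : Real.cos φ = -Real.cos (ψ - θ) := by
    have h1 : 0 ≤ Real.cos φ := Real.cos_nonneg_of_mem_Icc hφI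
    have h2 : Real.cos (ψ - θ) ≤ 0 := by
      rw [hal] at hin
      by_contra hc
      push Not at hc
      have : 0 < ε * Real.cos (ψ - θ) := by positivity
      linarith
    have h3 := Real.sin_sq_add_cos_sq φ
    have h4 := Real.sin_sq_add_cos_sq (ψ - θ)
    rw [hsφ] at h3
    refine (sq_eq_sq₀ h1 (by linarith)).mp ?_
    linarith
  -- The incoming direction is opposite to the reversed ray, whose angle is `θ - φ`.
  have hang : ((ψ : ℝ) : Real.Angle) = ((θ - φ + π : ℝ) : Real.Angle) := by
    have h1 : ((ψ - θ : ℝ) : Real.Angle) = ((π - φ : ℝ) : Real.Angle) := by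
      apply Real.Angle.cos_sin_inj
      · rw [Real.cos_pi_sub, hcφ, neg_neg]
      · rw [Real.sin_pi_sub, hsφ]
    have h2 : ψ = (ψ - θ) + θ := by ring
    rw [h2, Real.Angle.coe_add, h1, ← Real.Angle.coe_add]
    congr 1; ring
  have hsψ : Real.sin ψ = -Real.sin (θ - φ) := by
    rw [← Real.Angle.sin_coe, hang, Real.Angle.sin_coe, Real.sin_add_pi]
  have hcψ : Real.cos ψ = -Real.cos (θ - φ) := by
    rw [← Real.Angle.cos_coe, hang, Real.Angle.cos_coe, Real.cos_add_pi]
  have hdot : ∀ m, dotU m ψ = -dotU m (θ - φ) := by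
    intro m; rw [dotU, dotU, hsψ, hcψ]; ring
  have hcross : ∀ m, crossU m ψ = -crossU m (θ - φ) := by
    intro m; rw [crossU, crossU, hsψ, hcψ]; ring
  have hoff : ε * Real.sin f = offset ε φ (θ - φ) (-ℓ) := by
    rw [offset, crossU_neg, hsφ, ← hcr, hcross]; ring
  have hD : dotU (-ℓ) (θ - φ) = dotU ℓ ψ := by rw [dotU_neg, hdot]
  have hflight : τ = dotU (-ℓ) (θ - φ) - ε * Real.cos f - ε * Real.cos φ := by
    rw [hD, hcφ]; linarith
  refine ⟨hoff, hτ, hflight, ?_, ?_, hφI⟩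
  -- The scatterer `m'`, seen from the arrival, is `ℓ + m'` seen from the departure. Its closest
  -- point on the line would lie on the chord of the departure disk, on the free path, or on the
  -- chord of the arrival disk. The outer cases contradict disjointness of the disks, the middle one
  -- minimality of the flight time.
  · intro m' h0 h1
    by_contra hc
    push Not at hc
    have hoff' : ε * Real.sin f + crossU (ℓ + m') ψ = offset ε φ (θ - φ) m' := by
      rw [hoff, offset, offset, hcross, crossU_neg, crossU_add]; ring
    have hD' : dotU (ℓ + m') ψ = dotU ℓ ψ - dotU m' (θ - φ) := by
      rw [dotU_add, hdot m']; ring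
    have hsq := sq_le_sq' (neg_le_of_abs_le hc) (le_of_abs_le hc)
    have hpos : 0 < dotU (ℓ + m') ψ := by rw [hD', ← hD]; linarith
    have hmem' : ((dotU (ℓ + m') ψ) - dotU (ℓ + m') ψ) ^ 2 +
        (ε * Real.sin f + crossU (ℓ + m') ψ) ^ 2 ≤ ε ^ 2 := by
      rw [hoff', sub_self]; linarith
    have hfpos : 0 ≤ ε * Real.cos f := by positivity
    have hφpos : 0 ≤ ε * Real.cos φ := mul_nonneg hε0.le (Real.cos_nonneg_of_mem_Icc hφI)
    rcases le_or_gt (dotU (ℓ + m') ψ) (ε * Real.cos f) with h2 | h2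
    · have hmem0 : (dotU (ℓ + m') ψ - dotU 0 ψ) ^ 2 + (ε * Real.sin f + crossU 0 ψ) ^ 2 ≤ ε ^ 2 := by
        rw [dotU_zero, crossU_zero, sub_zero, add_zero]
        exact sq_add_sq_le_of_chord (by linarith) h2
      have := eq_of_mem_disks hε hε0 hmem' hmem0
      rw [this, dotU_zero] at hpos
      exact lt_irrefl _ hpos
    · rcases lt_or_ge (dotU (ℓ + m') ψ - ε * Real.cos f) τ with h3 | h3
      · refine absurd (hleast ⟨sub_pos.mpr h2, ℓ + m', ?_⟩) (not_le.mpr h3)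
        rw [norm_ray_sub_le_iff hε0, ← hψ, sub_add_cancel]
        exact hmem'
      · have hmem1 : (dotU (ℓ + m') ψ - dotU ℓ ψ) ^ 2 + (ε * Real.sin f + crossU ℓ ψ) ^ 2
            ≤ ε ^ 2 := by
          have h5 : -(ε * Real.cos φ) ≤ dotU (ℓ + m') ψ - dotU ℓ ψ := by
            rw [hcφ]; linarith
          have h6 : dotU (ℓ + m') ψ - dotU ℓ ψ ≤ 0 := by rw [hD']; linarith
          rw [hcr, ← hsφ]
          exact sq_add_sq_le_of_chord h5 (by linarith)
        have := eq_of_mem_disks hε hε0 hmem' hmem1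
        rw [this] at hD'
        linarith
  · rw [ha, Real.Angle.coe_sub, hang, ← Real.Angle.coe_sub]

/-- The outgoing angle at the scatterer `m` of the ray that arrives from `m` at the scatterer at the
origin and leaves it, with time reversed, in the direction `(sin α, cos α)`. -/
def backAngle (ε φ α : ℝ) (m : ℤ × ℤ) : ℝ := Real.arcsin (offset ε φ α m / ε)

/-- The preimage of `(θ, φ)` under the billiard map on the scatterer `m`. -/
def backPoint (ε θ φ : ℝ) (m : ℤ × ℤ) : Cylinder :=
  point (θ - φ + π - backAngle ε φ (θ - φ) m) (backAngle ε φ (θ - φ) m)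

lemma sin_backAngle {ε φ α : ℝ} {m : ℤ × ℤ} (hε0 : 0 < ε) (h : |offset ε φ α m| ≤ ε) :
    ε * Real.sin (backAngle ε φ α m) = offset ε φ α m := by
  obtain ⟨h1, h2⟩ := abs_le.mp h
  rw [backAngle, Real.sin_arcsin]
  · field_simp
  · rw [le_div_iff₀ hε0]; linarith
  · rw [div_le_one hε0]; exact h2

lemma cos_backAngle_pos {ε φ α : ℝ} {m : ℤ × ℤ} (hε0 : 0 < ε) (h : |offset ε φ α m| < ε) :
    0 < Real.cos (backAngle ε φ α m) := by
  obtain ⟨h1, h2⟩ := abs_lt.mp h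
  rw [backAngle, Real.cos_arcsin]
  apply Real.sqrt_pos.mpr
  have h3 : offset ε φ α m ^ 2 < ε ^ 2 := sq_lt_sq' h1 h2
  rw [div_pow, sub_pos, div_lt_one (by positivity)]
  exact h3

lemma backAngle_mem_Ioo {ε φ α : ℝ} {m : ℤ × ℤ} (hε0 : 0 < ε) (h : |offset ε φ α m| < ε) :
    backAngle ε φ α m ∈ Ioo (-(π / 2)) (π / 2) := by
  obtain ⟨h1, h2⟩ := abs_lt.mp h
  constructor
  · apply Real.neg_pi_div_two_lt_arcsin.mpr
    rw [lt_div_iff₀ hε0]; linarith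
  · apply Real.arcsin_lt_pi_div_two.mpr
    rw [div_lt_one hε0]; exact h2

/-- A visible scatterer is at a positive distance along the ray. -/
lemma chord_lt_dotU {ε φ f α : ℝ} {m : ℤ × ℤ} (hε0 : 0 < ε) (hε : ε < 1 / 2)
    (hφ : 0 ≤ Real.cos φ) (hf : 0 ≤ Real.cos f) (hD : 0 < dotU m α)
    (hb : ε * Real.sin f = offset ε φ α m) : ε * Real.cos f + ε * Real.cos φ < dotU m α := by
  by_contra hc
  push Not at hc
  have h1 : 0 ≤ ε * Real.cos φ := by positivity
  have h2 : 0 ≤ ε * Real.cos f := by positivity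
  -- `A` is a position along the line; if it lies on the chords of both disks, the disks intersect.
  -- When the chords are not separated in the right order, one of the two positions tried below does
  -- this.
  have key : ∀ A, -(ε * Real.cos φ) ≤ A → A ≤ ε * Real.cos φ →
      -(ε * Real.cos f) ≤ A - dotU m α → A - dotU m α ≤ ε * Real.cos f → False := by
    intro A h3 h4 h5 h6
    have h7 := sq_add_sq_le_of_chord h3 h4
    have h8 := sq_add_sq_le_of_chord h5 h6
    rw [hb, offset] at h8
    have h9 : (A - dotU 0 α) ^ 2 + (-(ε * Real.sin φ) + crossU 0 α) ^ 2 ≤ ε ^ 2 := by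
      rw [dotU_zero, crossU_zero]; linarith
    have h10 : (A - dotU m α) ^ 2 + (-(ε * Real.sin φ) + crossU m α) ^ 2 ≤ ε ^ 2 := by
      linarith
    have h11 := eq_of_mem_disks hε hε0 h9 h10
    rw [← h11, dotU_zero] at hD
    exact lt_irrefl _ hD
  rcases le_total (dotU m α) (ε * Real.cos φ) with h | h
  · exact key (dotU m α) (by linarith) h (by linarith) (by linarith)
  · exact key (ε * Real.cos φ) (by linarith) le_rfl (by linarith) (by linarith)

/-- Reversibility: visibility of `m` along the reversed ray says that nothing stands between `m` and
the origin, so the ray from `m` flies exactly the gap between the two chords. This is the converse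
of `eq_backPoint`. -/
lemma backPoint_spec {ε θ φ : ℝ} {m : ℤ × ℤ} (hε0 : 0 < ε) (hε : ε < 1 / 2)
    (hφ : φ ∈ Icc (-(π / 2)) (π / 2)) (hm : Visible ε φ (θ - φ) m) :
    billiardMap ε (backPoint ε θ φ m) = point θ φ ∧ displacement ε (backPoint ε θ φ m) = -m := by
  obtain ⟨hb, hD, hvis⟩ := hm
  have hsin := sin_backAngle hε0 hb.le
  have hcos := cos_backAngle_pos hε0 hb
  have hcφ := Real.cos_nonneg_of_mem_Icc hφ
  have hτ := chord_lt_dotU hε0 hε hcφ hcos.le hD hsin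
  rw [backPoint]
  set f := backAngle ε φ (θ - φ) m with hfdef
  obtain ⟨a, ha⟩ : ∃ a, a = θ - φ + π - f := ⟨_, rfl⟩
  have haf : a + f = (θ - φ) + π := by rw [ha]; ring
  rw [← ha]
  set τ := dotU m (θ - φ) - ε * Real.cos f - ε * Real.cos φ with hτdef
  have hdot : ∀ ℓ, dotU ℓ (a + f) = dotU m (θ - φ) - dotU (ℓ + m) (θ - φ) := by
    intro ℓ; rw [haf, dotU_add_pi, dotU_add]; ring
  have hcross : ∀ ℓ, ε * Real.sin f + crossU ℓ (a + f) = offset ε φ (θ - φ) (ℓ + m) := by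
    intro ℓ; rw [hsin, haf, crossU_add_pi, offset, offset, crossU_add]; ring
  have hcφ' : 0 ≤ ε * Real.cos φ := by positivity
  have hcf' : 0 < ε * Real.cos f := by positivity
  have hoff0 : offset ε φ (θ - φ) 0 = ε * Real.sin φ := by rw [offset, crossU_zero, sub_zero]
  have hsc := Real.sin_sq_add_cos_sq φ
  have hhit : ‖position ε (point a f) + (τ : ℂ) * velocity (point a f) - latticePoint (-m)‖ ≤ ε := by
    rw [norm_ray_sub_le_iff hε0, hdot, hcross, neg_add_cancel, dotU_zero, hoff0, sub_zero]
    exact sq_add_sq_le_of_chord (by linarith) (by linarith)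
  have hleast : IsLeast (hitTimes ε (point a f)) τ := by
    refine ⟨⟨by linarith, -m, hhit⟩, ?_⟩
    rintro t ⟨ht, ℓ', hℓ'⟩
    by_contra hlt
    push Not at hlt
    have hsq := (norm_ray_sub_le_iff hε0 _ _ _ _).mp hℓ'
    have hb' : |offset ε φ (θ - φ) (ℓ' + m)| ≤ ε := by
      rw [← hcross]
      apply abs_le_of_sq_le_sq _ hε0.le
      nlinarith [sq_nonneg (t + ε * Real.cos f - dotU ℓ' (a + f))]
    have hd := hdot ℓ'
    -- A hit before `τ` is located by the closest point of the line to the disk. If that point is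
    -- beyond the centre of arrival, the disk also contains the ray at time `τ`; if it is behind the
    -- centre of departure, the disk contains the ray at time `0`. Disjointness then identifies the
    -- disk. In between, visibility excludes it.
    rcases le_or_gt (dotU (ℓ' + m) (θ - φ)) 0 with h1 | h1
    · have h2 : (τ + ε * Real.cos f - dotU ℓ' (a + f)) ^ 2 +
          (ε * Real.sin f + crossU ℓ' (a + f)) ^ 2 ≤ ε ^ 2 := by
        have : (τ + ε * Real.cos f - dotU ℓ' (a + f)) ^ 2 ≤
            (t + ε * Real.cos f - dotU ℓ' (a + f)) ^ 2 := by
          have h3 : τ + ε * Real.cos f - dotU ℓ' (a + f) ≤ 0 := by rw [hd]; linarith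
          nlinarith
        linarith
      have h3 := eq_of_mem_disks hε hε0 h2 ((norm_ray_sub_le_iff hε0 _ _ _ _).mp hhit)
      rw [h3, hdot, hcross, neg_add_cancel, dotU_zero, hoff0, sub_zero] at hsq
      have h4 : t + ε * Real.cos f - dotU m (θ - φ) < -(ε * Real.cos φ) := by linarith
      nlinarith
    · rcases lt_or_ge (dotU (ℓ' + m) (θ - φ)) (dotU m (θ - φ)) with h2 | h2
      · exact absurd hb' (not_le.mpr (hvis _ h1 h2))
      · have h3 : (0 + ε * Real.cos f - dotU ℓ' (a + f)) ^ 2 +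
            (ε * Real.sin f + crossU ℓ' (a + f)) ^ 2 ≤ ε ^ 2 := by
          have : (0 + ε * Real.cos f - dotU ℓ' (a + f)) ^ 2 ≤
              (t + ε * Real.cos f - dotU ℓ' (a + f)) ^ 2 := by
            have h3 : 0 ≤ 0 + ε * Real.cos f - dotU ℓ' (a + f) := by rw [hd]; linarith
            nlinarith
          linarith
        have h4 := eq_of_mem_disks hε hε0 h3 (hit_start f (a + f))
        rw [h4] at hℓ'
        exact not_hit_zero hε0 a hcos.le ht hℓ'
  have hfl : flightTime ε (point a f) = τ := hleast.csInf_eq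
  have hdisp : displacement ε (point a f) = -m := by
    apply displacement_eq hε0 hε
    rw [nextPoint, hfl]; exact hhit
  refine ⟨?_, hdisp⟩
  have hs1 : Real.sin (a + f) = -Real.sin (θ - φ) := by rw [haf, Real.sin_add_pi]
  have hc1 : Real.cos (a + f) = -Real.cos (θ - φ) := by rw [haf, Real.cos_add_pi]
  have hpt : nextPoint ε (point a f) - latticePoint (-m) = ⟨ε * Real.sin θ, ε * Real.cos θ⟩ := by
    rw [nextPoint, hfl, ray_sub_latticePoint, hs1, hc1, ha]
    have h1 := Real.sin_sq_add_cos_sq (θ - φ)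
    have e0 : θ - φ + π - f = (θ - φ - f) + π := by ring
    rw [e0, Real.sin_add_pi, Real.cos_add_pi, Real.sin_sub (θ - φ) f, Real.cos_sub (θ - φ) f]
    have e1 : Real.sin θ = Real.sin (θ - φ) * Real.cos φ + Real.cos (θ - φ) * Real.sin φ := by
      rw [← Real.sin_add]; ring_nf
    have e2 : Real.cos θ = Real.cos (θ - φ) * Real.cos φ - Real.sin (θ - φ) * Real.sin φ := by
      rw [← Real.cos_add]; ring_nf
    rw [e1, e2]
    have hs' : ε * Real.sin f = ε * Real.sin φ - crossU m (θ - φ) := hsin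
    have hτ' := hτdef
    simp only [dotU, crossU] at hs' hτ'
    apply Complex.ext <;> simp
    · linear_combination Real.cos (θ - φ) * hs' - Real.sin (θ - φ) * hτ' - m.1 * h1
    · linear_combination -Real.sin (θ - φ) * hs' - Real.cos (θ - φ) * hτ' - m.2 * h1
  have hN : ((nextAngle ε (point a f) : ℝ) : Real.Angle) = (θ : Real.Angle) := by
    rw [nextAngle, hdisp, hpt]
    have : (⟨ε * Real.cos θ, ε * Real.sin θ⟩ : ℂ) =
        (ε : ℂ) * (Complex.cos θ + Complex.sin θ * Complex.I) := by
      apply Complex.ext <;> simp [← Complex.ofReal_cos, ← Complex.ofReal_sin]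
    simp only [this]
    have h := Complex.arg_mul_cos_add_sin_mul_I_coe_angle hε0 (θ : Real.Angle)
    simp only [Real.Angle.cos_coe, Real.Angle.sin_coe, Complex.ofReal_cos, Complex.ofReal_sin] at h
    exact h
  rw [billiardMap, point_eq_point_iff]
  refine ⟨hN, ?_⟩
  have hsN : Real.sin (nextAngle ε (point a f)) = Real.sin θ := by
    rw [← Real.Angle.sin_coe, hN, Real.Angle.sin_coe]
  have hcN : Real.cos (nextAngle ε (point a f)) = Real.cos θ := by
    rw [← Real.Angle.cos_coe, hN, Real.Angle.cos_coe]
  rw [hsN, hcN, velocity_point]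
  simp only [hs1, hc1]
  have : -Real.sin (θ - φ) * Real.cos θ - -Real.cos (θ - φ) * Real.sin θ = Real.sin φ := by
    have : φ = θ - (θ - φ) := by ring
    conv_rhs => rw [this, Real.sin_sub]
    ring
  rw [this, Real.arcsin_sin hφ.1 hφ.2]

lemma cos_pos_of_notMem_singularSetZero {x : Cylinder} (hx : x ∈ phaseSpace)
    (hx0 : x ∉ singularSetZero) : 0 < Real.cos x.snd := by
  simp only [singularSetZero, mem_ofPred_eq, not_or] at hx0
  exact Real.cos_pos_of_mem_Ioo ⟨lt_of_le_of_ne hx.1 (Ne.symm hx0.2), lt_of_le_of_ne hx.2 hx0.1⟩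

/-- A regular point is recovered from its image and its displacement. -/
lemma eq_backPoint {ε : ℝ} (hε0 : 0 < ε) (hε : ε < 1 / 2) {x : Cylinder} {θ φ : ℝ}
    (hx : x ∈ phaseSpace) (hx0 : x ∉ singularSetZero) (hT : billiardMap ε x = point θ φ) :
    Visible ε φ (θ - φ) (-displacement ε x) ∧ x = backPoint ε θ φ (-displacement ε x) ∧
      x.snd = backAngle ε φ (θ - φ) (-displacement ε x) ∧ φ ∈ Icc (-(π / 2)) (π / 2) := by
  have hc := cos_pos_of_notMem_singularSetZero hx hx0
  obtain ⟨a, ha⟩ := exists_point_eq x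
  have hfI : x.snd ∈ Icc (-(π / 2)) (π / 2) := hx
  set f := x.snd with hf
  obtain ⟨h1, h2, h3, h4, h5, h6⟩ := collision_spec hε0 hε hc.le (hitTimes_nonempty hε0 hε hc)
    (ha ▸ hT)
  rw [← ha] at h1 h2 h3 h4
  have hcφ : 0 ≤ ε * Real.cos φ := mul_nonneg hε0.le (Real.cos_nonneg_of_mem_Icc h6)
  have hcf : 0 < ε * Real.cos f := by positivity
  have hb : |offset ε φ (θ - φ) (-displacement ε x)| < ε := by
    rw [← h1, abs_mul, abs_of_pos hε0]
    have : |Real.sin f| < 1 := by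
      apply abs_lt_of_sq_lt_sq _ zero_le_one
      nlinarith [Real.sin_sq_add_cos_sq f]
    nlinarith
  have hback : f = backAngle ε φ (θ - φ) (-displacement ε x) := by
    rw [backAngle, ← h1, mul_div_cancel_left₀ _ hε0.ne', Real.arcsin_sin hfI.1 hfI.2]
  refine ⟨⟨hb, by linarith, h4⟩, ?_, hback, h6⟩
  rw [backPoint, ← hback]
  conv_lhs => rw [ha]
  rw [point_eq_point_iff]
  exact ⟨h5, rfl⟩

/-! ### Local constancy of the displacement -/

lemma continuous_position (ε : ℝ) : Continuous (position ε) := by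
  unfold position
  simp only [Complex.mk_eq_add_mul_I]
  have h1 : Continuous fun x : Cylinder => x.fst.sin :=
    Real.Angle.continuous_sin.comp (by fun_prop)
  have h2 : Continuous fun x : Cylinder => x.fst.cos :=
    Real.Angle.continuous_cos.comp (by fun_prop)
  fun_prop

lemma continuous_velocity : Continuous velocity := by
  unfold velocity
  simp only [Complex.mk_eq_add_mul_I]
  have h1 : Continuous fun x : Cylinder => x.fst.sin :=
    Real.Angle.continuous_sin.comp (by fun_prop)
  have h2 : Continuous fun x : Cylinder => x.fst.cos :=
    Real.Angle.continuous_cos.comp (by fun_prop)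
  have h3 : Continuous fun x : Cylinder => x.snd := by fun_prop
  fun_prop

/-- The displacement is locally constant away from the discontinuity set. -/
lemma eventually_displacement_eq {ε : ℝ} (hε0 : 0 < ε) (hε : ε < 1 / 2) {x : Cylinder}
    (hx : x ∈ phaseSpace) (hx1 : x ∉ singularSetOne ε) :
    ∀ᶠ y in nhdsWithin x phaseSpace, displacement ε y = displacement ε x := by
  have hx0 : x ∉ singularSetZero := fun h => hx1 (Or.inl h)
  have hTx : billiardMap ε x ∉ singularSetZero := fun h => hx1 (Or.inr ⟨hx, h⟩)
  obtain ⟨θ, hT⟩ := exists_point_eq (billiardMap ε x)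
  obtain ⟨φ, hφ⟩ : ∃ φ, φ = (billiardMap ε x).snd := ⟨_, rfl⟩
  rw [← hφ] at hT
  obtain ⟨-, hxb, hfb, hφI⟩ := eq_backPoint hε0 hε hx hx0 hT
  have hcf := cos_pos_of_notMem_singularSetZero hx hx0
  have hcφ : 0 < Real.cos φ := by
    simp only [singularSetZero, mem_ofPred_eq, not_or, ← hφ] at hTx
    exact Real.cos_pos_of_mem_Ioo
      ⟨lt_of_le_of_ne hφI.1 (Ne.symm hTx.2), lt_of_le_of_ne hφI.2 hTx.1⟩
  set ℓ := displacement ε x with hℓ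
  set f := x.snd with hf
  obtain ⟨a, haf, hxa⟩ : ∃ a, a + f = θ - φ + π ∧ x = point a f :=
    ⟨θ - φ + π - f, by ring, by rw [hxb, backPoint, ← hfb]⟩
  have hne := hitTimes_nonempty (a := a) hε0 hε hcf
  have hspec := collision_spec hε0 hε hcf.le hne (hxa ▸ hT)
  have hleast := isLeast_flightTime hε0 hε hcf.le hne
  rw [← hxa] at hspec hleast
  obtain ⟨h1, h2, h3, -, -, -⟩ := hspec
  set τ := flightTime ε x with hτ
  have hcφ' : 0 < ε * Real.cos φ := by positivity
  have hdot : dotU ℓ (a + f) = τ + ε * Real.cos f + ε * Real.cos φ := by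
    rw [haf, dotU_add_pi, h3, dotU_neg]; ring
  have hcross : ε * Real.sin f + crossU ℓ (a + f) = ε * Real.sin φ := by
    rw [h1, haf, crossU_add_pi, offset, crossU_neg]; ring
  set T := τ + ε * Real.cos φ with hTdef
  have hT0 : 0 < T := by positivity
  have hstrict : ‖position ε x + (T : ℂ) * velocity x - latticePoint ℓ‖ < ε := by
    have h4 : ‖position ε x + (T : ℂ) * velocity x - latticePoint ℓ‖ ^ 2 < ε ^ 2 := by
      rw [hxa, norm_ray_sub_sq, hdot, hcross]
      have h5 := Real.sin_sq_add_cos_sq φ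
      have h6 : ε ^ 2 = (ε * Real.cos φ) ^ 2 + (ε * Real.sin φ) ^ 2 := by
        linear_combination -ε ^ 2 * h5
      have h7 : T + ε * Real.cos f - (τ + ε * Real.cos f + ε * Real.cos φ) = 0 := by
        rw [hTdef]; ring
      rw [h7, h6]
      have h8 : 0 < (ε * Real.cos φ) ^ 2 := by positivity
      linarith
    exact lt_of_pow_lt_pow_left₀ 2 hε0.le h4
  -- On the compact interval `[0, T]` every third disk is missed by a strict inequality: before `τ`
  -- there is no hit, after `τ` the ray is inside the disk `ℓ`. Only finitely many disks are within
  -- reach, so this persists for nearby rays.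
  have hmiss : ∀ ℓ', ℓ' ≠ 0 → ℓ' ≠ ℓ → ∀ t ∈ Icc 0 T,
      ε < ‖position ε x + (t : ℂ) * velocity x - latticePoint ℓ'‖ := by
    intro ℓ' hℓ0 hℓ1 t ht
    by_contra hc
    push Not at hc
    have hc' := hc
    rw [hxa, norm_ray_sub_le_iff hε0] at hc'
    rcases eq_or_lt_of_le ht.1 with h | h
    · rw [← h] at hc'
      exact hℓ0 (eq_of_mem_disks hε hε0 hc' (hit_start f _))
    · have h4 : τ ≤ t := hleast.2 ⟨h, ℓ', hc⟩
      apply hℓ1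
      refine eq_of_mem_disks hε hε0 hc' ?_
      rw [hdot, hcross]
      apply sq_add_sq_le_of_chord <;> linarith [ht.2]
  have hP := continuous_position ε
  have hV := continuous_velocity
  have ev1 : ∀ᶠ y in nhds x, ‖position ε y + (T : ℂ) * velocity y - latticePoint ℓ‖ < ε := by
    have : Continuous fun y : Cylinder => ‖position ε y + (T : ℂ) * velocity y - latticePoint ℓ‖ := by
      fun_prop
    exact this.continuousAt.eventually_lt continuousAt_const hstrict
  have ev2 : ∀ᶠ y in nhds x, ∀ ℓ' ∈ {ℓ' : ℤ × ℤ | ‖latticePoint ℓ'‖ ≤ T + 1}, ℓ' ≠ 0 → ℓ' ≠ ℓ →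
      ∀ t ∈ Icc 0 T, ε < ‖position ε y + (t : ℂ) * velocity y - latticePoint ℓ'‖ := by
    rw [Filter.eventually_all_finite (finite_norm_latticePoint_le _)]
    intro ℓ' _
    by_cases hℓ0 : ℓ' = 0
    · simp [hℓ0]
    by_cases hℓ1 : ℓ' = ℓ
    · simp [hℓ1]
    have : ∀ᶠ y in nhds x, ∀ t ∈ Icc 0 T,
        ε < ‖position ε y + (t : ℂ) * velocity y - latticePoint ℓ'‖ := by
      apply isCompact_Icc.eventually_forall_of_forall_eventually
      intro t ht
      have hc : Continuous fun z : Cylinder × ℝ =>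
          ‖position ε z.1 + (z.2 : ℂ) * velocity z.1 - latticePoint ℓ'‖ := by
        fun_prop
      exact continuousAt_const.eventually_lt hc.continuousAt (hmiss ℓ' hℓ0 hℓ1 t ht)
    filter_upwards [this] with y hy _ _ using hy
  filter_upwards [nhdsWithin_le_nhds ev1, nhdsWithin_le_nhds ev2, self_mem_nhdsWithin]
    with y hy1 hy2 hy
  obtain ⟨b, hb⟩ := exists_point_eq y
  have hg : 0 ≤ Real.cos y.snd := Real.cos_nonneg_of_mem_Icc hy
  obtain ⟨g, hgy⟩ : ∃ g, g = y.snd := ⟨_, rfl⟩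
  rw [← hgy] at hb hg
  rw [hb] at hy1 hy2 ⊢
  have hl := isLeast_flightTime hε0 hε hg ⟨T, hT0, ℓ, hy1.le⟩
  obtain ⟨⟨h4, ℓ', h5⟩, h6⟩ := hl
  have h7 : flightTime ε (point b g) ≤ T := h6 ⟨hT0, ℓ, hy1.le⟩
  have h8 := norm_latticePoint_le_of_hit hε0 hε h4.le h7 h5
  have h9 : ℓ' ≠ 0 := by
    rintro rfl
    exact not_hit_zero hε0 b hg h4 h5
  have h10 : ℓ' = ℓ := by
    by_contra hc
    exact absurd h5 (not_le.mpr (hy2 ℓ' h8 h9 hc _ ⟨h4.le, h7⟩))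
  rw [h10] at h5
  exact displacement_eq hε0 hε h5

/-! ### Expansion of a divergent front -/

lemma abs_one_sub_cos_le (h : ℝ) : |1 - Real.cos h| ≤ h ^ 2 / 2 := by
  rw [abs_of_nonneg (by linarith [Real.cos_le_one h])]
  linarith [Real.one_sub_sq_div_two_le_cos (x := h)]

lemma abs_sub_sin_le {h : ℝ} (hh : |h| ≤ 1) : |h - Real.sin h| ≤ h ^ 2 / 4 := by
  have key : ∀ x : ℝ, 0 ≤ x → x ≤ 1 → |x - Real.sin x| ≤ x ^ 2 / 4 := by
    intro x h0 h1
    rw [abs_of_nonneg (by linarith [Real.sin_le h0])]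
    rcases eq_or_lt_of_le h0 with h | h
    · simp [← h]
    · have := Real.sin_gt_sub_cube h
      nlinarith [sq_nonneg x, mul_nonneg (sq_nonneg x) (sub_nonneg.mpr h1)]
  rcases le_total 0 h with h0 | h0
  · exact key h h0 ((le_abs_self h).trans hh)
  · have := key (-h) (by linarith) ((neg_le_abs h).trans hh)
    have e : h - Real.sin h = -(-h - -Real.sin h) := by ring
    rw [Real.sin_neg, neg_sq] at this
    rw [e, abs_neg]
    exact this

lemma crossU_add_right (m : ℤ × ℤ) (α h : ℝ) :
    crossU m (α + h) = crossU m α * Real.cos h - dotU m α * Real.sin h := by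
  rw [crossU, crossU, dotU, Real.sin_add, Real.cos_add]; ring

lemma dotU_add_right (m : ℤ × ℤ) (α h : ℝ) :
    dotU m (α + h) = dotU m α * Real.cos h + crossU m α * Real.sin h := by
  rw [crossU, dotU, dotU, Real.sin_add, Real.cos_add]; ring

lemma abs_crossU_sub_le (m : ℤ × ℤ) {α β : ℝ} (h : |β - α| ≤ 1) :
    |crossU m α - crossU m β - (β - α) * dotU m α| ≤ ‖latticePoint m‖ * (β - α) ^ 2 := by
  obtain ⟨k, rfl⟩ : ∃ k, β = α + k := ⟨β - α, by ring⟩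
  rw [add_sub_cancel_left] at *
  have e : crossU m α - crossU m (α + k) - k * dotU m α =
      crossU m α * (1 - Real.cos k) - dotU m α * (k - Real.sin k) := by
    rw [crossU_add_right]; ring
  rw [e]
  refine (abs_sub _ _).trans ?_
  rw [abs_mul, abs_mul]
  have h1 := mul_le_mul (abs_crossU_le m α) (abs_one_sub_cos_le k) (abs_nonneg _) (norm_nonneg _)
  have h2 := mul_le_mul (abs_dotU_le m α) (abs_sub_sin_le h) (abs_nonneg _) (norm_nonneg _)
  nlinarith [mul_nonneg (norm_nonneg (latticePoint m)) (sq_nonneg k)]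

lemma abs_sin_sub_le {φ ψ : ℝ} (h : |ψ - φ| ≤ 1) :
    |Real.sin ψ - Real.sin φ - (ψ - φ) * Real.cos φ| ≤ (ψ - φ) ^ 2 := by
  obtain ⟨k, rfl⟩ : ∃ k, ψ = φ + k := ⟨ψ - φ, by ring⟩
  rw [add_sub_cancel_left] at *
  have e : Real.sin (φ + k) - Real.sin φ - k * Real.cos φ =
      -(Real.sin φ * (1 - Real.cos k) + Real.cos φ * (k - Real.sin k)) := by
    rw [Real.sin_add]; ring
  rw [e, abs_neg]
  refine (abs_add_le _ _).trans ?_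
  rw [abs_mul, abs_mul]
  have h1 := mul_le_mul (Real.abs_sin_le_one φ) (abs_one_sub_cos_le k) (abs_nonneg _) zero_le_one
  have h2 := mul_le_mul (Real.abs_cos_le_one φ) (abs_sub_sin_le h) (abs_nonneg _) zero_le_one
  nlinarith [sq_nonneg k]

lemma abs_dotU_sub_le (m : ℤ × ℤ) (α β : ℝ) :
    |dotU m β - dotU m α| ≤ ‖latticePoint m‖ * |β - α| := by
  obtain ⟨k, rfl⟩ : ∃ k, β = α + k := ⟨β - α, by ring⟩
  rw [add_sub_cancel_left, dotU_add_right]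
  apply abs_le_of_sq_le_sq _ (by positivity)
  rw [mul_pow, sq_abs, ← dotU_sq_add_crossU_sq m α]
  have h1 := Real.one_sub_sq_div_two_le_cos (x := k)
  have h2 := Real.sin_sq_add_cos_sq k
  have h3 : (dotU m α * Real.cos k + crossU m α * Real.sin k - dotU m α) ^ 2 ≤
      (dotU m α ^ 2 + crossU m α ^ 2) * ((Real.cos k - 1) ^ 2 + Real.sin k ^ 2) := by
    nlinarith [sq_nonneg (dotU m α * Real.sin k - crossU m α * (Real.cos k - 1))]
  refine h3.trans (mul_le_mul_of_nonneg_left ?_ (by positivity))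
  nlinarith

lemma abs_crossU_sub_le' (m : ℤ × ℤ) (α β : ℝ) :
    |crossU m β - crossU m α| ≤ ‖latticePoint m‖ * |β - α| := by
  obtain ⟨k, rfl⟩ : ∃ k, β = α + k := ⟨β - α, by ring⟩
  rw [add_sub_cancel_left, crossU_add_right]
  apply abs_le_of_sq_le_sq _ (by positivity)
  rw [mul_pow, sq_abs, ← dotU_sq_add_crossU_sq m α]
  have h1 := Real.one_sub_sq_div_two_le_cos (x := k)
  have h2 := Real.sin_sq_add_cos_sq k
  have h3 : (crossU m α * Real.cos k - dotU m α * Real.sin k - crossU m α) ^ 2 ≤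
      (dotU m α ^ 2 + crossU m α ^ 2) * ((Real.cos k - 1) ^ 2 + Real.sin k ^ 2) := by
    nlinarith [sq_nonneg (crossU m α * Real.sin k + dotU m α * (Real.cos k - 1))]
  refine h3.trans (mul_le_mul_of_nonneg_left ?_ (by positivity))
  nlinarith

/-- The length of the free path to a scatterer that is hit. -/
lemma norm_le_of_hit {ε φ α : ℝ} {m : ℤ × ℤ} (hε0 : 0 < ε) (hε : ε < 1 / 2)
    (hφ : 0 ≤ Real.cos φ) (hb : |offset ε φ α m| ≤ ε) (hD : 0 < dotU m α) :
    (1 - 2 * ε) * ‖latticePoint m‖ ≤ dotU m α - ε * Real.cos φ := by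
  have hcos : 0 ≤ Real.cos (backAngle ε φ α m) := Real.cos_arcsin_nonneg _
  have h1 := chord_lt_dotU hε0 hε hφ hcos hD (sin_backAngle hε0 hb)
  have h2 : 0 ≤ ε * Real.cos (backAngle ε φ α m) := by positivity
  have hm : m ≠ 0 := by rintro rfl; rw [dotU_zero] at hD; exact lt_irrefl _ hD
  have h3 := one_le_norm_latticePoint hm
  have h4 := dotU_sq_add_crossU_sq m α
  have h5 := Real.sin_sq_add_cos_sq φ
  have h6 : Real.cos φ * dotU m α + Real.sin φ * crossU m α ≤ ‖latticePoint m‖ := by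
    apply le_of_abs_le
    apply abs_le_of_sq_le_sq _ (norm_nonneg _)
    rw [← h4]
    have : dotU m α ^ 2 + crossU m α ^ 2 =
      (dotU m α ^ 2 + crossU m α ^ 2) * (Real.sin φ ^ 2 + Real.cos φ ^ 2) := by rw [h5, mul_one]
    rw [this]
    nlinarith [sq_nonneg (Real.cos φ * crossU m α - Real.sin φ * dotU m α)]
  have h7 : offset ε φ α m ^ 2 ≤ ε ^ 2 := sq_le_sq' (neg_le_of_abs_le hb) (le_of_abs_le hb)
  -- The point of departure is at distance at least `‖m‖ - ε` from `m`, and the line passes `m` at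
  -- distance at most `ε`; the squared component along the line is thus at least `(‖m‖ - ε) ^ 2 - ε
  -- ^ 2`.
  have h8 : ‖latticePoint m‖ ^ 2 - 2 * ε * ‖latticePoint m‖ ≤ (dotU m α - ε * Real.cos φ) ^ 2 := by
    rw [offset] at h7
    have e1 : (dotU m α - ε * Real.cos φ) ^ 2 = (dotU m α ^ 2 + crossU m α ^ 2) + ε ^ 2
        - 2 * ε * (Real.cos φ * dotU m α + Real.sin φ * crossU m α)
        - (ε * Real.sin φ - crossU m α) ^ 2 := by
      linear_combination ε ^ 2 * h5
    rw [e1, h4]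
    nlinarith
  refine abs_le_of_sq_le_sq' ?_ (by linarith) |>.2
  have h9 : 0 ≤ ε * (‖latticePoint m‖ * (‖latticePoint m‖ - 1)) :=
    mul_nonneg hε0.le (mul_nonneg (norm_nonneg _) (by linarith))
  have h10 : 0 ≤ ε * ((1 - 2 * ε) * ‖latticePoint m‖ ^ 2) :=
    mul_nonneg hε0.le (mul_nonneg (by linarith) (by positivity))
  linarith

/-- Two scatterers on the same line are far from each other along this line. -/
lemma norm_sub_le_of_hit {ε φ α : ℝ} {m m' : ℤ × ℤ} (hε0 : 0 < ε) (hε : ε < 1 / 2)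
    (hb : |offset ε φ α m| ≤ ε) (hb' : |offset ε φ α m'| ≤ ε) (hD : dotU m' α < dotU m α) :
    (1 - 2 * ε) * ‖latticePoint (m - m')‖ ≤ dotU (m - m') α := by
  have hm : m - m' ≠ 0 := by
    intro h; rw [sub_eq_zero.mp h] at hD; exact lt_irrefl _ hD
  have h3 := one_le_norm_latticePoint hm
  have h4 := dotU_sq_add_crossU_sq (m - m') α
  have h5 : |crossU (m - m') α| ≤ 2 * ε := by
    have : crossU (m - m') α = offset ε φ α m' - offset ε φ α m := by
      rw [crossU_sub, offset, offset]; ring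
    rw [this]
    refine (abs_sub _ _).trans ?_
    linarith
  have h6 : crossU (m - m') α ^ 2 ≤ (2 * ε) ^ 2 :=
    sq_le_sq' (neg_le_of_abs_le h5) (le_of_abs_le h5)
  have h7 : 0 ≤ dotU (m - m') α := by rw [dotU_sub]; linarith
  refine abs_le_of_sq_le_sq' ?_ h7 |>.2
  have h8 : 1 ≤ ‖latticePoint (m - m')‖ ^ 2 := by nlinarith
  have h9 : 0 ≤ ε * ((1 - ε) * (‖latticePoint (m - m')‖ ^ 2 - 1)) :=
    mul_nonneg hε0.le (mul_nonneg (by linarith) (by linarith))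
  have h10 : 0 ≤ ε * (1 - 2 * ε) := mul_nonneg hε0.le (by linarith)
  linarith

/-- To first order in `h = α₂ - α₁` the offset grows by at least `(dotU m α₁ - ε cos φ₁) h`, because
`φ` drops by at most `h`; this is at least `(1 - 2ε) ‖m‖ h`. The quadratic errors total at most `2
‖m‖ h ^ 2`, and `h ≤ (1 - 2ε) / 4` makes them at most half of the main term. Working with two points
only, no derivative of the leaf enters. -/
lemma offset_growth_left {ε ρ φ₁ φ₂ α₁ α₂ : ℝ} {m : ℤ × ℤ} (hε0 : 0 < ε) (hε : ε < 1 / 2)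
    (hρ : ρ ≤ (1 - 2 * ε) / 4) (hφ : φ₂ ≤ φ₁) (hφα : φ₁ - φ₂ ≤ α₂ - α₁) (hα : α₂ - α₁ ≤ ρ)
    (hcos : 0 ≤ Real.cos φ₁) (hm : m ≠ 0)
    (hd : (1 - 2 * ε) * ‖latticePoint m‖ ≤ dotU m α₁ - ε * Real.cos φ₁) :
    (1 - 2 * ε) / 2 * ‖latticePoint m‖ * (α₂ - α₁) ≤ offset ε φ₂ α₂ m - offset ε φ₁ α₁ m := by
  have h1 := one_le_norm_latticePoint hm
  have h2 := (abs_le.mp (abs_crossU_sub_le m (α := α₁) (β := α₂)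
    (by rw [abs_of_nonneg (by linarith)]; linarith))).1
  have h3 := (abs_le.mp (abs_sin_sub_le (φ := φ₁) (ψ := φ₂)
    (by rw [abs_sub_comm, abs_of_nonneg (by linarith)]; linarith))).1
  obtain ⟨h, hh⟩ : ∃ h, h = α₂ - α₁ := ⟨_, rfl⟩
  obtain ⟨k, hk⟩ : ∃ k, φ₂ - φ₁ = -k := ⟨φ₁ - φ₂, by ring⟩
  have hkh : k ≤ h := by linarith
  have hk0 : 0 ≤ k := by linarith
  rw [← hh] at h2 hφα hα ⊢
  rw [hk] at h3
  rw [offset, offset]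
  have h4 : k * (ε * Real.cos φ₁) ≤ h * (ε * Real.cos φ₁) := by gcongr
  have h5 : ε * k ^ 2 ≤ ‖latticePoint m‖ * h ^ 2 := by gcongr; linarith
  have h6 : h * ((1 - 2 * ε) * ‖latticePoint m‖) ≤ h * (dotU m α₁ - ε * Real.cos φ₁) := by
    gcongr; linarith
  have h7 : ‖latticePoint m‖ * h ^ 2 ≤ ‖latticePoint m‖ * (h * ((1 - 2 * ε) / 4)) := by
    rw [pow_two]; gcongr <;> linarith
  have h8 : ε * (-k ^ 2 + -k * Real.cos φ₁) ≤ ε * (Real.sin φ₂ - Real.sin φ₁) := by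
    apply mul_le_mul_of_nonneg_left _ hε0.le
    rw [neg_sq] at h3
    linarith
  linarith

/-- The same estimate expanded at the right end, for use where the distance to `m` is controlled
only there. -/
lemma offset_growth_right {ε ρ φ₁ φ₂ α₁ α₂ : ℝ} {m : ℤ × ℤ} (hε0 : 0 < ε) (hε : ε < 1 / 2)
    (hρ : ρ ≤ (1 - 2 * ε) / 4) (hφ : φ₂ ≤ φ₁) (hφα : φ₁ - φ₂ ≤ α₂ - α₁) (hα : α₂ - α₁ ≤ ρ)
    (hcos : 0 ≤ Real.cos φ₂) (hm : m ≠ 0)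
    (hd : (1 - 2 * ε) * ‖latticePoint m‖ ≤ dotU m α₂ - ε * Real.cos φ₂) :
    (1 - 2 * ε) / 2 * ‖latticePoint m‖ * (α₂ - α₁) ≤ offset ε φ₂ α₂ m - offset ε φ₁ α₁ m := by
  have h1 := one_le_norm_latticePoint hm
  have h2 := (abs_le.mp (abs_crossU_sub_le m (α := α₂) (β := α₁)
    (by rw [abs_sub_comm, abs_of_nonneg (by linarith)]; linarith))).2
  have h3 := (abs_le.mp (abs_sin_sub_le (φ := φ₂) (ψ := φ₁)
    (by rw [abs_of_nonneg (by linarith)]; linarith))).2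
  obtain ⟨h, hh⟩ : ∃ h, h = α₂ - α₁ := ⟨_, rfl⟩
  obtain ⟨k, hk⟩ : ∃ k, φ₁ - φ₂ = k := ⟨φ₁ - φ₂, by ring⟩
  have hkh : k ≤ h := by linarith
  have hk0 : 0 ≤ k := by linarith
  have hh' : α₁ - α₂ = -h := by linarith
  rw [← hh] at hφα hα ⊢
  rw [hh', neg_sq] at h2
  rw [hk] at h3
  rw [offset, offset]
  have h4 : k * (ε * Real.cos φ₂) ≤ h * (ε * Real.cos φ₂) := by gcongr
  have h5 : ε * k ^ 2 ≤ ‖latticePoint m‖ * h ^ 2 := by gcongr; linarith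
  have h6 : h * ((1 - 2 * ε) * ‖latticePoint m‖) ≤ h * (dotU m α₂ - ε * Real.cos φ₂) := by
    gcongr; linarith
  have h7 : ‖latticePoint m‖ * h ^ 2 ≤ ‖latticePoint m‖ * (h * ((1 - 2 * ε) / 4)) := by
    rw [pow_two]; gcongr <;> linarith
  have h8 : ε * (Real.sin φ₁ - Real.sin φ₂) ≤ ε * (k ^ 2 + k * Real.cos φ₂) := by
    apply mul_le_mul_of_nonneg_left _ hε0.le
    linarith
  linarith

/-- Within a short stretch of a divergent front, the part that hits a given scatterer first is
connected: a scatterer in the shadow would have to be wider than the disk behind it. -/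
lemma visible_between {ε ρ φ₁ φ φ₂ α₁ α α₂ : ℝ} {m : ℤ × ℤ} (hε0 : 0 < ε) (hε : ε < 1 / 2)
    (hρ : ρ ≤ (1 - 2 * ε) / 4) (hφ1 : φ ≤ φ₁) (hφα1 : φ₁ - φ ≤ α - α₁)
    (hφ2 : φ₂ ≤ φ) (hφα2 : φ - φ₂ ≤ α₂ - α) (hα : α₂ - α₁ ≤ ρ)
    (h1I : φ₁ ∈ Icc (-(π / 2)) (π / 2)) (h2I : φ₂ ∈ Icc (-(π / 2)) (π / 2))
    (h1 : Visible ε φ₁ α₁ m) (h2 : Visible ε φ₂ α₂ m) :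
    Visible ε φ α m ∧ offset ε φ₁ α₁ m ≤ offset ε φ α m ∧
      offset ε φ α m ≤ offset ε φ₂ α₂ m := by
  have hc1 := Real.cos_nonneg_of_mem_Icc h1I
  have hc2 := Real.cos_nonneg_of_mem_Icc h2I
  have hI : φ ∈ Icc (-(π / 2)) (π / 2) := ⟨h2I.1.trans hφ2, hφ1.trans h1I.2⟩
  have hc := Real.cos_nonneg_of_mem_Icc hI
  have hm : m ≠ 0 := by
    rintro rfl; have := h1.2.1; rw [dotU_zero] at this; exact lt_irrefl _ this
  have hN := one_le_norm_latticePoint hm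
  have hγ : 0 < 1 - 2 * ε := by linarith
  have hl1 := norm_le_of_hit hε0 hε hc1 h1.1.le h1.2.1
  have hl2 := norm_le_of_hit hε0 hε hc2 h2.1.le h2.2.1
  have g1 := offset_growth_left hε0 hε hρ hφ1 hφα1 (by linarith) hc1 hm hl1
  have g2 := offset_growth_right hε0 hε hρ hφ2 hφα2 (by linarith) hc2 hm hl2
  have p1 : 0 ≤ (1 - 2 * ε) / 2 * ‖latticePoint m‖ * (α - α₁) :=
    mul_nonneg (by positivity) (by linarith)
  have p2 : 0 ≤ (1 - 2 * ε) / 2 * ‖latticePoint m‖ * (α₂ - α) :=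
    mul_nonneg (by positivity) (by linarith)
  have ho1 : offset ε φ₁ α₁ m ≤ offset ε φ α m := by linarith
  have ho2 : offset ε φ α m ≤ offset ε φ₂ α₂ m := by linarith
  have ha1 := abs_lt.mp h1.1
  have ha2 := abs_lt.mp h2.1
  have hoff : |offset ε φ α m| < ε := abs_lt.mpr ⟨by linarith, by linarith⟩
  -- Turning by at most `ρ` changes a component by at most `(1 - 2ε) / 4` of the norm. The lower
  -- bounds for `m'` and `m - m'` at `α` survive this, so `m'` stays in front of `m` on the whole
  -- stretch.
  have dot_close : ∀ n β, |β - α| ≤ ρ →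
      dotU n α - (1 - 2 * ε) / 4 * ‖latticePoint n‖ ≤ dotU n β := by
    intro n β hβ
    have h3 := (abs_le.mp (abs_dotU_sub_le n α β)).1
    have h4 : ‖latticePoint n‖ * |β - α| ≤ ‖latticePoint n‖ * ((1 - 2 * ε) / 4) := by
      gcongr; linarith
    linarith
  have hβ1 : |α₁ - α| ≤ ρ := by rw [abs_sub_comm, abs_of_nonneg] <;> linarith
  have hβ2 : |α₂ - α| ≤ ρ := by rw [abs_of_nonneg] <;> linarith
  have hdot : 0 < dotU m α := by
    have h3 := (abs_le.mp (abs_dotU_sub_le m α₁ α)).1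
    have h4 : ‖latticePoint m‖ * |α - α₁| ≤ ‖latticePoint m‖ * ((1 - 2 * ε) / 4) := by
      gcongr; rw [abs_sub_comm]; linarith
    have h5 : 0 ≤ ε * Real.cos φ₁ := by positivity
    have h6 : 0 < (1 - 2 * ε) * ‖latticePoint m‖ := mul_pos hγ (by linarith)
    linarith
  refine ⟨⟨hoff, hdot, ?_⟩, ho1, ho2⟩
  intro m' h0 hlt
  by_contra hcon
  push Not at hcon
  have hm' : m' ≠ 0 := by rintro rfl; rw [dotU_zero] at h0; exact lt_irrefl _ h0
  have hN' := one_le_norm_latticePoint hm'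
  have hl := norm_le_of_hit hε0 hε hc hcon h0
  have hs := norm_sub_le_of_hit hε0 hε hoff.le hcon hlt
  have hNd := one_le_norm_latticePoint (m := m - m')
    (by intro h; rw [sub_eq_zero.mp h] at hlt; exact lt_irrefl _ hlt)
  have hcosε : 0 ≤ ε * Real.cos φ := by positivity
  have hγm' : 0 < (1 - 2 * ε) * ‖latticePoint m'‖ := mul_pos hγ (by linarith)
  have hγd : 0 < (1 - 2 * ε) * ‖latticePoint (m - m')‖ := mul_pos hγ (by linarith)
  have hpos : ∀ β, |β - α| ≤ ρ → 0 < dotU m' β ∧ dotU m' β < dotU m β := by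
    intro β hβ
    have h3 := dot_close m' β hβ
    have h4 := dot_close (m - m') β hβ
    have h5 := dotU_sub m m' β
    constructor <;> linarith
  have b1 := h1.2.2 m' (hpos _ hβ1).1 (hpos _ hβ1).2
  have b2 := h2.2.2 m' (hpos _ hβ2).1 (hpos _ hβ2).2
  have g1' := offset_growth_right hε0 hε hρ hφ1 hφα1 (by linarith) hc hm' hl
  have g2' := offset_growth_left hε0 hε hρ hφ2 hφα2 (by linarith) hc hm' hl
  have p1' : 0 ≤ (1 - 2 * ε) / 2 * ‖latticePoint m'‖ * (α - α₁) :=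
    mul_nonneg (by positivity) (by linarith)
  have p2' : 0 ≤ (1 - 2 * ε) / 2 * ‖latticePoint m'‖ * (α₂ - α) :=
    mul_nonneg (by positivity) (by linarith)
  have hcon' := abs_le.mp hcon
  -- The blocking disk is missed at both ends although its offset is in `[-ε, ε]` in between. As the
  -- offset increases, it must start below `-ε` and end above `ε`.
  have c1 : offset ε φ₁ α₁ m' < -ε := by
    by_contra h
    push Not at h
    exact absurd b1 (not_lt.mpr (abs_le.mpr ⟨h, by linarith⟩))
  have c2 : ε < offset ε φ₂ α₂ m' := by
    by_contra h
    push Not at h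
    exact absurd b2 (not_lt.mpr (abs_le.mpr ⟨by linarith, h⟩))
  -- The offset of `m'` gains more than `2ε`, that of `m` less than `2ε`. But `m` lies farther out,
  -- so on a divergent front its offset gains at least as much: the gains differ by the change of
  -- `crossU (m - m')`, of the sign of `dotU (m - m')`.
  have hcr := (abs_le.mp (abs_crossU_sub_le (m - m') (α := α₁) (β := α₂)
    (by rw [abs_of_nonneg (by linarith)]; linarith))).1
  have h3 := dot_close (m - m') α₁ hβ1
  have h4 : ‖latticePoint (m - m')‖ * (α₂ - α₁) ^ 2 ≤
      ‖latticePoint (m - m')‖ * ((α₂ - α₁) * ((1 - 2 * ε) / 4)) := by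
    rw [pow_two]; gcongr <;> linarith
  have h5 : (α₂ - α₁) * ((1 - 2 * ε) / 2 * ‖latticePoint (m - m')‖) ≤
      (α₂ - α₁) * dotU (m - m') α₁ := by
    refine mul_le_mul_of_nonneg_left ?_ (by linarith)
    linarith
  have h6 : 0 ≤ (α₂ - α₁) * ((1 - 2 * ε) / 4 * ‖latticePoint (m - m')‖) :=
    mul_nonneg (by linarith) (by positivity)
  rw [crossU_sub, crossU_sub] at hcr
  simp only [offset] at c1 c2 ha1 ha2
  linarith

/-! ### Corridors and far scatterers -/

/-- A long free path drifts across the corridor between two neighbouring rows of scatterers, and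
ends almost tangentially on the second row. -/
lemma corridor_aux {A B : ℤ × ℤ →+ ℝ} {ε p : ℝ} {e f m : ℤ × ℤ}
    (hp : |p| ≤ ε) (hE : 0 < A e) (hB : B e < 0) (hBε : -B e ≤ ε) (hEB : A e * -B e ≤ 1)
    (hdet : A e * B f - A f * B e = 1) (hbasis : ∃ i j : ℤ, m = i • e + j • f)
    (hA0 : 0 < A f) (hAE : A f ≤ A e) (hT : 6 * A e ≤ A m) (hm : |p - B m| < ε)
    (hfree : ∀ x, 0 < A x → A x < A m → ε < |p - B x|) :
    A e * B m - A m * B e = 1 ∧ p - B m < -ε - B e ∧ -B e * (A m - 3 * A e) ≤ 1 := by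
  obtain ⟨H, hH⟩ : ∃ H, B e = -H := ⟨-B e, by ring⟩
  rw [hH] at hB hBε hEB hdet ⊢
  set E := A e
  set T := A m
  have hH0 : 0 < H := by linarith
  have hp' := abs_le.mp hp
  have hm' := abs_lt.mp hm
  -- The scatterer `e` is missed, and it cannot be missed on the negative side since `p + H > -ε`.
  have h1 : ε < p + H := by
    have := hfree e hE (by linarith)
    rw [hH] at this
    rcases lt_abs.mp this with h | h <;> linarith
  have hBf : 0 ≤ B f := by
    have h2 : A f * H ≤ E * H := by gcongr
    have h3 : 0 ≤ E * B f := by linarith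
    exact nonneg_of_mul_nonneg_right h3 hE
  -- Along the row `f + n e` the offset moves up by `H ≤ ε` per step. Starting below `-ε`, it cannot
  -- jump across the forbidden band `[-ε, ε]` of width `2ε`, so it stays below as long as the
  -- scatterers come before `m`.
  have hstep : ∀ n : ℕ, A f + n * E < T → p - B f + n * H < -ε := by
    intro n
    induction n with
    | zero =>
      intro h
      have := hfree f hA0 (by simpa using h)
      rcases lt_abs.mp this with h2 | h2
      · linarith
      · push_cast; linarith
    | succ n ih =>
      intro h
      push_cast at h ⊢
      have h2 := ih (by linarith)
      have h3 : A (f + (n + 1 : ℕ) • e) = A f + (n + 1) * E := by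
        rw [map_add, map_nsmul, nsmul_eq_mul]; push_cast; rfl
      have h4 : B (f + (n + 1 : ℕ) • e) = B f - (n + 1) * H := by
        rw [map_add, map_nsmul, nsmul_eq_mul, hH]; push_cast; ring
      have h5 := hfree (f + (n + 1 : ℕ) • e) (by rw [h3]; positivity) (by rw [h3]; exact h)
      rw [h4] at h5
      rcases lt_abs.mp h5 with h6 | h6 <;> linarith
  have hTf : 0 < (T - A f) / E := by apply div_pos _ hE; linarith
  -- `f + n e` is the last scatterer of this row before the distance `T`, the ceiling minus one
  -- because the inequality must be strict.
  obtain ⟨n, hn⟩ := Nat.exists_eq_succ_of_ne_zero (Nat.ceil_pos.mpr hTf).ne'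
  have hn1 : T ≤ A f + (n + 1) * E := by
    have := Nat.le_ceil ((T - A f) / E)
    rw [hn, div_le_iff₀ hE] at this
    push_cast at this
    linarith
  have hn2 : A f + n * E < T := by
    have := Nat.ceil_lt_add_one hTf.le
    rw [hn] at this
    push_cast at this
    have h2 : (n : ℝ) < (T - A f) / E := by linarith
    rw [lt_div_iff₀ hE] at h2
    linarith
  have hbn := hstep n hn2
  have hnH : (n - 1) * H ≤ B f := by linarith
  obtain ⟨i, j, hij⟩ := hbasis
  have hTij : T = i * E + j * A f := by
    change A m = _
    rw [hij, map_add, map_zsmul, map_zsmul, zsmul_eq_mul, zsmul_eq_mul]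
  have hBij : B m = -(i * H) + j * B f := by
    rw [hij, map_add, map_zsmul, map_zsmul, zsmul_eq_mul, zsmul_eq_mul, hH]; ring
  have hj : E * B m + T * H = j := by
    rw [hBij, hTij]; linear_combination (j : ℝ) * hdet
  -- The row index `j` of `m` is positive: `B m > p - ε > -H`, so `E * B m + T * H > (T - E) * H >
  -- 0`.
  have hj1 : 1 ≤ j := by
    have h2 : E * -H ≤ E * B m := by gcongr; linarith
    have h3 : 0 < (T - E) * H := mul_pos (by linarith) hH0
    have : (0 : ℝ) < j := by linarith
    exact_mod_cast this
  have hj1' : (1 : ℝ) ≤ j := by exact_mod_cast hj1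
  have hi : n + 1 ≤ i := by
    have h2 : 0 ≤ (j - 1) * B f := mul_nonneg (by linarith) hBf
    have h3 : 0 < (i - n) * H := by rw [hBij] at hm'; linarith
    have h4 : (0 : ℝ) < i - n := pos_of_mul_pos_left h3 hH0.le
    have h5 : (n : ℝ) < i := by linarith
    have : (n : ℤ) < i := by exact_mod_cast h5
    omega
  have hi' : (n : ℝ) + 1 ≤ i := by exact_mod_cast hi
  -- With `i ≥ n + 1` and `j ≥ 1`, the bound `T ≤ A f + (n + 1) E` leaves no room: `m = f + (n + 1)
  -- e`. Its offset exceeds that of `f + n e` by `H` only, which is the near tangency.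
  have h7 : 0 ≤ (i - (n + 1)) * E := mul_nonneg (by linarith) hE.le
  have hjeq : (j : ℝ) = 1 := by
    have h8 : (j - 1) * A f ≤ 0 := by linarith
    have h9 : (j : ℝ) - 1 ≤ 0 := nonpos_of_mul_nonpos_left h8 hA0
    linarith
  have hieq : (i : ℝ) = n + 1 := by
    have h8 : (i - (n + 1)) * E ≤ 0 := by rw [hTij, hjeq] at hn1; linarith
    have := nonpos_of_mul_nonpos_left h8 hE
    linarith
  refine ⟨by rw [← hjeq, ← hj]; ring, ?_, ?_⟩
  · rw [hBij, hjeq, hieq]; linarith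
  · have h8 : T - 3 * E ≤ (n - 1) * E := by linarith
    have h9 : H * (T - 3 * E) ≤ H * ((n - 1) * E) := by gcongr
    have h10 : E * ((n - 1) * H) ≤ E * B f := by gcongr
    have h11 : 0 ≤ A f * H := by positivity
    linarith

/-- A multiple of `e` is subtracted from `f` so that its component along the ray falls into `(0, A
e]`; the determinant and the lattice spanned do not change. The ceiling minus one selects this
half-open interval. -/
lemma corridor_aux' {A B : ℤ × ℤ →+ ℝ} {ε p : ℝ} {e f m : ℤ × ℤ}
    (hp : |p| ≤ ε) (hE : 0 < A e) (hB : B e < 0) (hBε : -B e ≤ ε) (hEB : A e * -B e ≤ 1)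
    (hdet : A e * B f - A f * B e = 1) (hbasis : ∃ i j : ℤ, m = i • e + j • f)
    (hT : 6 * A e ≤ A m) (hm : |p - B m| < ε)
    (hfree : ∀ x, 0 < A x → A x < A m → ε < |p - B x|) :
    A e * B m - A m * B e = 1 ∧ p - B m < -ε - B e ∧ -B e * (A m - 3 * A e) ≤ 1 := by
  set k : ℤ := ⌈A f / A e⌉ - 1 with hk
  have h1 : A (f - k • e) = A f - k * A e := by
    rw [map_sub, map_zsmul, zsmul_eq_mul]
  have h2 : B (f - k • e) = B f - k * B e := by
    rw [map_sub, map_zsmul, zsmul_eq_mul]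
  have h3 : A f / A e ≤ k + 1 := by
    rw [hk]; push_cast; linarith [Int.le_ceil (A f / A e)]
  have h4 : k < A f / A e := by
    rw [hk]; push_cast; linarith [Int.ceil_lt_add_one (A f / A e)]
  rw [div_le_iff₀ hE] at h3
  rw [lt_div_iff₀ hE] at h4
  refine corridor_aux (f := f - k • e) hp hE hB hBε hEB ?_ ?_ ?_ ?_ hT hm hfree
  · rw [h1, h2]; linear_combination hdet
  · obtain ⟨i, j, hij⟩ := hbasis
    refine ⟨i + j * k, j, ?_⟩
    rw [hij]; module
  · rw [h1]; linarith
  · rw [h1]; linarith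

/-- `dotU` as an additive map. -/
def dotUHom (α : ℝ) : ℤ × ℤ →+ ℝ where
  toFun m := dotU m α
  map_zero' := dotU_zero α
  map_add' m n := dotU_add m n α

/-- `crossU` as an additive map. -/
def crossUHom (α : ℝ) : ℤ × ℤ →+ ℝ where
  toFun m := crossU m α
  map_zero' := crossU_zero α
  map_add' m n := crossU_add m n α

lemma det_dotU_crossU (e f : ℤ × ℤ) (α : ℝ) :
    dotU e α * crossU f α - dotU f α * crossU e α = ((e.2 * f.1 - e.1 * f.2 : ℤ) : ℝ) := by
  simp only [dotU, crossU]; push_cast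
  linear_combination (e.2 * f.1 - e.1 * f.2 : ℝ) * Real.sin_sq_add_cos_sq α

/-- A far visible scatterer lies on a row next to that of the scatterer of departure, and it is hit
almost tangentially. -/
lemma far_visible {ε φ α : ℝ} {m : ℤ × ℤ} (hε0 : 0 < ε) (hε : ε < 1 / 2)
    (h : Visible ε φ α m) (hfar : 36 / ε ≤ ‖latticePoint m‖) :
    (∃ e : ℤ × ℤ, |e.2 * m.1 - e.1 * m.2| = 1 ∧ ‖latticePoint e‖ ≤ 4 / ε ∧ |crossU e α| ≤ 1) ∧
      ε ^ 2 - offset ε φ α m ^ 2 ≤ 8 * ε / ‖latticePoint m‖ := by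
  obtain ⟨hb, hD, hfree⟩ := h
  have hb' := abs_lt.mp hb
  have hp : |ε * Real.sin φ| ≤ ε := by
    rw [abs_mul, abs_of_pos hε0]
    exact mul_le_of_le_one_right hε0.le (Real.abs_sin_le_one φ)
  have hε2 : 2 < 1 / ε := by rw [lt_div_iff₀ hε0]; linarith
  have hε36 : 36 / ε = 36 * (1 / ε) := by ring
  have hN : 72 ≤ ‖latticePoint m‖ := by linarith
  have hT : ‖latticePoint m‖ / 2 ≤ dotU m α := by
    have h1 := dotU_sq_add_crossU_sq m α
    have h2 : |crossU m α| ≤ 1 := by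
      have : crossU m α = ε * Real.sin φ - offset ε φ α m := by rw [offset]; ring
      rw [this]
      refine (abs_sub _ _).trans ?_
      linarith
    have h3 : crossU m α ^ 2 ≤ 1 := by
      rw [← sq_abs]; nlinarith [abs_nonneg (crossU m α)]
    refine abs_le_of_sq_le_sq' ?_ hD.le |>.2
    nlinarith
  -- This order of approximation makes the transverse component of `e` at most `ε`, the step allowed
  -- in the corridor argument, with `e` of length `O(1 / ε)`.
  set n := ⌊1 / ε⌋₊ with hn
  have hn0 : 0 < n := Nat.floor_pos.mpr (by linarith)
  have hn1 : 1 / ε < n + 1 := Nat.lt_floor_add_one _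
  have hn2 : (n : ℝ) ≤ 1 / ε := Nat.floor_le (by positivity)
  obtain ⟨e, hcop, hE, hH, hEH, hE2⟩ := exists_lattice_approx α n hn0
  have hE3 : dotU e α ≤ 3 / ε := by
    have : 3 / ε = 3 * (1 / ε) := by ring
    linarith
  have hHε : |crossU e α| ≤ ε := by
    refine hH.trans ?_
    rw [div_le_iff₀ (by positivity)]
    rw [div_lt_iff₀ hε0] at hn1
    linarith
  -- Here the threshold `36 / ε` is used: `dotU m α ≥ 18 / ε ≥ 6 * dotU e α`.
  have hT6 : 6 * dotU e α ≤ dotU m α := by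
    have : 3 / ε = 3 * (1 / ε) := by ring
    linarith
  have hediff : ‖latticePoint e‖ ≤ 4 / ε := by
    have h1 := dotU_sq_add_crossU_sq e α
    have h2 : ‖latticePoint e‖ ≤ dotU e α + |crossU e α| := by
      apply le_of_abs_le
      apply abs_le_of_sq_le_sq _ (by positivity)
      rw [← h1, ← sq_abs (crossU e α)]
      nlinarith [abs_nonneg (crossU e α), mul_nonneg hE.le (abs_nonneg (crossU e α))]
    have : 4 / ε = 3 / ε + 1 / ε := by ring
    linarith
  obtain ⟨u, v, huv⟩ := hcop
  -- If `e` were exactly parallel to the ray, its offset would be that of the origin and it would be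
  -- hit before `m`.
  have hne0 : crossU e α ≠ 0 := by
    intro h0
    have h1 := hfree e hE (by linarith)
    rw [offset, h0, sub_zero] at h1
    linarith
  have hbasis : ∀ s : ℤ, s * s = 1 → ∃ i j : ℤ, m = i • e + j • (s * v, -(s * u)) := by
    intro s hs
    refine ⟨u * m.1 + v * m.2, s * (e.2 * m.1 - e.1 * m.2), ?_⟩
    apply Prod.ext
    · simp only [Prod.fst_add, Prod.smul_fst, smul_eq_mul]
      linear_combination -m.1 * huv - v * (e.2 * m.1 - e.1 * m.2) * hs
    · simp only [Prod.snd_add, Prod.smul_snd, smul_eq_mul]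
      linear_combination -m.2 * huv + u * (e.2 * m.1 - e.1 * m.2) * hs
  have hNpos : 0 < ‖latticePoint m‖ := by linarith
  -- `H` is the drift `|crossU e α|`. Since `dotU m α - 3 * dotU e α ≥ ‖m‖ / 4`, it is at most `4 /
  -- ‖m‖`, and `ε ^ 2 - offset ^ 2` is at most `2ε` times the gap `ε - |offset| ≤ H`.
  have fin : ∀ H, 0 ≤ H → H * (dotU m α - 3 * dotU e α) ≤ 1 →
      (ε - |offset ε φ α m|) ≤ H → ε ^ 2 - offset ε φ α m ^ 2 ≤ 8 * ε / ‖latticePoint m‖ := by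
    intro H hH0 h1 h2
    have h3 : H * (‖latticePoint m‖ / 4) ≤ 1 := by
      refine le_trans ?_ h1
      gcongr; linarith
    rw [le_div_iff₀ hNpos, ← sq_abs (offset ε φ α m)]
    have h4 : ε ^ 2 - |offset ε φ α m| ^ 2 ≤ H * (2 * ε) := by
      have : ε ^ 2 - |offset ε φ α m| ^ 2 =
        (ε - |offset ε φ α m|) * (ε + |offset ε φ α m|) := by ring
      rw [this]
      apply mul_le_mul h2 (by linarith) (by positivity) hH0
    calc _ ≤ H * (2 * ε) * ‖latticePoint m‖ := by gcongr
      _ = (H * (‖latticePoint m‖ / 4)) * (8 * ε) := by ring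
      _ ≤ 1 * (8 * ε) := by gcongr
      _ = 8 * ε := one_mul _
  rcases lt_or_gt_of_ne hne0 with hneg | hpos
  · rw [abs_of_neg hneg] at hHε hEH hH
    have hdet : dotUHom α e * crossUHom α (v, -u) - dotUHom α (v, -u) * crossUHom α e = 1 := by
      have h4 := det_dotU_crossU e (v, -u) α
      have h5 : e.2 * (v, -u).1 - e.1 * (v, -u).2 = 1 := by
        simp only; linear_combination huv
      rw [h5, Int.cast_one] at h4
      exact h4
    obtain ⟨h1, h2, h3⟩ := corridor_aux' (A := dotUHom α) (B := crossUHom α) (ε := ε)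
      (p := ε * Real.sin φ) (e := e) (f := (v, -u)) (m := m) hp hE hneg hHε hEH hdet
      (by simpa using hbasis 1 (by norm_num)) hT6 hb hfree
    · refine ⟨⟨e, ?_, hediff, by rw [abs_of_neg hneg]; linarith⟩, ?_⟩
      · have h4 := det_dotU_crossU e m α
        have h5 : ((e.2 * m.1 - e.1 * m.2 : ℤ) : ℝ) = 1 := by rw [← h4]; exact h1
        have h6 : e.2 * m.1 - e.1 * m.2 = 1 := by exact_mod_cast h5
        rw [h6, abs_one]
      · refine fin (-crossU e α) (by linarith) h3 ?_
        have h4 : offset ε φ α m < -ε - crossU e α := h2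
        linarith [neg_le_abs (offset ε φ α m)]
  · rw [abs_of_pos hpos] at hHε hEH hH
    -- The opposite sign of `crossU e α` is reduced to the previous case by reflection in the ray.
    have hfree' : ∀ x, 0 < dotUHom α x → dotUHom α x < dotUHom α m →
        ε < |-(ε * Real.sin φ) - (-crossUHom α) x| := by
      intro x h1 h2
      have h3 := hfree x h1 h2
      have : -(ε * Real.sin φ) - (-crossUHom α) x = -offset ε φ α x := by
        rw [offset, AddMonoidHom.neg_apply]
        change _ - -crossU x α = _
        ring
      rwa [this, abs_neg]
    have hbm : |-(ε * Real.sin φ) - (-crossUHom α) m| < ε := by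
      have : -(ε * Real.sin φ) - (-crossUHom α) m = -offset ε φ α m := by
        rw [offset, AddMonoidHom.neg_apply]
        change _ - -crossU m α = _
        ring
      rwa [this, abs_neg]
    have hBe : (-crossUHom α) e = -crossU e α := rfl
    have hdet : dotUHom α e * (-crossUHom α) (-v, u) - dotUHom α (-v, u) * (-crossUHom α) e =
        1 := by
      have h4 := det_dotU_crossU e (-v, u) α
      have h5 : e.2 * (-v, u).1 - e.1 * (-v, u).2 = -1 := by
        simp only; linear_combination -huv
      rw [h5] at h4
      push_cast at h4
      change dotU e α * -crossU (-v, u) α - dotU (-v, u) α * -crossU e α = 1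
      linarith
    obtain ⟨h1, h2, h3⟩ := corridor_aux' (A := dotUHom α) (B := -crossUHom α) (ε := ε)
      (p := -(ε * Real.sin φ)) (e := e) (f := (-v, u)) (m := m) (by rwa [abs_neg]) hE
      (by rw [hBe]; linarith) (by rw [hBe]; linarith)
      (by rw [hBe, neg_neg]; exact hEH) hdet
      (by simpa using hbasis (-1) (by norm_num)) hT6 hbm hfree'
    · refine ⟨⟨e, ?_, hediff, by rw [abs_of_pos hpos]; linarith⟩, ?_⟩
      · have h4 := det_dotU_crossU e m α
        have h5 : ((e.2 * m.1 - e.1 * m.2 : ℤ) : ℝ) = -1 := by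
          rw [← h4]
          have : dotU e α * -crossU m α - dotU m α * -crossU e α = 1 := h1
          linarith
        have h6 : e.2 * m.1 - e.1 * m.2 = -1 := by exact_mod_cast h5
        rw [h6, abs_neg, abs_one]
      · refine fin (crossU e α) hpos.le ?_ ?_
        · have : - -crossU e α * (dotU m α - 3 * dotU e α) ≤ 1 := h3
          linarith
        · have h4 : -(ε * Real.sin φ) - -crossU m α < -ε - -crossU e α := h2
          have h5 := le_abs_self (offset ε φ α m)
          rw [offset] at h5 ⊢
          linarith

/-! ### Lattice sums over sectors and rows -/

lemma card_Icc_ceil_floor_le {x y : ℝ} (h : x ≤ y) :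
    ((Finset.Icc ⌈x⌉ ⌊y⌋).card : ℝ) ≤ y - x + 1 := by
  rw [Int.card_Icc]
  have h1 := Int.floor_le y
  have h2 := Int.le_ceil x
  rcases le_or_gt 0 (⌊y⌋ + 1 - ⌈x⌉) with h3 | h3
  · have : (((⌊y⌋ + 1 - ⌈x⌉).toNat : ℤ) : ℝ) = ((⌊y⌋ + 1 - ⌈x⌉ : ℤ) : ℝ) := by
      rw [Int.toNat_of_nonneg h3]
    rw [Int.cast_natCast] at this
    rw [this]; push_cast; linarith
  · rw [Int.toNat_of_nonpos h3.le]; push_cast; linarith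

/-- The lattice points of a strip on two opposite sides of a square. -/
lemma sector_count {c s D : ℝ} (hcs : s ^ 2 + c ^ 2 = 1) (hD : 1 ≤ D) (i : ℤ) :
    (((Finset.Icc (-|i|) |i|).filter fun j : ℤ => |i * c - j * s| ≤ D).card : ℝ) ≤ 10 * D := by
  rcases le_or_gt (1 / 2) |s| with hs | hs
  · have hs0 : s ≠ 0 := by rintro rfl; norm_num at hs
    have hsub : ((Finset.Icc (-|i|) |i|).filter fun j : ℤ => |i * c - j * s| ≤ D) ⊆
        Finset.Icc ⌈i * c / s - 2 * D⌉ ⌊i * c / s + 2 * D⌋ := by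
      intro j hj
      have hj := (Finset.mem_filter.mp hj).2
      have e : i * c - j * s = (i * c / s - j) * s := by field_simp
      rw [e, abs_mul] at hj
      have h1 : |i * c / s - j| ≤ 2 * D := by nlinarith [abs_nonneg (i * c / s - j)]
      have h2 := abs_le.mp h1
      rw [Finset.mem_Icc, Int.ceil_le, Int.le_floor]
      constructor <;> linarith
    have h1 : ((((Finset.Icc (-|i|) |i|).filter fun j : ℤ => |i * c - j * s| ≤ D).card : ℕ) : ℝ) ≤
        ((Finset.Icc ⌈i * c / s - 2 * D⌉ ⌊i * c / s + 2 * D⌋).card : ℕ) := by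
      exact_mod_cast Finset.card_le_card hsub
    have h2 := card_Icc_ceil_floor_le (x := i * c / s - 2 * D) (y := i * c / s + 2 * D)
      (by linarith)
    linarith
  · have hc : 4 / 5 ≤ |c| := by
      have h1 : |s| ^ 2 + |c| ^ 2 = 1 := by rw [sq_abs, sq_abs]; exact hcs
      by_contra hc
      push Not at hc
      nlinarith [abs_nonneg s, abs_nonneg c]
    rcases Finset.eq_empty_or_nonempty
      ((Finset.Icc (-|i|) |i|).filter fun j : ℤ => |i * c - j * s| ≤ D) with he | ⟨j, hj⟩
    · rw [he]; simp; linarith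
    · obtain ⟨h1, h2⟩ := Finset.mem_filter.mp hj
      have h3 : |(j : ℝ)| ≤ |(i : ℝ)| := by
        have : |j| ≤ |i| := abs_le.mpr (Finset.mem_Icc.mp h1)
        exact_mod_cast this
      have h4 : |(i : ℝ)| * |c| ≤ D + |(j : ℝ)| * |s| := by
        have : (i : ℝ) * c = (i * c - j * s) + j * s := by ring
        rw [← abs_mul, this]
        refine (abs_add_le _ _).trans ?_
        rw [abs_mul (j : ℝ) s]; linarith
      -- The strip is here steep relative to the side `|j| ≤ |i|`: it meets it only if `(4/5 - 1/2)
      -- |i| ≤ D`, and then all `2|i| + 1` values of `j` are affordable.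
      have h5 : |(i : ℝ)| * (3 / 10) ≤ D := by nlinarith [abs_nonneg (i : ℝ), abs_nonneg (j : ℝ)]
      have h6 : ((((Finset.Icc (-|i|) |i|).filter fun j : ℤ => |i * c - j * s| ≤ D).card : ℕ) : ℝ) ≤
          ((Finset.Icc (-|i|) |i|).card : ℕ) := by
        exact_mod_cast Finset.card_filter_le _ _
      have h7 : ((Finset.Icc (-|i|) |i|).card : ℝ) = 2 * |(i : ℝ)| + 1 := by
        rw [Int.card_Icc]
        have : (((|i| + 1 - -|i|).toNat : ℤ) : ℝ) = ((|i| + 1 - -|i| : ℤ) : ℝ) := by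
          rw [Int.toNat_of_nonneg (by have := abs_nonneg i; omega)]
        rw [Int.cast_natCast] at this
        rw [this]; push_cast; ring
      linarith

lemma tsum_int_natAbs_le (h : ℕ → ℝ≥0∞) : ∑' i : ℤ, h i.natAbs ≤ 2 * ∑' n, h n := by
  have h1 : HasSum (fun n : ℕ => h ((n : ℤ).natAbs)) (∑' n, h n) := by
    simpa using ENNReal.summable.hasSum (f := h)
  have h2 : HasSum (fun n : ℕ => h ((-((n : ℤ) + 1)).natAbs)) (∑' n, h (n + 1)) := by
    have e : ∀ n : ℕ, (-((n : ℤ) + 1)).natAbs = n + 1 := by intro n; omega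
    simp only [e]
    exact ENNReal.summable.hasSum
  rw [(HasSum.of_nat_of_neg_add_one (f := fun i : ℤ => h i.natAbs) h1 h2).tsum_eq, two_mul]
  refine add_le_add le_rfl ?_
  exact ENNReal.tsum_comp_le_tsum_of_injective (add_left_injective 1) h

/-- Column by column: `sector_count` bounds the number of contributing `j` for each `i`, and the
weight depends on `|i|` only. The factor `2` accounts for the sign of `i`. -/
lemma sector_sum_half {c s Δ : ℝ} (hcs : s ^ 2 + c ^ 2 = 1) (hΔ : 0 ≤ Δ) {G : ℤ → ℤ → ℝ≥0∞}
    {g : ℕ → ℝ≥0∞} (h1 : ∀ i j, G i j ≠ 0 → |j| ≤ |i| ∧ |i * c - j * s| ≤ 1 + 2 * Δ * i.natAbs)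
    (h2 : ∀ i j, G i j ≤ g i.natAbs) :
    ∑' i, ∑' j, G i j ≤ 2 * ∑' n : ℕ, ENNReal.ofReal (10 * (1 + 2 * Δ * n)) * g n := by
  refine le_trans ?_
    (tsum_int_natAbs_le fun n => ENNReal.ofReal (10 * (1 + 2 * Δ * n)) * g n)
  refine ENNReal.tsum_le_tsum fun i => ?_
  set D := 1 + 2 * Δ * (i.natAbs : ℝ) with hD
  set S := (Finset.Icc (-|i|) |i|).filter fun j : ℤ => |i * c - j * s| ≤ D
  have hS : ∑' j, G i j = ∑ j ∈ S, G i j := by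
    apply tsum_eq_sum
    intro j hj
    by_contra hne
    obtain ⟨h3, h4⟩ := h1 i j hne
    exact hj (Finset.mem_filter.mpr ⟨Finset.mem_Icc.mpr (abs_le.mp h3), h4⟩)
  rw [hS]
  have hD1 : 1 ≤ D := by rw [hD]; linarith [show 0 ≤ 2 * Δ * (i.natAbs : ℝ) by positivity]
  calc ∑ j ∈ S, G i j ≤ ∑ j ∈ S, g i.natAbs := Finset.sum_le_sum fun j _ => h2 i j
    _ = (S.card : ℝ≥0∞) * g i.natAbs := by rw [Finset.sum_const, nsmul_eq_mul]
    _ ≤ ENNReal.ofReal (10 * D) * g i.natAbs := by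
      gcongr
      rw [← ENNReal.ofReal_natCast]
      exact ENNReal.ofReal_le_ofReal (sector_count hcs hD1 i)

lemma norm_latticePoint_le_max (m : ℤ × ℤ) :
    ‖latticePoint m‖ ≤ 2 * (max m.1.natAbs m.2.natAbs : ℕ) := by
  have h1 := Complex.norm_le_abs_re_add_abs_im (latticePoint m)
  have h2 : |(latticePoint m).re| = (m.1.natAbs : ℝ) := by
    simp [latticePoint, Nat.cast_natAbs]
  have h3 : |(latticePoint m).im| = (m.2.natAbs : ℝ) := by
    simp [latticePoint, Nat.cast_natAbs]
  have h4 : (m.1.natAbs : ℝ) ≤ (max m.1.natAbs m.2.natAbs : ℕ) := by exact_mod_cast le_max_left _ _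
  have h5 : (m.2.natAbs : ℝ) ≤ (max m.1.natAbs m.2.natAbs : ℕ) := by
    exact_mod_cast le_max_right _ _
  linarith

lemma max_le_norm_latticePoint (m : ℤ × ℤ) :
    ((max m.1.natAbs m.2.natAbs : ℕ) : ℝ) ≤ ‖latticePoint m‖ := by
  have h1 := Complex.abs_re_le_norm (latticePoint m)
  have h2 := Complex.abs_im_le_norm (latticePoint m)
  simp only [latticePoint] at h1 h2
  push_cast
  rw [Nat.cast_natAbs, Nat.cast_natAbs]
  push_cast
  exact max_le h1 h2

lemma natAbs_le_of_abs_le {i j : ℤ} (h : |j| ≤ |i|) : j.natAbs ≤ i.natAbs := by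
  rw [Int.abs_eq_natAbs, Int.abs_eq_natAbs] at h
  exact_mod_cast h

/-- Summation over the lattice points of a sector by the size of their coordinates. -/
lemma sector_sum {α Δ : ℝ} (hΔ : 0 ≤ Δ) {F : ℤ × ℤ → ℝ≥0∞} {g : ℕ → ℝ≥0∞}
    (h1 : ∀ m, F m ≠ 0 → |crossU m α| ≤ 1 + Δ * ‖latticePoint m‖)
    (h2 : ∀ m, F m ≤ g (max m.1.natAbs m.2.natAbs)) :
    ∑' m, F m ≤ 4 * ∑' n : ℕ, ENNReal.ofReal (10 * (1 + 2 * Δ * n)) * g n := by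
  set S := ∑' n : ℕ, ENNReal.ofReal (10 * (1 + 2 * Δ * n)) * g n with hS
  have h3 : ∀ m, F m ≠ 0 → |crossU m α| ≤ 1 + 2 * Δ * (max m.1.natAbs m.2.natAbs : ℕ) := by
    intro m hm
    have h4 := h1 m hm
    have h5 : Δ * ‖latticePoint m‖ ≤ Δ * (2 * (max m.1.natAbs m.2.natAbs : ℕ)) := by
      gcongr; exact norm_latticePoint_le_max m
    linarith
  have hA : ∑' i, ∑' j, (if |j| ≤ |i| then F (i, j) else 0) ≤ 2 * S := by
    refine sector_sum_half (c := Real.cos α) (s := Real.sin α) (Real.sin_sq_add_cos_sq α) hΔ ?_ ?_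
    · intro i j hij
      by_cases h : |j| ≤ |i|
      · rw [if_pos h] at hij
        have h4 := h3 _ hij
        have e : max (i, j).1.natAbs (i, j).2.natAbs = i.natAbs :=
          max_eq_left (natAbs_le_of_abs_le h)
        rw [e] at h4
        exact ⟨h, h4⟩
      · rw [if_neg h] at hij; exact absurd rfl hij
    · intro i j
      by_cases h : |j| ≤ |i|
      · rw [if_pos h]
        have h4 := h2 (i, j)
        have e : max (i, j).1.natAbs (i, j).2.natAbs = i.natAbs :=
          max_eq_left (natAbs_le_of_abs_le h)
        rwa [e] at h4
      · rw [if_neg h]; exact zero_le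
  have hB : ∑' i, ∑' j, (if |j| ≤ |i| then F (j, i) else 0) ≤ 2 * S := by
    refine sector_sum_half (c := Real.sin α) (s := Real.cos α)
      (by rw [add_comm]; exact Real.sin_sq_add_cos_sq α) hΔ ?_ ?_
    · intro i j hij
      by_cases h : |j| ≤ |i|
      · rw [if_pos h] at hij
        have h4 := h3 _ hij
        have e : max (j, i).1.natAbs (j, i).2.natAbs = i.natAbs :=
          max_eq_right (natAbs_le_of_abs_le h)
        rw [e, crossU, abs_sub_comm] at h4
        exact ⟨h, h4⟩
      · rw [if_neg h] at hij; exact absurd rfl hij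
    · intro i j
      by_cases h : |j| ≤ |i|
      · rw [if_pos h]
        have h4 := h2 (j, i)
        have e : max (j, i).1.natAbs (j, i).2.natAbs = i.natAbs :=
          max_eq_right (natAbs_le_of_abs_le h)
        rwa [e] at h4
      · rw [if_neg h]; exact zero_le
  -- Splitting by which coordinate dominates; the diagonals are counted twice, which is harmless for
  -- an upper bound.
  have hsplit : ∑' m, F m ≤ ∑' i, ∑' j, (if |j| ≤ |i| then F (i, j) else 0) +
      ∑' i, ∑' j, (if |j| ≤ |i| then F (j, i) else 0) := by
    rw [ENNReal.tsum_comm (f := fun i j : ℤ => if |j| ≤ |i| then F (j, i) else 0),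
      ← ENNReal.tsum_prod, ← ENNReal.tsum_prod, ← ENNReal.tsum_add]
    refine ENNReal.tsum_le_tsum fun m => ?_
    obtain ⟨i, j⟩ := m
    simp only
    rcases le_total |j| |i| with h | h
    · rw [if_pos h]; exact le_self_add
    · rw [if_pos h]; exact le_add_self
  calc _ ≤ _ := hsplit
    _ ≤ 2 * S + 2 * S := add_le_add hA hB
    _ = 4 * S := by rw [← add_mul]; norm_num

lemma sum_inv_sqrt_le (N : ℕ) : ∑ n ∈ Finset.Icc 1 N, (n : ℝ) ^ (-(1 / 2 : ℝ)) ≤ 2 * √N := by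
  induction N with
  | zero => simp
  | succ N ih =>
    rw [Finset.sum_Icc_succ_top (by omega)]
    have h1 : (((N + 1 : ℕ) : ℝ)) ^ (-(1 / 2 : ℝ)) = 1 / √((N : ℝ) + 1) := by
      rw [Real.rpow_neg (by positivity), ← Real.sqrt_eq_rpow]; push_cast; rw [one_div]
    rw [h1]
    push_cast
    have h2 : 0 < √((N : ℝ) + 1) := by positivity
    have h3 := Real.sq_sqrt (by positivity : (0 : ℝ) ≤ (N : ℝ) + 1)
    have h4 := Real.sq_sqrt (by positivity : (0 : ℝ) ≤ (N : ℝ))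
    have h5 : 1 / √((N : ℝ) + 1) ≤ 2 * √((N : ℝ) + 1) - 2 * √N := by
      rw [div_le_iff₀ h2]
      nlinarith [sq_nonneg (√((N : ℝ) + 1) - √N)]
    linarith

/-- Comparison with the exponent `1/2` through `n ^ (1/2 - σ) ≤ N ^ (1/2 - σ)` keeps the constant
`2` uniform in `σ ≤ 1/2`. -/
lemma sum_rpow_neg_le {σ : ℝ} (h1 : σ ≤ 1 / 2) (N : ℕ) :
    ∑ n ∈ Finset.Icc 1 N, (n : ℝ) ^ (-σ) ≤ 2 * (N : ℝ) ^ (1 - σ) := by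
  rcases Nat.eq_zero_or_pos N with rfl | hN
  · simpa using by positivity
  have hN' : (0 : ℝ) < N := by exact_mod_cast hN
  calc ∑ n ∈ Finset.Icc 1 N, (n : ℝ) ^ (-σ)
      ≤ ∑ n ∈ Finset.Icc 1 N, (N : ℝ) ^ (1 / 2 - σ) * (n : ℝ) ^ (-(1 / 2 : ℝ)) := by
        apply Finset.sum_le_sum
        intro n hn
        obtain ⟨hn1, hn2⟩ := Finset.mem_Icc.mp hn
        have hn0 : (0 : ℝ) < n := by exact_mod_cast hn1
        have e : (n : ℝ) ^ (-σ) = (n : ℝ) ^ (1 / 2 - σ) * (n : ℝ) ^ (-(1 / 2 : ℝ)) := by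
          rw [← Real.rpow_add hn0]; ring_nf
        rw [e]
        gcongr
    _ = (N : ℝ) ^ (1 / 2 - σ) * ∑ n ∈ Finset.Icc 1 N, (n : ℝ) ^ (-(1 / 2 : ℝ)) := by
        rw [Finset.mul_sum]
    _ ≤ (N : ℝ) ^ (1 / 2 - σ) * (2 * √N) := by gcongr; exact sum_inv_sqrt_le N
    _ = 2 * (N : ℝ) ^ (1 - σ) := by
        rw [Real.sqrt_eq_rpow]
        have : (1 : ℝ) - σ = (1 / 2 - σ) + 1 / 2 := by ring
        rw [this, Real.rpow_add hN']; ring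

lemma sum_rpow_le {ν : ℝ} (h0 : 0 ≤ ν) (N : ℕ) :
    ∑ n ∈ Finset.Icc 1 N, (n : ℝ) ^ ν ≤ (N : ℝ) ^ (1 + ν) := by
  rcases Nat.eq_zero_or_pos N with rfl | hN
  · simp; positivity
  have hN' : (0 : ℝ) < N := by exact_mod_cast hN
  calc ∑ n ∈ Finset.Icc 1 N, (n : ℝ) ^ ν ≤ ∑ n ∈ Finset.Icc 1 N, (N : ℝ) ^ ν := by
        apply Finset.sum_le_sum
        intro n hn
        have := (Finset.mem_Icc.mp hn).2
        gcongr
    _ = (N : ℝ) ^ (1 + ν) := by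
        rw [Finset.sum_const, Nat.card_Icc, nsmul_eq_mul, Real.rpow_add hN', Real.rpow_one]
        simp

/-- The value `∑ n ^ (-(1 + η))` of the zeta function. -/
def zetaSum (η : ℝ) : ℝ≥0∞ := ∑' n : ℕ, ENNReal.ofReal ((n : ℝ) ^ (-(1 + η)))

lemma zetaSum_ne_top {η : ℝ} (hη : 0 < η) : zetaSum η ≠ ∞ := by
  have h : Summable fun n : ℕ => (n : ℝ) ^ (-(1 + η)) := Real.summable_nat_rpow.mpr (by linarith)
  exact h.tsum_ofReal_lt_top.ne

/-- The scatterers on the two rows next to the row of direction `e`. -/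
lemma row_sum {ε η σ : ℝ} (hε0 : 0 < ε) (hε : ε < 1 / 2) (hη : 0 < η) (hση : η ≤ σ) (hσ : σ ≤ 1)
    {e : ℤ × ℤ} (he0 : e ≠ 0) (he : ‖latticePoint e‖ ≤ 4 / ε) {F : ℤ × ℤ → ℝ≥0∞}
    (h1 : ∀ m, F m ≠ 0 → |e.2 * m.1 - e.1 * m.2| = 1 ∧ 36 / ε ≤ ‖latticePoint m‖)
    (h2 : ∀ m, F m ≤ ENNReal.ofReal (‖latticePoint m‖ ^ (-(1 + σ)))) :
    ∑' m, F m ≤ 16 * ENNReal.ofReal (‖latticePoint e‖ ^ (-(1 + σ))) * zetaSum η := by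
  set L := ‖latticePoint e‖ with hL
  have hL1 : 1 ≤ L := one_le_norm_latticePoint he0
  have hLsq : L ^ 2 = (e.1 : ℝ) ^ 2 + (e.2 : ℝ) ^ 2 := norm_latticePoint_sq e
  set z : ℤ × ℤ → ℝ := fun m => (e.1 * m.1 + e.2 * m.2 : ℝ) / L ^ 2 with hz
  set S : Set (ℤ × ℤ) := {m | |e.2 * m.1 - e.1 * m.2| = 1 ∧ 36 / ε ≤ ‖latticePoint m‖} with hS
  -- A point of the two rows is labelled by its side of `e` and by the integer part of `z`, its
  -- projection on `e` in units of `‖e‖`. Points on the same side differ by a multiple `d` of `e`,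
  -- which shifts `z` by an integer, so the label is injective.
  set Φ : S → Bool × ℤ := fun m => (decide (e.2 * m.1.1 - e.1 * m.1.2 = 1), ⌊z m.1⌋) with hΦ
  have hinj : Function.Injective Φ := by
    rintro ⟨m, hm⟩ ⟨m', hm'⟩ h
    simp only [hΦ, Prod.mk.injEq, decide_eq_decide] at h
    obtain ⟨ha, hb⟩ := h
    rw [hS] at hm hm'
    have hc : e.2 * m.1 - e.1 * m.2 = e.2 * m'.1 - e.1 * m'.2 := by
      rcases (abs_eq zero_le_one).mp hm.1 with h3 | h3
      · rw [h3, ha.mp h3]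
      · rcases (abs_eq zero_le_one).mp hm'.1 with h4 | h4
        · exact absurd (ha.mpr h4) (by omega)
        · rw [h3, h4]
    obtain ⟨s, hs⟩ : ∃ s, s = e.2 * m.1 - e.1 * m.2 := ⟨_, rfl⟩
    have hs2 : s * s = 1 := by
      have := hm.1; rw [← hs] at this
      rw [← abs_mul_abs_self, this, one_mul]
    obtain ⟨d, hd⟩ : ∃ d, d = (m.2 * m'.1 - m.1 * m'.2) * s := ⟨_, rfl⟩
    have e1 : m'.1 - m.1 = -d * e.1 := by
      rw [hd]
      linear_combination (-(m'.1 - m.1)) * hs2 + s * (m'.1 - m.1) * hs - s * m.1 * hc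
    have e2 : m'.2 - m.2 = -d * e.2 := by
      rw [hd]
      linear_combination (-(m'.2 - m.2)) * hs2 + s * (m'.2 - m.2) * hs - s * m.2 * hc
    have hz' : z m' - z m = -d := by
      have e1' : (m'.1 : ℝ) - m.1 = -d * e.1 := by exact_mod_cast e1
      have e2' : (m'.2 : ℝ) - m.2 = -d * e.2 := by exact_mod_cast e2
      rw [hz]
      simp only
      rw [← sub_div, div_eq_iff (by positivity), hLsq]
      linear_combination (e.1 : ℝ) * e1' + (e.2 : ℝ) * e2'
    have hd0 : d = 0 := by
      have h3 : z m' = z m + ((-d : ℤ) : ℝ) := by push_cast; linarith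
      rw [h3, Int.floor_add_intCast] at hb
      omega
    apply Subtype.ext
    apply Prod.ext
    · have := e1; rw [hd0] at this; simp only; linarith
    · have := e2; rw [hd0] at this; simp only; linarith
  have hsupp : Function.support F ⊆ S := fun m hm => h1 m hm
  have hbound : ∀ m : S, F m ≤ ENNReal.ofReal (4 * L ^ (-(1 + σ))) *
      ENNReal.ofReal (((Φ m).2.natAbs : ℝ) ^ (-(1 + η))) := by
    rintro ⟨m, hm⟩
    rw [hS] at hm
    refine (h2 m).trans ?_
    rw [← ENNReal.ofReal_mul (by positivity)]
    apply ENNReal.ofReal_le_ofReal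
    simp only [hΦ]
    obtain ⟨hc, hfar⟩ := hm
    have hM := norm_latticePoint_sq m
    set M := ‖latticePoint m‖ with hMdef
    have hLM : (z m * L) ^ 2 * L ^ 2 = M ^ 2 * L ^ 2 - 1 := by
      have hc2 : ((e.2 : ℝ) * m.1 - e.1 * m.2) ^ 2 = 1 := by
        have : (e.2 * m.1 - e.1 * m.2) ^ 2 = 1 := by rw [← sq_abs, hc, one_pow]
        exact_mod_cast this
      have : z m * L ^ 2 = e.1 * m.1 + e.2 * m.2 := by
        rw [hz]; field_simp
      have e3 : (z m * L) ^ 2 * L ^ 2 = (z m * L ^ 2) ^ 2 := by ring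
      rw [e3, this, hM, hLsq]
      linear_combination -hc2
    have h36 : 36 / ε = 9 * (4 / ε) := by ring
    have hM9 : 9 * L ≤ M := by linarith
    have hup : |z m| * L ≤ M := by
      have : |z m * L| ≤ M := by
        apply abs_le_of_sq_le_sq _ (by linarith)
        nlinarith [sq_nonneg (z m * L)]
      rwa [abs_mul, abs_of_pos (by linarith : 0 < L)] at this
    -- Because `‖m‖ ≥ 36 / ε ≥ 9 ‖e‖`, the label `n = ⌊z⌋` is never `0`. This matters since the real
    -- power `0 ^ (-(1 + η))` has the value `0` and would bound nothing.
    have hlow : 2 ≤ |z m| := by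
      by_contra hcon
      push Not at hcon
      have h3 : (z m * L) ^ 2 ≤ 4 * L ^ 2 := by
        rw [mul_pow, ← sq_abs]
        gcongr
        nlinarith [abs_nonneg (z m)]
      have h4 : M ^ 2 * L ^ 2 - 1 ≤ 4 * L ^ 2 * L ^ 2 := by rw [← hLM]; gcongr
      have h5 : (9 * L) ^ 2 * L ^ 2 ≤ M ^ 2 * L ^ 2 := by gcongr
      have h6' : 1 ≤ L ^ 2 := one_le_pow₀ hL1
      have h6 : 1 ≤ L ^ 2 * L ^ 2 := one_le_mul_of_one_le_of_one_le h6' h6'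
      linarith
    obtain ⟨n, hn⟩ : ∃ n, n = ⌊z m⌋ := ⟨_, rfl⟩
    rw [← hn]
    have hn1 : |(n : ℝ) - z m| ≤ 1 := by
      rw [hn, abs_le]
      constructor <;> linarith [Int.floor_le (z m), Int.lt_floor_add_one (z m)]
    have hnabs : ((n.natAbs : ℕ) : ℝ) = |(n : ℝ)| := by rw [Nat.cast_natAbs]; push_cast; rfl
    have hn2 : |(n : ℝ)| ≤ |z m| + 1 := by
      have := abs_sub_abs_le_abs_sub (n : ℝ) (z m); linarith
    have hn3 : 1 ≤ |(n : ℝ)| := by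
      have := abs_sub_abs_le_abs_sub (z m) (n : ℝ)
      rw [abs_sub_comm] at this; linarith
    rw [hnabs]
    have hbase : |(n : ℝ)| * L / 2 ≤ M := by nlinarith
    have hpos : 0 < |(n : ℝ)| * L / 2 := by positivity
    calc M ^ (-(1 + σ)) ≤ (|(n : ℝ)| * L / 2) ^ (-(1 + σ)) :=
          Real.rpow_le_rpow_of_nonpos hpos hbase (by linarith)
      _ = 2 ^ (1 + σ) * L ^ (-(1 + σ)) * |(n : ℝ)| ^ (-(1 + σ)) := by
          rw [Real.div_rpow (by positivity) (by norm_num), Real.mul_rpow (by positivity)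
            (by positivity), Real.rpow_neg (by norm_num : (0 : ℝ) ≤ 2), div_inv_eq_mul]
          ring
      _ ≤ 4 * L ^ (-(1 + σ)) * |(n : ℝ)| ^ (-(1 + η)) := by
          gcongr
          · calc (2 : ℝ) ^ (1 + σ) ≤ 2 ^ (2 : ℝ) := by
                  apply Real.rpow_le_rpow_of_exponent_le <;> linarith
              _ = 4 := by norm_num
  calc ∑' m, F m = ∑' m : S, F m := (tsum_subtype_eq_of_support_subset hsupp).symm
    _ ≤ ∑' m : S, (fun y : Bool × ℤ => ENNReal.ofReal (4 * L ^ (-(1 + σ))) *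
      ENNReal.ofReal ((y.2.natAbs : ℝ) ^ (-(1 + η)))) (Φ m) := ENNReal.tsum_le_tsum hbound
    _ ≤ ∑' y : Bool × ℤ, ENNReal.ofReal (4 * L ^ (-(1 + σ))) *
      ENNReal.ofReal ((y.2.natAbs : ℝ) ^ (-(1 + η))) :=
        ENNReal.tsum_comp_le_tsum_of_injective hinj _
    _ = 2 * (ENNReal.ofReal (4 * L ^ (-(1 + σ))) *
        ∑' n : ℤ, ENNReal.ofReal ((n.natAbs : ℝ) ^ (-(1 + η)))) := by
        rw [ENNReal.tsum_prod (f := fun (_ : Bool) (n : ℤ) => ENNReal.ofReal (4 * L ^ (-(1 + σ))) *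
          ENNReal.ofReal ((n.natAbs : ℝ) ^ (-(1 + η)))), tsum_fintype, Fintype.sum_bool, ← two_mul, ENNReal.tsum_mul_left]
    _ ≤ 2 * (ENNReal.ofReal (4 * L ^ (-(1 + σ))) * (2 * zetaSum η)) := by
        gcongr
        exact tsum_int_natAbs_le fun n => ENNReal.ofReal ((n : ℝ) ^ (-(1 + η)))
    _ = 16 * ENNReal.ofReal (L ^ (-(1 + σ))) * zetaSum η := by
        rw [ENNReal.ofReal_mul (by norm_num), ENNReal.ofReal_ofNat]
        ring

/-- The weighted number of lattice points of norm at most `R` in a sector. -/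
lemma sector_weight {Δ P R β A α : ℝ} (hΔ : 0 ≤ Δ) (hP : 0 ≤ P) (hβ : 1 / 2 ≤ β) (hR : 0 ≤ R)
    {F : ℤ × ℤ → ℝ≥0∞}
    (h1 : ∀ m, F m ≠ 0 → m ≠ 0 ∧ ‖latticePoint m‖ ≤ R ∧ |crossU m α| ≤ 1 + Δ * ‖latticePoint m‖)
    (h2 : ∀ m, F m ≤ ENNReal.ofReal (P * ‖latticePoint m‖ ^ (-β)))
    (hA : ∑ n ∈ Finset.Icc 1 ⌊R⌋₊, (n : ℝ) ^ (1 - β) ≤ A) :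
    ∑' m, F m ≤ ENNReal.ofReal (40 * P * (2 * √R + 2 * Δ * A)) := by
  set N := ⌊R⌋₊ with hN
  set g : ℕ → ℝ≥0∞ := fun n => if n ∈ Finset.Icc 1 N then ENNReal.ofReal (P * (n : ℝ) ^ (-β)) else 0
    with hg
  have hFg : ∀ m, F m ≤ g (max m.1.natAbs m.2.natAbs) := by
    intro m
    by_cases hm : F m = 0
    · rw [hm]; exact zero_le
    obtain ⟨hm0, hmR, -⟩ := h1 m hm
    have h3 := max_le_norm_latticePoint m
    have hk0 : 1 ≤ max m.1.natAbs m.2.natAbs := by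
      by_contra hc
      apply hm0
      have h4 : m.1.natAbs = 0 := by omega
      have h5 : m.2.natAbs = 0 := by omega
      exact Prod.ext (Int.natAbs_eq_zero.mp h4) (Int.natAbs_eq_zero.mp h5)
    set k := max m.1.natAbs m.2.natAbs
    have hkN : k ∈ Finset.Icc 1 N :=
      Finset.mem_Icc.mpr ⟨hk0, Nat.le_floor (h3.trans hmR)⟩
    simp only [hg, if_pos hkN]
    refine (h2 m).trans (ENNReal.ofReal_le_ofReal ?_)
    have : (0 : ℝ) < k := by exact_mod_cast hk0
    exact mul_le_mul_of_nonneg_left (Real.rpow_le_rpow_of_nonpos this h3 (by linarith)) hP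
  refine (sector_sum hΔ (fun m hm => (h1 m hm).2.2) hFg).trans ?_
  have hsum : ∑' n : ℕ, ENNReal.ofReal (10 * (1 + 2 * Δ * n)) * g n =
      ∑ n ∈ Finset.Icc 1 N, ENNReal.ofReal (10 * (1 + 2 * Δ * n) * (P * (n : ℝ) ^ (-β))) := by
    rw [tsum_eq_sum (s := Finset.Icc 1 N)]
    · apply Finset.sum_congr rfl
      intro n hn
      rw [hg]
      simp only [if_pos hn]
      rw [← ENNReal.ofReal_mul (by positivity)]
    · intro n hn
      rw [hg]
      simp only [if_neg hn, mul_zero]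
  rw [hsum, ← ENNReal.ofReal_sum_of_nonneg (fun n _ => by positivity)]
  rw [show (4 : ℝ≥0∞) = ENNReal.ofReal 4 by norm_num, ← ENNReal.ofReal_mul (by norm_num)]
  apply ENNReal.ofReal_le_ofReal
  -- The width of the sector has a constant part, summed with exponent `-1/2`, and a linear part,
  -- summed by `A`. The latter stays a parameter because `1 - β` is nonnegative for near scatterers
  -- and nonpositive for far ones.
  have hterm : ∀ n ∈ Finset.Icc 1 N, 10 * (1 + 2 * Δ * n) * (P * (n : ℝ) ^ (-β)) ≤
      10 * P * (n : ℝ) ^ (-(1 / 2 : ℝ)) + 20 * P * Δ * (n : ℝ) ^ (1 - β) := by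
    intro n hn
    have hn1 : (1 : ℝ) ≤ n := by exact_mod_cast (Finset.mem_Icc.mp hn).1
    have e : (n : ℝ) ^ (1 - β) = n * (n : ℝ) ^ (-β) := by
      rw [sub_eq_neg_add, Real.rpow_add_one (by positivity), mul_comm]
    have h3 : (n : ℝ) ^ (-β) ≤ (n : ℝ) ^ (-(1 / 2 : ℝ)) :=
      Real.rpow_le_rpow_of_exponent_le hn1 (by linarith)
    have h4 : P * (n : ℝ) ^ (-β) ≤ P * (n : ℝ) ^ (-(1 / 2 : ℝ)) := by gcongr
    rw [e]
    linarith
  have h5 := Finset.sum_le_sum hterm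
  rw [Finset.sum_add_distrib, ← Finset.mul_sum, ← Finset.mul_sum] at h5
  have h6 : ∑ n ∈ Finset.Icc 1 N, (n : ℝ) ^ (-(1 / 2 : ℝ)) ≤ 2 * √R := by
    refine (sum_inv_sqrt_le N).trans ?_
    gcongr
    exact Nat.floor_le hR
  calc _ ≤ 4 * (10 * P * (2 * √R) + 20 * P * Δ * A) := by
        refine mul_le_mul_of_nonneg_left (h5.trans ?_) (by norm_num)
        gcongr
    _ = _ := by ring

/-! ### The sum over visible scatterers -/

/-- A bound for the cosine of the outgoing angle at a visible scatterer at distance `L`. -/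
def grazing (ε L : ℝ) : ℝ := if L < 36 / ε then 1 else √(8 / (ε * L))

lemma grazing_nonneg (ε L : ℝ) : 0 ≤ grazing ε L := by
  unfold grazing; split_ifs <;> positivity

/-- The powers of `ε` in the linear part cancel exactly, `ε * ε ^ ν * (36 / ε) ^ (1 + ν) = 36 ^ (1 +
ν) ≤ 216`, leaving a multiple of `c`. The constant part gives `ε * √(36 / ε) = 6 √ε`. -/
lemma near_sum {ε ν c α : ℝ} (hε0 : 0 < ε) (hν0 : 0 ≤ ν) (hν : ν ≤ 1 / 2)
    (hc : 0 < c) {F : ℤ × ℤ → ℝ≥0∞}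
    (h1 : ∀ m, F m ≠ 0 → m ≠ 0 ∧ ‖latticePoint m‖ ≤ 36 / ε ∧
      |crossU m α| ≤ 1 + 2 * c * ε ^ ν * ‖latticePoint m‖)
    (h2 : ∀ m, F m ≤ ENNReal.ofReal (ε * ‖latticePoint m‖ ^ (ν - 1))) :
    ∑' m, F m ≤ ENNReal.ofReal (34560 * (c + √ε)) := by
  have hN : (⌊36 / ε⌋₊ : ℝ) ≤ 36 / ε := Nat.floor_le (by positivity)
  have hA : ∑ n ∈ Finset.Icc 1 ⌊36 / ε⌋₊, (n : ℝ) ^ (1 - (1 - ν)) ≤ (36 / ε) ^ (1 + ν) := by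
    rw [sub_sub_cancel]
    refine (sum_rpow_le hν0 _).trans ?_
    gcongr
  refine (sector_weight (β := 1 - ν) (P := ε) (by positivity) hε0.le (by linarith)
    (by positivity) h1 (by simpa using h2) hA).trans (ENNReal.ofReal_le_ofReal ?_)
  have e1 : ε * √(36 / ε) = 6 * √ε := by
    rw [Real.sqrt_div (by norm_num), show (36 : ℝ) = 6 ^ 2 by norm_num,
      Real.sqrt_sq (by norm_num)]
    have := Real.mul_self_sqrt hε0.le
    have h0 : 0 < √ε := Real.sqrt_pos.mpr hε0
    field_simp
    nlinarith
  have e2 : ε * (ε ^ ν * (36 / ε) ^ (1 + ν)) = 36 ^ (1 + ν) := by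
    rw [Real.div_rpow (by norm_num) hε0.le, Real.rpow_add hε0, Real.rpow_one]
    have : 0 < ε ^ ν := by positivity
    field_simp
  have e3 : (36 : ℝ) ^ (1 + ν) ≤ 216 := by
    calc (36 : ℝ) ^ (1 + ν) ≤ 36 ^ (3 / 2 : ℝ) := by
          apply Real.rpow_le_rpow_of_exponent_le <;> linarith
      _ = 216 := by
          rw [show (36 : ℝ) = 6 ^ (2 : ℝ) by norm_num, ← Real.rpow_mul (by norm_num)]
          norm_num
  have e4 : 40 * ε * (2 * √(36 / ε) + 2 * (2 * c * ε ^ ν) * (36 / ε) ^ (1 + ν)) =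
      80 * (ε * √(36 / ε)) + 160 * c * (ε * (ε ^ ν * (36 / ε) ^ (1 + ν))) := by ring
  rw [e4, e1, e2]
  have h0 : 0 ≤ √ε := Real.sqrt_nonneg ε
  nlinarith

/-- A sum over the corridor directions `e`. With `σ = a/2 - ν` the powers of `ε` in the linear part
again cancel, leaving a multiple of `c`; the constant part has the exponent `(1 - a) / 2 ≥ η / 2`.
-/
lemma far_sum {ε ν σ a η c α : ℝ} (hε0 : 0 < ε) (hε : ε < 1) (hσ0 : 0 ≤ σ) (hσ : σ ≤ 1 / 2)
    (hσa : σ = a / 2 - ν) (ha : a ≤ 1 - η)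
    (hc : 0 < c) {F : ℤ × ℤ → ℝ≥0∞}
    (h1 : ∀ m, F m ≠ 0 → m ≠ 0 ∧ ‖latticePoint m‖ ≤ 4 / ε ∧
      |crossU m α| ≤ 1 + 2 * c * ε ^ ν * ‖latticePoint m‖)
    (h2 : ∀ m, F m ≤ ENNReal.ofReal (ε ^ (1 - a / 2) * ‖latticePoint m‖ ^ (-(1 + σ)))) :
    ∑' m, F m ≤ ENNReal.ofReal (1280 * (c + ε ^ (η / 2))) := by
  have hN : (⌊4 / ε⌋₊ : ℝ) ≤ 4 / ε := Nat.floor_le (by positivity)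
  have hA : ∑ n ∈ Finset.Icc 1 ⌊4 / ε⌋₊, (n : ℝ) ^ (1 - (1 + σ)) ≤ 2 * (4 / ε) ^ (1 - σ) := by
    have : (1 : ℝ) - (1 + σ) = -σ := by ring
    rw [this]
    refine (sum_rpow_neg_le hσ _).trans ?_
    gcongr
    linarith
  refine (sector_weight (P := ε ^ (1 - a / 2)) (by positivity) (by positivity) (by linarith)
    (by positivity) h1 h2 hA).trans (ENNReal.ofReal_le_ofReal ?_)
  have e1 : ε ^ (1 - a / 2) * √(4 / ε) ≤ 2 * ε ^ (η / 2) := by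
    rw [Real.sqrt_div (by norm_num), show (4 : ℝ) = 2 ^ 2 by norm_num,
      Real.sqrt_sq (by norm_num), Real.sqrt_eq_rpow, div_eq_mul_inv (2 : ℝ), ← Real.rpow_neg hε0.le]
    have : ε ^ (1 - a / 2) * (2 * ε ^ (-(1 / 2 : ℝ))) = 2 * ε ^ (1 - a / 2 + -(1 / 2)) := by
      rw [Real.rpow_add hε0]; ring
    rw [this]
    refine mul_le_mul_of_nonneg_left ?_ (by norm_num)
    exact Real.rpow_le_rpow_of_exponent_ge hε0 hε.le (by linarith)
  have e2 : ε ^ (1 - a / 2) * (ε ^ ν * (4 / ε) ^ (1 - σ)) = 4 ^ (1 - σ) := by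
    rw [Real.div_rpow (by norm_num) hε0.le, div_eq_mul_inv ((4 : ℝ) ^ (1 - σ)), ← Real.rpow_neg hε0.le]
    have : ε ^ (1 - a / 2) * (ε ^ ν * (4 ^ (1 - σ) * ε ^ (-(1 - σ)))) =
      4 ^ (1 - σ) * ε ^ (1 - a / 2 + ν + -(1 - σ)) := by
      rw [Real.rpow_add hε0, Real.rpow_add hε0]; ring
    rw [this, hσa]
    ring_nf
    simp
  have e3 : (4 : ℝ) ^ (1 - σ) ≤ 4 := by
    calc (4 : ℝ) ^ (1 - σ) ≤ 4 ^ (1 : ℝ) := by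
          apply Real.rpow_le_rpow_of_exponent_le <;> linarith
      _ = 4 := by norm_num
  have e4 : 40 * ε ^ (1 - a / 2) * (2 * √(4 / ε) + 2 * (2 * c * ε ^ ν) * (2 * (4 / ε) ^ (1 - σ))) =
      80 * (ε ^ (1 - a / 2) * √(4 / ε)) +
        320 * c * (ε ^ (1 - a / 2) * (ε ^ ν * (4 / ε) ^ (1 - σ))) := by ring
  rw [e4, e2]
  have h0 : 0 < ε ^ (η / 2) := by positivity
  nlinarith

open Classical in
/-- The sum over the visible scatterers. -/
lemma weighted_count {ε ν a η c α : ℝ} (hε0 : 0 < ε) (hε : ε < 1 / 2) (hν0 : 0 ≤ ν) (hη : 0 < η)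
    (ha : a ≤ 1 - η) (hνa : 2 * ν ≤ a - η) (hc : 0 < c) {P : ℤ × ℤ → Prop}
    (h0 : ∀ m, P m → m ≠ 0 ∧ |crossU m α| ≤ 1 + 2 * c * ε ^ ν * ‖latticePoint m‖)
    (h1 : ∀ m, P m → 36 / ε ≤ ‖latticePoint m‖ → ∃ e : ℤ × ℤ, |e.2 * m.1 - e.1 * m.2| = 1 ∧
      ‖latticePoint e‖ ≤ 4 / ε ∧ |crossU e α| ≤ 1 + 2 * c * ε ^ ν * ‖latticePoint e‖) :
    ∑' m, (if P m then ENNReal.ofReal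
      (ε * ‖latticePoint m‖ ^ (ν - 1) * grazing ε ‖latticePoint m‖ ^ a) else 0) ≤
      ENNReal.ofReal (61440 * (c + ε ^ (η / 2))) * (1 + zetaSum (η / 2)) := by
  set σ := a / 2 - ν with hσ
  set A : ℤ × ℤ → ℝ≥0∞ := fun m => if P m ∧ ‖latticePoint m‖ < 36 / ε then
    ENNReal.ofReal (ε * ‖latticePoint m‖ ^ (ν - 1)) else 0 with hA
  set Q : ℤ × ℤ → Prop := fun e => e ≠ 0 ∧ ‖latticePoint e‖ ≤ 4 / ε ∧
    |crossU e α| ≤ 1 + 2 * c * ε ^ ν * ‖latticePoint e‖ with hQ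
  set B : ℤ × ℤ → ℤ × ℤ → ℝ≥0∞ := fun e m =>
    if |e.2 * m.1 - e.1 * m.2| = 1 ∧ 36 / ε ≤ ‖latticePoint m‖ then
      ENNReal.ofReal (‖latticePoint m‖ ^ (-(1 + σ))) else 0 with hB
  set G : ℤ × ℤ → ℝ≥0∞ := fun e => if Q e then
    ENNReal.ofReal (ε ^ (1 - a / 2) * ‖latticePoint e‖ ^ (-(1 + σ))) else 0 with hG
  have hnear : ∑' m, A m ≤ ENNReal.ofReal (34560 * (c + √ε)) := by
    apply near_sum (α := α) hε0 hν0 (by linarith) hc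
    · intro m hm
      have hm' : P m ∧ ‖latticePoint m‖ < 36 / ε := by
        by_contra h; exact hm (if_neg h)
      exact ⟨(h0 m hm'.1).1, hm'.2.le, (h0 m hm'.1).2⟩
    · intro m
      rw [hA]; simp only; split_ifs
      · exact le_rfl
      · exact zero_le
  have hG2 : ∑' e, G e ≤ ENNReal.ofReal (1280 * (c + ε ^ (η / 2))) := by
    apply far_sum (α := α) (ν := ν) hε0 (by linarith) (by linarith) (by linarith) hσ ha hc
    · intro m hm
      by_contra h; exact hm (if_neg h)
    · intro m
      rw [hG]; simp only; split_ifs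
      · exact le_rfl
      · exact zero_le
  have hrow : ∀ e, Q e → ∑' m, B e m ≤
      16 * ENNReal.ofReal (‖latticePoint e‖ ^ (-(1 + σ))) * zetaSum (η / 2) := by
    intro e he
    refine row_sum hε0 hε (by linarith) (by linarith) (by linarith) he.1 he.2.1 ?_ ?_
    · intro m hm
      by_contra h; exact hm (if_neg h)
    · intro m
      rw [hB]; simp only; split_ifs
      · exact le_rfl
      · exact zero_le
  -- For far `m` the power of `grazing` turns the weight into `ε ^ (1 - a/2) ‖m‖ ^ (-(1 + σ))` up to
  -- the factor `8 ^ (a/2) ≤ 3`. The vector `e` of its corridor is not selected: summing over all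
  -- admissible `e` only increases the bound, and the two sums can be exchanged.
  have hpt : ∀ m, (if P m then ENNReal.ofReal
      (ε * ‖latticePoint m‖ ^ (ν - 1) * grazing ε ‖latticePoint m‖ ^ a) else 0) ≤
      A m + ∑' e, (if Q e then 3 * ENNReal.ofReal (ε ^ (1 - a / 2)) * B e m else 0) := by
    intro m
    by_cases hm : P m
    swap
    · rw [if_neg hm]; exact zero_le
    rw [if_pos hm]
    set L := ‖latticePoint m‖ with hL
    have hL1 : 1 ≤ L := one_le_norm_latticePoint (h0 m hm).1
    rcases lt_or_ge L (36 / ε) with hlt | hge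
    · refine le_trans ?_ le_self_add
      rw [hA]
      simp only
      rw [if_pos ⟨hm, hlt⟩, grazing, if_pos hlt, Real.one_rpow, mul_one]
    · refine le_trans ?_ le_add_self
      obtain ⟨e, he1, he2, he3⟩ := h1 m hm hge
      have he0 : e ≠ 0 := by rintro rfl; simp at he1
      refine le_trans ?_ (ENNReal.le_tsum e)
      have hQe : Q e := ⟨he0, he2, he3⟩
      rw [if_pos hQe, hB]
      simp only
      rw [if_pos ⟨he1, hge⟩, show (3 : ℝ≥0∞) = ENNReal.ofReal 3 by norm_num,
        ← ENNReal.ofReal_mul (by norm_num), ← ENNReal.ofReal_mul (by positivity)]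
      apply ENNReal.ofReal_le_ofReal
      rw [grazing, if_neg (not_lt.mpr hge), Real.sqrt_eq_rpow, ← Real.rpow_mul (by positivity),
        ← hL, Real.div_rpow (by norm_num) (by positivity), Real.mul_rpow hε0.le (by linarith)]
      have h3 : (8 : ℝ) ^ (1 / 2 * a) ≤ 3 := by
        calc (8 : ℝ) ^ (1 / 2 * a) ≤ 8 ^ (1 / 2 : ℝ) := by
              apply Real.rpow_le_rpow_of_exponent_le <;> linarith
          _ ≤ 3 := by
              rw [← Real.sqrt_eq_rpow]
              exact Real.sqrt_le_iff.mpr ⟨by norm_num, by norm_num⟩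
      have hL0 : 0 < L := by linarith
      have e1 : L ^ (-(1 + σ)) = L ^ (ν - 1) * (L ^ (1 / 2 * a))⁻¹ := by
        rw [← Real.rpow_neg hL0.le, ← Real.rpow_add hL0, hσ]; ring_nf
      have e2 : ε ^ (1 - a / 2) = ε * (ε ^ (1 / 2 * a))⁻¹ := by
        rw [← Real.rpow_neg hε0.le]
        nth_rewrite 2 [← Real.rpow_one ε]
        rw [← Real.rpow_add hε0]; ring_nf
      rw [e1, e2]
      calc _ = 8 ^ (1 / 2 * a) * (ε * (ε ^ (1 / 2 * a))⁻¹ * (L ^ (ν - 1) * (L ^ (1 / 2 * a))⁻¹)) := by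
            field_simp
        _ ≤ 3 * (ε * (ε ^ (1 / 2 * a))⁻¹ * (L ^ (ν - 1) * (L ^ (1 / 2 * a))⁻¹)) := by gcongr
        _ = _ := by ring
  have hsqrt : √ε ≤ ε ^ (η / 2) := by
    rw [Real.sqrt_eq_rpow]
    exact Real.rpow_le_rpow_of_exponent_ge hε0 (by linarith) (by linarith)
  have hε2 : 0 < ε ^ (η / 2) := by positivity
  calc _ ≤ ∑' m, (A m + ∑' e, (if Q e then 3 * ENNReal.ofReal (ε ^ (1 - a / 2)) * B e m else 0)) :=
        ENNReal.tsum_le_tsum hpt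
    _ = ∑' m, A m + ∑' e, ∑' m, (if Q e then 3 * ENNReal.ofReal (ε ^ (1 - a / 2)) * B e m else 0) := by
        rw [ENNReal.tsum_add, ENNReal.tsum_comm]
    _ ≤ ∑' m, A m + ∑' e, 48 * zetaSum (η / 2) * G e := by
        refine add_le_add le_rfl (ENNReal.tsum_le_tsum fun e => ?_)
        by_cases he : Q e
        · simp only [if_pos he]
          rw [ENNReal.tsum_mul_left, hG]
          simp only [if_pos he]
          rw [ENNReal.ofReal_mul (by positivity)]
          calc _ ≤ 3 * ENNReal.ofReal (ε ^ (1 - a / 2)) *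
              (16 * ENNReal.ofReal (‖latticePoint e‖ ^ (-(1 + σ))) * zetaSum (η / 2)) := by
                gcongr; exact hrow e he
            _ = _ := by ring
        · simp only [if_neg he, tsum_zero]; exact zero_le
    _ ≤ ENNReal.ofReal (34560 * (c + √ε)) +
        48 * zetaSum (η / 2) * ENNReal.ofReal (1280 * (c + ε ^ (η / 2))) := by
        rw [ENNReal.tsum_mul_left]
        gcongr
    _ ≤ ENNReal.ofReal (61440 * (c + ε ^ (η / 2))) +
        ENNReal.ofReal (61440 * (c + ε ^ (η / 2))) * zetaSum (η / 2) := by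
        refine add_le_add (ENNReal.ofReal_le_ofReal (by linarith)) (le_of_eq ?_)
        have : ENNReal.ofReal (61440 * (c + ε ^ (η / 2))) =
            48 * ENNReal.ofReal (1280 * (c + ε ^ (η / 2))) := by
          rw [← ENNReal.ofReal_ofNat 48, ← ENNReal.ofReal_mul (by norm_num)]
          ring_nf
        rw [this]
        ring
    _ = _ := by ring

/-! ### Stable leaves and homogeneity strips -/

lemma abs_snd_sub_le_dist (x y : Cylinder) : |x.snd - y.snd| ≤ dist x y := by
  rw [WithLp.prod_dist_eq_of_L2, ← Real.dist_eq]
  apply Real.le_sqrt_of_sq_le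
  nlinarith [sq_nonneg (dist x.fst y.fst)]

lemma dist_point_le (θ φ θ' φ' : ℝ) :
    dist (point θ φ) (point θ' φ') ≤ |θ - θ'| + |φ - φ'| := by
  rw [WithLp.prod_dist_eq_of_L2]
  have h1 : dist (point θ φ).fst (point θ' φ').fst ≤ |θ - θ'| := by
    change dist (θ : Real.Angle) (θ' : Real.Angle) ≤ _
    rw [dist_eq_norm, ← Real.Angle.coe_sub, ← Real.norm_eq_abs]
    exact QuotientAddGroup.norm_mk_le_norm
  have h2 : dist (point θ φ).snd (point θ' φ').snd = |φ - φ'| := rfl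
  rw [h2]
  apply Real.sqrt_le_iff.mpr
  refine ⟨by positivity, ?_⟩
  have := dist_nonneg (x := (point θ φ).fst) (y := (point θ' φ').fst)
  have := abs_nonneg (φ - φ')
  have := abs_nonneg (θ - θ')
  nlinarith

/-- The properties of an admissible stable leaf that matter for the growth of its preimage: a
decreasing graph, whose variation is bounded by its length. -/
lemma IsAdmissibleStableLeaf.exists_graph {ε r₀ B δ₀ : ℝ} {k₀ : ℕ} {W : Set Cylinder}
    (hδ : 0 ≤ δ₀) (hW : IsAdmissibleStableLeaf ε r₀ k₀ B δ₀ W) :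
    ∃ (I : Set ℝ) (w : ℝ → ℝ), I.OrdConnected ∧ I.Nonempty ∧ W = (fun θ => point θ (w θ)) '' I ∧
      ContinuousOn w I ∧ (∀ θ ∈ I, w θ ∈ Icc (-(π / 2)) (π / 2)) ∧
      ∀ θ₁ ∈ I, ∀ θ₂ ∈ I, θ₁ ≤ θ₂ → θ₂ - θ₁ ≤ w θ₁ - w θ₂ ∧ w θ₁ - w θ₂ ≤ δ₀ := by
  obtain ⟨⟨I, w, hI, hIn, hWI, hw, hw', -⟩, hhom, -, hlen⟩ := hW
  have hcont : ContinuousOn w I := hw.continuousOn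
  refine ⟨I, w, hI, hIn.nonempty, hWI, hcont, ?_, ?_⟩
  · have hsub : W ⊆ phaseSpace := by
      rcases hhom with h | ⟨k, -, h | h⟩
      · exact h.trans inter_subset_right
      · exact h.trans inter_subset_right
      · exact h.trans inter_subset_right
    intro θ hθ
    have : point θ (w θ) ∈ W := by rw [hWI]; exact mem_image_of_mem _ hθ
    exact hsub this
  · intro θ₁ h₁ θ₂ h₂ h12
    constructor
    · have hder : ∀ x ∈ interior I, deriv w x ≤ -1 := by
        intro x hx
        rw [← derivWithin_of_mem_nhds (mem_interior_iff_mem_nhds.mp hx)]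
        exact (hw' x (interior_subset hx)).2
      have hdiff : DifferentiableOn ℝ w (interior I) :=
        (hw.differentiableOn (by norm_num)).mono interior_subset
      have := hI.convex.image_sub_le_mul_sub_of_deriv_le hcont hdiff hder θ₁ h₁ θ₂ h₂ h12
      linarith
    -- The projection to `φ` is 1-Lipschitz, so the interval of values covered by the leaf is no
    -- longer than the leaf.
    · have hlip : LipschitzWith 1 (fun x : Cylinder => x.snd) :=
        LipschitzWith.of_dist_le_mul fun x y => by
          rw [NNReal.coe_one, one_mul, Real.dist_eq]; exact abs_snd_sub_le_dist x y
      have himg : Icc (w θ₂) (w θ₁) ⊆ (fun x : Cylinder => x.snd) '' W := by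
        rw [hWI, image_image]
        have h3 : ContinuousOn w (Icc θ₁ θ₂) := hcont.mono (hI.out h₁ h₂)
        exact (intermediate_value_Icc' h12 h3).trans (image_mono (hI.out h₁ h₂))
      have h4 : ENNReal.ofReal (w θ₁ - w θ₂) ≤ ENNReal.ofReal δ₀ := by
        calc ENNReal.ofReal (w θ₁ - w θ₂) = volume (Icc (w θ₂) (w θ₁)) := Real.volume_Icc.symm
          _ ≤ volume ((fun x : Cylinder => x.snd) '' W) := measure_mono himg
          _ = Measure.hausdorffMeasure 1 ((fun x : Cylinder => x.snd) '' W) := by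
              rw [hausdorffMeasure_real]
          _ ≤ ((1 : NNReal) : ℝ≥0∞) ^ (1 : ℝ) * Measure.hausdorffMeasure 1 W :=
              hlip.hausdorffMeasure_image_le zero_le_one W
          _ = length W := by simp [length]
          _ ≤ ENNReal.ofReal δ₀ := hlen
      rwa [ENNReal.ofReal_le_ofReal_iff hδ] at h4

/-- The distance of the angle `f` to the upper or the lower end of `[-π/2, π/2]`. -/
def edgeDist (b : Bool) (f : ℝ) : ℝ := if b then π / 2 - f else π / 2 + f

/-- The interior of the homogeneity strip with index `k ≥ k₀` at one of the two ends of
`[-π/2, π/2]`; the index `0` stands for the central strip. -/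
def InStrip (r₀ : ℝ) (k₀ : ℕ) (s : Bool × ℕ) (f : ℝ) : Prop :=
  (s.2 = 0 ∧ (k₀ : ℝ) ^ (-r₀) < π / 2 - f ∧ (k₀ : ℝ) ^ (-r₀) < π / 2 + f) ∨
  (k₀ ≤ s.2 ∧ ((s.2 : ℝ) + 1) ^ (-r₀) < edgeDist s.1 f ∧ edgeDist s.1 f < (s.2 : ℝ) ^ (-r₀))

/-- A bound for `cos φ` on a homogeneity strip. -/
def stripWidth (r₀ : ℝ) (k : ℕ) : ℝ := if k = 0 then 1 else (k : ℝ) ^ (-r₀)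

lemma InStrip.between {r₀ : ℝ} {k₀ : ℕ} {s : Bool × ℕ} {f₁ f f₂ : ℝ} (h₁ : InStrip r₀ k₀ s f₁)
    (h₂ : InStrip r₀ k₀ s f₂) (hk₀ : 1 ≤ k₀) (h : f₁ ≤ f) (h' : f ≤ f₂) : InStrip r₀ k₀ s f := by
  rcases h₁ with ⟨a, b, c⟩ | ⟨a, b, c⟩ <;> rcases h₂ with ⟨a', b', c'⟩ | ⟨a', b', c'⟩
  · exact Or.inl ⟨a, by linarith, by linarith⟩
  · omega
  · omega
  · refine Or.inr ⟨a, ?_⟩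
    unfold edgeDist at *
    split_ifs at * <;> constructor <;> linarith

lemma rpow_neg_le_one {k : ℕ} {r₀ : ℝ} (hk : 1 ≤ k) (hr : 0 < r₀) : (k : ℝ) ^ (-r₀) ≤ 1 :=
  Real.rpow_le_one_of_one_le_of_nonpos (by exact_mod_cast hk) (by linarith)

lemma InStrip.snd_notMem {r₀ : ℝ} {k₀ : ℕ} {s : Bool × ℕ} {x : Cylinder} (hk₀ : 1 ≤ k₀)
    (hr : 0 < r₀) (h : InStrip r₀ k₀ s x.snd) (hx : x ∈ phaseSpace) :
    x ∉ stripBoundaries r₀ k₀ := by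
  rintro ⟨k, hk, hb⟩
  have h1 : |π / 2 - x.snd| = π / 2 - x.snd := abs_of_nonneg (by linarith [hx.2])
  have h2 : |-(π / 2) - x.snd| = π / 2 + x.snd := by
    rw [abs_of_nonpos (by linarith [hx.1])]; ring
  rw [h1, h2] at hb
  have hk1 : (k : ℝ) ^ (-r₀) ≤ 1 := rpow_neg_le_one (hk₀.trans hk) hr
  have hanti : ∀ i j : ℕ, 1 ≤ i → i ≤ j → (j : ℝ) ^ (-r₀) ≤ (i : ℝ) ^ (-r₀) := by
    intro i j hi hij
    have : (0 : ℝ) < i := by exact_mod_cast hi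
    exact Real.rpow_le_rpow_of_nonpos this (by exact_mod_cast hij) (by linarith)
  have hpi := Real.pi_gt_three
  rcases h with ⟨-, h3, h4⟩ | ⟨h3, h4, h5⟩
  · have := hanti k₀ k hk₀ hk
    rcases hb with hb | hb <;> linarith
  · have h6 : edgeDist s.1 x.snd ≠ (k : ℝ) ^ (-r₀) := by
      rcases le_or_gt k s.2 with hle | hgt
      · have := hanti k s.2 (hk₀.trans hk) hle
        linarith
      · have := hanti (s.2 + 1) k (by omega) hgt
        push_cast at this
        linarith
    have h7 : edgeDist s.1 x.snd < 1 := h5.trans_le (rpow_neg_le_one (hk₀.trans h3) hr)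
    unfold edgeDist at h6 h7
    split_ifs at h6 h7
    · rcases hb with hb | hb
      · exact h6 hb
      · linarith
    · rcases hb with hb | hb
      · linarith
      · exact h6 hb

/-- `k + 1` is the first index with `(k + 1) ^ (-r₀) < d`. Excluding the boundary values makes the
other inequality strict. -/
lemma exists_strip_index {r₀ d : ℝ} {k₀ : ℕ} (hr : 0 < r₀) (hd : 0 < d)
    (hd' : d < (k₀ : ℝ) ^ (-r₀)) (hne : ∀ k : ℕ, k₀ ≤ k → d ≠ (k : ℝ) ^ (-r₀)) :
    ∃ k : ℕ, k₀ ≤ k ∧ ((k : ℝ) + 1) ^ (-r₀) < d ∧ d < (k : ℝ) ^ (-r₀) := by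
  have hlim : Filter.Tendsto (fun k : ℕ => (k : ℝ) ^ (-r₀)) Filter.atTop (nhds 0) :=
    (tendsto_rpow_neg_atTop hr).comp tendsto_natCast_atTop_atTop
  have hex : ∃ k : ℕ, k₀ ≤ k ∧ (k : ℝ) ^ (-r₀) < d :=
    ((Filter.eventually_ge_atTop k₀).and (hlim.eventually_lt_const hd)).exists
  classical
  obtain ⟨h1, h2⟩ := Nat.find_spec hex
  have h3 := fun n => Nat.find_min hex (m := n)
  set n := Nat.find hex
  have hn : n ≠ k₀ := by rintro hn; rw [hn] at h2; linarith
  obtain ⟨k, hk⟩ : ∃ k, n = k + 1 := ⟨n - 1, by omega⟩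
  refine ⟨k, by omega, ?_, ?_⟩
  · rw [hk] at h2; push_cast at h2; exact h2
  · have h4 := h3 k (by omega)
    push Not at h4
    exact lt_of_le_of_ne (h4 (by omega)) (hne k (by omega))

lemma exists_inStrip {r₀ : ℝ} {k₀ : ℕ} {x : Cylinder} (hr : 0 < r₀)
    (hx : x ∈ phaseSpace) (hx0 : x ∉ singularSetZero) (hxb : x ∉ stripBoundaries r₀ k₀) :
    ∃ s, InStrip r₀ k₀ s x.snd := by
  have h1 : |π / 2 - x.snd| = π / 2 - x.snd := abs_of_nonneg (by linarith [hx.2])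
  have h2 : |-(π / 2) - x.snd| = π / 2 + x.snd := by
    rw [abs_of_nonpos (by linarith [hx.1])]; ring
  simp only [singularSetZero, mem_ofPred_eq, not_or] at hx0
  have h3 : 0 < π / 2 - x.snd := sub_pos.mpr (lt_of_le_of_ne hx.2 hx0.1)
  have h4 : 0 < π / 2 + x.snd := by
    have := lt_of_le_of_ne hx.1 (Ne.symm hx0.2); linarith
  simp only [stripBoundaries, mem_ofPred_eq, not_exists, not_and, not_or, h1, h2] at hxb
  rcases lt_or_ge (π / 2 - x.snd) ((k₀ : ℝ) ^ (-r₀)) with h5 | h5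
  · obtain ⟨k, hk, hk1, hk2⟩ := exists_strip_index hr h3 h5 fun k hk => (hxb k hk).1
    exact ⟨(true, k), Or.inr ⟨hk, hk1, hk2⟩⟩
  rcases lt_or_ge (π / 2 + x.snd) ((k₀ : ℝ) ^ (-r₀)) with h6 | h6
  · obtain ⟨k, hk, hk1, hk2⟩ := exists_strip_index hr h4 h6 fun k hk => (hxb k hk).2
    exact ⟨(false, k), Or.inr ⟨hk, hk1, hk2⟩⟩
  · exact ⟨(true, 0), Or.inl ⟨rfl, lt_of_le_of_ne h5 (Ne.symm (hxb k₀ le_rfl).1),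
      lt_of_le_of_ne h6 (Ne.symm (hxb k₀ le_rfl).2)⟩⟩

lemma cos_le_edgeDist {f : ℝ} (hf : f ∈ Icc (-(π / 2)) (π / 2)) (b : Bool) :
    Real.cos f ≤ edgeDist b f := by
  unfold edgeDist
  split_ifs
  · rw [← Real.sin_pi_div_two_sub]; exact Real.sin_le (by linarith [hf.2])
  · rw [← Real.cos_neg, ← Real.sin_pi_div_two_sub, sub_neg_eq_add]
    exact Real.sin_le (by linarith [hf.1])

/-- A connected set that avoids the boundaries of the strips stays in one strip. -/
lemma cos_le_stripWidth {r₀ : ℝ} {k₀ : ℕ} {s : Bool × ℕ} {V : Set Cylinder} {x y : Cylinder}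
    (hV : IsPreconnected V) (hVp : V ⊆ phaseSpace)
    (hVb : ∀ z ∈ V, z ∉ stripBoundaries r₀ k₀) (hx : x ∈ V) (hy : y ∈ V)
    (h : InStrip r₀ k₀ s x.snd) : Real.cos y.snd ≤ stripWidth r₀ s.2 := by
  unfold stripWidth
  split_ifs with hs
  · exact Real.cos_le_one _
  have h' : k₀ ≤ s.2 ∧ edgeDist s.1 x.snd < (s.2 : ℝ) ^ (-r₀) := by
    rcases h with h | h
    · exact absurd h.1 hs
    · exact ⟨h.1, h.2.2⟩
  refine (cos_le_edgeDist (hVp hy) s.1).trans ?_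
  by_contra hc
  push Not at hc
  have hcont : ContinuousOn (fun z : Cylinder => edgeDist s.1 z.snd) V := by
    unfold edgeDist
    have h3 : Continuous fun x : Cylinder => x.snd := by fun_prop
    split_ifs <;> fun_prop
  -- Leaving the strip inwards would require crossing its boundary curve, by connectedness. Only
  -- this inner side is needed.
  obtain ⟨z, hz, hz'⟩ := hV.intermediate_value hx hy hcont ⟨h'.2.le, hc.le⟩
  refine hVb z hz ⟨s.2, h'.1, ?_⟩
  simp only [edgeDist] at hz'
  split_ifs at hz'
  · left; rw [abs_of_nonneg (by linarith [(hVp hz).2])]; exact hz'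
  · right; rw [abs_of_nonpos (by linarith [(hVp hz).1])]; linarith

/-- Interpolation: it lets the corridor bound and the strip bound for the cosine act together, one
to sum over scatterers and the other to sum over strips. -/
lemma min_le_rpow_mul_rpow {q s a : ℝ} (hq : 0 ≤ q) (hs : 0 ≤ s) (ha : 0 ≤ a) (ha' : a ≤ 1) :
    min q s ≤ q ^ a * s ^ (1 - a) := by
  rcases eq_or_lt_of_le (le_min hq hs) with h | h
  · rw [← h]; positivity
  · calc min q s = min q s ^ a * min q s ^ (1 - a) := by
          rw [← Real.rpow_add h]; simp
      _ ≤ q ^ a * s ^ (1 - a) := by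
          have h1 : 0 ≤ 1 - a := by linarith
          gcongr
          · exact min_le_left _ _
          · exact min_le_right _ _

/-- The weight of a strip in the growth sum. -/
def stripWeight (η : ℝ) (k : ℕ) : ℝ := if k = 0 then 1 else (k : ℝ) ^ (-(1 + η))

lemma stripWeight_nonneg (η : ℝ) (k : ℕ) : 0 ≤ stripWeight η k := by
  unfold stripWeight; split_ifs <;> positivity

lemma stripWidth_nonneg (r₀ : ℝ) (k : ℕ) : 0 ≤ stripWidth r₀ k := by
  unfold stripWidth; split_ifs <;> positivity

/-- The choice of `a` makes `r₀ (1 - a) = 1 + r₀ η ≥ 1 + η`, so the strips are summable uniformly in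
`r₀`. -/
lemma stripWidth_rpow_le {r₀ η a : ℝ} (hr : 1 < r₀) (hη : 0 < η) (ha : a = 1 - 1 / r₀ - η) (k : ℕ) :
    stripWidth r₀ k ^ (1 - a) ≤ stripWeight η k := by
  unfold stripWidth stripWeight
  split_ifs with hk
  · rw [Real.one_rpow]
  · have hk1 : (1 : ℝ) ≤ k := by exact_mod_cast Nat.one_le_iff_ne_zero.mpr hk
    rw [← Real.rpow_mul (by linarith)]
    apply Real.rpow_le_rpow_of_exponent_le hk1
    have : -r₀ * (1 - a) = -(1 + r₀ * η) := by rw [ha]; field_simp; ring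
    rw [this]
    nlinarith

lemma tsum_stripWeight_le (η : ℝ) :
    ∑' s : Bool × ℕ, ENNReal.ofReal (stripWeight η s.2) ≤ 2 * (1 + zetaSum η) := by
  rw [ENNReal.tsum_prod (f := fun (_ : Bool) (n : ℕ) => ENNReal.ofReal (stripWeight η n)),
    tsum_fintype, Fintype.sum_bool, ← two_mul]
  gcongr
  calc _ ≤ ∑' n : ℕ, ((if n = 0 then 1 else 0) + ENNReal.ofReal ((n : ℝ) ^ (-(1 + η)))) := by
        refine ENNReal.tsum_le_tsum fun n => ?_
        unfold stripWeight
        split_ifs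
        · simp
        · simp
    _ = _ := by rw [ENNReal.tsum_add, tsum_ite_eq, zetaSum]

/-! ### Pieces of the preimage: connectedness and contraction -/

/-- `W` is the graph, over the interval `I`, of a function with slopes at most `-1`. -/
structure IsStableGraph (I : Set ℝ) (w : ℝ → ℝ) (W : Set Cylinder) : Prop where
  ordConnected : I.OrdConnected
  image_eq : W = (fun θ => point θ (w θ)) '' I
  continuousOn : ContinuousOn w I
  mem_Icc : ∀ θ ∈ I, w θ ∈ Icc (-(π / 2)) (π / 2)
  sub_le : ∀ θ₁ ∈ I, ∀ θ₂ ∈ I, θ₁ ≤ θ₂ → θ₂ - θ₁ ≤ w θ₁ - w θ₂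

lemma cutPreimage_spec {ε r₀ : ℝ} {k₀ : ℕ} {I : Set ℝ} {w : ℝ → ℝ} {W : Set Cylinder}
    (hε0 : 0 < ε) (hε : ε < 1 / 2) (hG : IsStableGraph I w W) {x : Cylinder}
    (hx : x ∈ cutPreimage ε r₀ k₀ W) : ∃ θ ∈ I, billiardMap ε x = point θ (w θ) ∧
      Visible ε (w θ) (θ - w θ) (-displacement ε x) ∧
      x = backPoint ε θ (w θ) (-displacement ε x) ∧
      x.snd = backAngle ε (w θ) (θ - w θ) (-displacement ε x) ∧
      w θ ∈ Ioo (-(π / 2)) (π / 2) := by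
  obtain ⟨⟨hxp, hxW⟩, hxS⟩ := hx
  have hx1 : x ∉ singularSetOne ε := fun h => hxS (Or.inl h)
  have hx0 : x ∉ singularSetZero := fun h => hx1 (Or.inl h)
  have hTx : billiardMap ε x ∉ singularSetZero := fun h => hx1 (Or.inr ⟨hxp, h⟩)
  rw [hG.image_eq] at hxW
  obtain ⟨θ, hθ, hT⟩ := hxW
  simp only at hT
  obtain ⟨h1, h2, h3, h4⟩ := eq_backPoint hε0 hε hxp hx0 hT.symm
  refine ⟨θ, hθ, hT.symm, h1, h2, h3, ?_⟩
  rw [← hT] at hTx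
  have hTx' : ¬ (w θ = π / 2 ∨ w θ = -(π / 2)) := hTx
  rw [not_or] at hTx'
  exact ⟨lt_of_le_of_ne h4.1 (Ne.symm hTx'.2), lt_of_le_of_ne h4.2 hTx'.1⟩

/-- On a short part of the leaf, the part of the preimage on a given scatterer and in a given strip
is connected. -/
lemma connectedComponentIn_eq_of_visible {ε r₀ ρ : ℝ} {k₀ : ℕ} {I : Set ℝ} {w : ℝ → ℝ} {W : Set Cylinder}
    (hε0 : 0 < ε) (hε : ε < 1 / 2) (hr : 0 < r₀) (hk₀ : 1 ≤ k₀) (hG : IsStableGraph I w W)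
    (hρ : ρ ≤ (1 - 2 * ε) / 4) {x₁ x₂ : Cylinder} {θ₁ θ₂ : ℝ} {m : ℤ × ℤ} {s : Bool × ℕ}
    (hθ₁ : θ₁ ∈ I) (hθ₂ : θ₂ ∈ I) (h12 : θ₁ ≤ θ₂) (hα : θ₂ - w θ₂ - (θ₁ - w θ₁) ≤ ρ)
    (hv₁ : Visible ε (w θ₁) (θ₁ - w θ₁) m) (hv₂ : Visible ε (w θ₂) (θ₂ - w θ₂) m)
    (hx₁ : x₁ = backPoint ε θ₁ (w θ₁) m) (hx₂ : x₂ = backPoint ε θ₂ (w θ₂) m)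
    (hw₁ : w θ₁ ∈ Ioo (-(π / 2)) (π / 2)) (hw₂ : w θ₂ ∈ Ioo (-(π / 2)) (π / 2))
    (hs₁ : InStrip r₀ k₀ s x₁.snd) (hs₂ : InStrip r₀ k₀ s x₂.snd) :
    connectedComponentIn (cutPreimage ε r₀ k₀ W) x₁ =
      connectedComponentIn (cutPreimage ε r₀ k₀ W) x₂ := by
  set Γ := (fun θ => backPoint ε θ (w θ) m) '' Icc θ₁ θ₂ with hΓ
  have hI : Icc θ₁ θ₂ ⊆ I := hG.ordConnected.out hθ₁ hθ₂
  have hcont : ContinuousOn (fun θ => backPoint ε θ (w θ) m) (Icc θ₁ θ₂) := by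
    have hw : ContinuousOn w (Icc θ₁ θ₂) := hG.continuousOn.mono hI
    have hb : ContinuousOn (fun θ => backAngle ε (w θ) (θ - w θ) m) (Icc θ₁ θ₂) := by
      unfold backAngle offset crossU
      fun_prop
    have hp : Continuous fun z : ℝ × ℝ => point z.1 z.2 := by
      unfold point
      have : Continuous fun z : ℝ × ℝ => ((z.1 : ℝ) : Real.Angle) :=
        Real.Angle.continuous_coe.comp continuous_fst
      exact (WithLp.prod_continuous_toLp 2 _ _).comp (this.prodMk continuous_snd)
    unfold backPoint
    exact hp.comp_continuousOn (by fun_prop : ContinuousOn (fun θ =>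
      (θ - w θ + π - backAngle ε (w θ) (θ - w θ) m, backAngle ε (w θ) (θ - w θ) m)) (Icc θ₁ θ₂))
  have hpre : IsPreconnected Γ := isPreconnected_Icc.image _ hcont
  have hx₁Γ : x₁ ∈ Γ := ⟨θ₁, left_mem_Icc.mpr h12, hx₁.symm⟩
  have hx₂Γ : x₂ ∈ Γ := ⟨θ₂, right_mem_Icc.mpr h12, hx₂.symm⟩
  have hsub : Γ ⊆ cutPreimage ε r₀ k₀ W := by
    rintro _ ⟨θ, hθ, rfl⟩
    have hθI := hI hθ
    have g1 := hG.sub_le θ₁ hθ₁ θ hθI hθ.1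
    have g2 := hG.sub_le θ hθI θ₂ hθ₂ hθ.2
    obtain ⟨hv, ho1, ho2⟩ := visible_between hε0 hε hρ (φ₁ := w θ₁) (φ := w θ) (φ₂ := w θ₂)
      (α₁ := θ₁ - w θ₁) (α := θ - w θ) (α₂ := θ₂ - w θ₂) (m := m) (by linarith [hθ.1])
      (by linarith [hθ.1]) (by linarith [hθ.2]) (by linarith [hθ.2]) hα
      (hG.mem_Icc _ hθ₁) (hG.mem_Icc _ hθ₂) hv₁ hv₂
    obtain ⟨hT, -⟩ := backPoint_spec hε0 hε (hG.mem_Icc _ hθI) hv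
    have hf := backAngle_mem_Ioo hε0 hv.1
    have hsnd : ∀ θ, (backPoint ε θ (w θ) m).snd = backAngle ε (w θ) (θ - w θ) m := fun _ => rfl
    have hphase : backPoint ε θ (w θ) m ∈ phaseSpace := ⟨hf.1.le, hf.2.le⟩
    refine ⟨⟨hphase, ?_⟩, ?_⟩
    · rw [hT, hG.image_eq]; exact mem_image_of_mem _ hθI
    · rintro ((h | h) | h)
      · rcases h with h | h
        · rw [hsnd] at h; exact hf.2.ne h
        · rw [hsnd] at h; exact hf.1.ne' h
      · have h2 := h.2
        rw [hT] at h2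
        have h3 : w θ = π / 2 ∨ w θ = -(π / 2) := h2
        rcases h3 with h3 | h3
        · linarith [hw₁.2, hθ.1]
        · linarith [hw₂.1, hθ.2]
      · refine InStrip.snd_notMem hk₀ hr ?_ hphase h (s := s)
        rw [hx₁, hsnd] at hs₁
        rw [hx₂, hsnd] at hs₂
        rw [hsnd]
        refine hs₁.between hs₂ hk₀ ?_ ?_
        · apply Real.monotone_arcsin; gcongr
        · apply Real.monotone_arcsin; gcongr
  exact connectedComponentIn_eq (hpre.subset_connectedComponentIn hx₁Γ hsub hx₂Γ)

/-- The displacement is constant on the connected subsets of the cut preimage. -/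
lemma displacement_eq_of_mem {ε r₀ : ℝ} {k₀ : ℕ} {V W : Set Cylinder} (hε0 : 0 < ε)
    (hε : ε < 1 / 2) (hV : IsPreconnected V) (hVW : V ⊆ cutPreimage ε r₀ k₀ W) {x y : Cylinder}
    (hx : x ∈ V) (hy : y ∈ V) : displacement ε y = displacement ε x := by
  refine hV.constant (f := displacement ε) ?_ hy hx
  intro z hz
  have hzc := hVW hz
  have h1 := eventually_displacement_eq hε0 hε hzc.1.1 fun h => hzc.2 (Or.inl h)
  have h2 : nhdsWithin z V ≤ nhdsWithin z phaseSpace :=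
    nhdsWithin_mono z fun y hy => (hVW hy).1.1
  exact tendsto_nhds_of_eventually_eq (h2 h1)

lemma abs_sin_sub_le_of_cos_le {f g q : ℝ} (hf : f ∈ Icc (-(π / 2)) (π / 2))
    (hg : g ∈ Icc (-(π / 2)) (π / 2)) (h : ∀ t ∈ uIcc f g, Real.cos t ≤ q) :
    |Real.sin g - Real.sin f| ≤ q * |g - f| := by
  refine (convex_uIcc f g).norm_image_sub_le_of_norm_deriv_le (f := Real.sin)
    (fun t _ => Real.differentiableAt_sin) (fun t ht => ?_) left_mem_uIcc right_mem_uIcc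
  rw [Real.deriv_sin, Real.norm_eq_abs, abs_of_nonneg]
  · exact h t ht
  · exact Real.cos_nonneg_of_mem_Icc (uIcc_subset_Icc hf hg ht)

/-- The contraction of the billiard map along a piece of the preimage of a stable leaf. -/
lemma dist_billiardMap_le {ε r₀ ρ q : ℝ} {k₀ : ℕ} {I : Set ℝ} {w : ℝ → ℝ} {V W : Set Cylinder}
    (hε0 : 0 < ε) (hε : ε < 1 / 2) (hG : IsStableGraph I w W) (hρ : ρ ≤ (1 - 2 * ε) / 4)
    (hV : IsPreconnected V) (hVW : V ⊆ cutPreimage ε r₀ k₀ W) {m : ℤ × ℤ}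
    (hm : ∀ y ∈ V, displacement ε y = -m) (hq : ∀ y ∈ V, Real.cos y.snd ≤ q)
    {x₁ x₂ : Cylinder} {θ₁ θ₂ : ℝ} (hx₁ : x₁ ∈ V) (hx₂ : x₂ ∈ V) (hθ₁ : θ₁ ∈ I) (hθ₂ : θ₂ ∈ I)
    (h12 : θ₁ ≤ θ₂) (hα : θ₂ - w θ₂ - (θ₁ - w θ₁) ≤ ρ)
    (hT₁ : billiardMap ε x₁ = point θ₁ (w θ₁)) (hT₂ : billiardMap ε x₂ = point θ₂ (w θ₂)) :
    dist (billiardMap ε x₁) (billiardMap ε x₂) ≤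
      2 * ε * q / ((1 - 2 * ε) * ‖latticePoint m‖) * dist x₁ x₂ := by
  have spec : ∀ x ∈ V, ∀ θ, billiardMap ε x = point θ (w θ) →
      Visible ε (w θ) (θ - w θ) m ∧ x.snd = backAngle ε (w θ) (θ - w θ) m := by
    intro x hx θ hT
    have hxc := hVW hx
    obtain ⟨h1, -, h3, -⟩ := eq_backPoint hε0 hε hxc.1.1
      (fun h => hxc.2 (Or.inl (Or.inl h))) hT
    rw [hm x hx, neg_neg] at h1 h3
    exact ⟨h1, h3⟩
  obtain ⟨hv₁, hf₁⟩ := spec x₁ hx₁ θ₁ hT₁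
  obtain ⟨hv₂, hf₂⟩ := spec x₂ hx₂ θ₂ hT₂
  have hm0 : m ≠ 0 := by
    rintro rfl; have := hv₁.2.1; rw [dotU_zero] at this; exact lt_irrefl _ this
  have hN := one_le_norm_latticePoint hm0
  have hγ : 0 < 1 - 2 * ε := by linarith
  have hc₁ := Real.cos_nonneg_of_mem_Icc (hG.mem_Icc _ hθ₁)
  have g := hG.sub_le θ₁ hθ₁ θ₂ hθ₂ h12
  have hgrow := offset_growth_left hε0 hε hρ (φ₁ := w θ₁) (φ₂ := w θ₂) (α₁ := θ₁ - w θ₁)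
    (α₂ := θ₂ - w θ₂) (by linarith) (by linarith) hα hc₁ hm0
    (norm_le_of_hit hε0 hε hc₁ hv₁.1.le hv₁.2.1)
  rw [← sin_backAngle hε0 hv₁.1.le, ← sin_backAngle hε0 hv₂.1.le, ← hf₁, ← hf₂] at hgrow
  -- Every angle between those of `x₁` and `x₂` occurs on the connected set `V`, so `cos ≤ q` holds
  -- on the whole interval.
  have hsin : |Real.sin x₂.snd - Real.sin x₁.snd| ≤ q * |x₂.snd - x₁.snd| := by
    apply abs_sin_sub_le_of_cos_le (hVW hx₁).1.1 (hVW hx₂).1.1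
    intro t ht
    have hcont : ContinuousOn (fun z : Cylinder => z.snd) V := by
      have h3 : Continuous fun x : Cylinder => x.snd := by fun_prop
      exact h3.continuousOn
    have hoc := (hV.image _ hcont).ordConnected
    obtain ⟨z, hz, rfl⟩ := hoc.uIcc_subset (mem_image_of_mem _ hx₁) (mem_image_of_mem _ hx₂) ht
    exact hq z hz
  have hq0 : 0 ≤ q := (Real.cos_nonneg_of_mem_Icc (hVW hx₁).1.1).trans (hq x₁ hx₁)
  have hdist : dist (billiardMap ε x₁) (billiardMap ε x₂) ≤ θ₂ - w θ₂ - (θ₁ - w θ₁) := by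
    rw [hT₁, hT₂]
    refine (dist_point_le _ _ _ _).trans (le_of_eq ?_)
    rw [abs_sub_comm, abs_of_nonneg (by linarith), abs_of_nonneg (by linarith)]
    ring
  refine hdist.trans ?_
  have h5 : |x₂.snd - x₁.snd| ≤ dist x₁ x₂ := by
    rw [abs_sub_comm]; exact abs_snd_sub_le_dist x₁ x₂
  have hpos : 0 < (1 - 2 * ε) * ‖latticePoint m‖ := mul_pos hγ (by linarith)
  rw [div_mul_eq_mul_div, le_div_iff₀ hpos]
  have h6 : ε * (Real.sin x₂.snd - Real.sin x₁.snd) ≤ ε * (q * dist x₁ x₂) := by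
    gcongr
    exact (le_abs_self _).trans (hsin.trans (by gcongr))
  linarith

/-- The one-step contraction of a piece. -/
lemma length_image_le {ε r₀ ρ q αs : ℝ} {k₀ N : ℕ} {I : Set ℝ} {w : ℝ → ℝ} {V W : Set Cylinder}
    (hε0 : 0 < ε) (hε : ε < 1 / 2) (hG : IsStableGraph I w W) (hρ0 : 0 < ρ)
    (hρ : ρ ≤ (1 - 2 * ε) / 4) (hN : ∀ θ ∈ I, |θ - w θ - αs| ≤ N * ρ)
    (hV : IsPreconnected V) (hVW : V ⊆ cutPreimage ε r₀ k₀ W) {m : ℤ × ℤ}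
    (hm : ∀ y ∈ V, displacement ε y = -m) (hq0 : 0 ≤ q) (hq : ∀ y ∈ V, Real.cos y.snd ≤ q) :
    length (billiardMap ε '' V) ≤
      ENNReal.ofReal ((2 * N + 1) * (2 * ε * q / ((1 - 2 * ε) * ‖latticePoint m‖))) * length V := by
  set L := 2 * ε * q / ((1 - 2 * ε) * ‖latticePoint m‖) with hL
  have hL0 : 0 ≤ L := by
    apply div_nonneg (by positivity)
    exact mul_nonneg (by linarith) (norm_nonneg _)
  set J := Finset.Icc (-(N : ℤ)) N with hJ
  -- The Lipschitz bound holds only for images whose `α` differ by at most `ρ`, so `V` is cut by the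
  -- value of `α` into `2N + 1` parts; these need not be connected.
  set U : ℤ → Set Cylinder := fun j => {y ∈ V | ∃ θ ∈ I, billiardMap ε y = point θ (w θ) ∧
    ⌊(θ - w θ - αs) / ρ⌋ = j} with hU
  have hlip : ∀ j, LipschitzOnWith L.toNNReal (billiardMap ε) (U j) := by
    intro j
    apply LipschitzOnWith.of_dist_le_mul
    rintro x₁ ⟨hx₁, θ₁, hθ₁, hT₁, hj₁⟩ x₂ ⟨hx₂, θ₂, hθ₂, hT₂, hj₂⟩
    rw [Real.coe_toNNReal _ hL0]
    have h1 : |(θ₁ - w θ₁ - αs) / ρ - (θ₂ - w θ₂ - αs) / ρ| < 1 :=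
      Int.abs_sub_lt_one_of_floor_eq_floor (hj₁.trans hj₂.symm)
    rw [← sub_div, abs_div, abs_of_pos hρ0, div_lt_one hρ0] at h1
    have h2 := abs_lt.mp h1
    rcases le_total θ₁ θ₂ with h | h
    · exact dist_billiardMap_le hε0 hε hG hρ hV hVW hm hq hx₁ hx₂ hθ₁ hθ₂ h (by linarith) hT₁ hT₂
    · rw [dist_comm, dist_comm x₁]
      exact dist_billiardMap_le hε0 hε hG hρ hV hVW hm hq hx₂ hx₁ hθ₂ hθ₁ h (by linarith) hT₂ hT₁
  have hcover : billiardMap ε '' V ⊆ ⋃ j ∈ J, billiardMap ε '' U j := by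
    rintro _ ⟨y, hy, rfl⟩
    obtain ⟨θ, hθ, hT, -⟩ := cutPreimage_spec hε0 hε hG (hVW hy)
    have h1 := abs_le.mp (hN θ hθ)
    refine mem_biUnion (x := ⌊(θ - w θ - αs) / ρ⌋) ?_ ⟨y, ⟨hy, θ, hθ, hT, rfl⟩, rfl⟩
    simp only [hJ, Finset.coe_Icc, mem_Icc]
    constructor
    · rw [Int.le_floor, le_div_iff₀ hρ0]; push_cast; linarith
    · have : ((⌊(θ - w θ - αs) / ρ⌋ : ℤ) : ℝ) ≤ N :=
        (Int.floor_le _).trans ((div_le_iff₀ hρ0).mpr h1.2)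
      exact_mod_cast this
  calc length (billiardMap ε '' V) ≤ length (⋃ j ∈ J, billiardMap ε '' U j) := measure_mono hcover
    _ ≤ ∑ j ∈ J, length (billiardMap ε '' U j) := measure_biUnion_finset_le _ _
    _ ≤ ∑ j ∈ J, ENNReal.ofReal L * length V := by
        refine Finset.sum_le_sum fun j _ => ?_
        have := (hlip j).hausdorffMeasure_image_le (d := 1) zero_le_one
        rw [ENNReal.rpow_one] at this
        refine this.trans ?_
        have h3 : U j ⊆ V := fun y hy => hy.1
        exact mul_le_mul' le_rfl (measure_mono h3)
    _ = _ := by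
        rw [Finset.sum_const, nsmul_eq_mul, hJ, Int.card_Icc]
        have : ((N : ℤ) + 1 - -(N : ℤ)).toNat = 2 * N + 1 := by omega
        rw [this, ← mul_assoc, ← ENNReal.ofReal_natCast, ← ENNReal.ofReal_mul (by positivity)]
        push_cast
        rfl

/-- Since `offset = ε sin f`, the near tangency in `far_visible` reads `ε ^ 2 cos ^ 2 f ≤ 8 ε /
‖m‖`. Near scatterers get the trivial bound. -/
lemma cos_backAngle_le_grazing {ε φ α : ℝ} {m : ℤ × ℤ} (hε0 : 0 < ε) (hε : ε < 1 / 2)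
    (h : Visible ε φ α m) : Real.cos (backAngle ε φ α m) ≤ grazing ε ‖latticePoint m‖ := by
  unfold grazing
  split_ifs with hL
  · exact Real.cos_le_one _
  · push Not at hL
    have hL0 : 0 < ‖latticePoint m‖ := lt_of_lt_of_le (by positivity) hL
    obtain ⟨-, h2⟩ := far_visible hε0 hε h hL
    apply Real.le_sqrt_of_sq_le
    rw [le_div_iff₀ (by positivity)]
    rw [← sin_backAngle hε0 h.1.le, le_div_iff₀ hL0] at h2
    have h3 := Real.sin_sq_add_cos_sq (backAngle ε φ α m)
    set u := Real.cos (backAngle ε φ α m)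
    set v := Real.sin (backAngle ε φ α m)
    have h4 : ε * (u ^ 2 * (ε * ‖latticePoint m‖)) ≤ ε * 8 := by
      have : u ^ 2 = 1 - v ^ 2 := by linarith
      rw [this]; linarith
    exact le_of_mul_le_mul_left h4 hε0

lemma Visible.ne_zero {ε φ α : ℝ} {m : ℤ × ℤ} (h : Visible ε φ α m) : m ≠ 0 := by
  rintro rfl
  have := h.2.1
  rw [dotU_zero] at this
  exact lt_irrefl _ this

lemma Visible.abs_crossU_le_one {ε φ α : ℝ} {m : ℤ × ℤ} (hε0 : 0 < ε) (hε : ε < 1 / 2)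
    (h : Visible ε φ α m) : |crossU m α| ≤ 1 := by
  have h1 : crossU m α = ε * Real.sin φ - offset ε φ α m := by rw [offset]; ring
  have h2 := abs_lt.mp h.1
  have h3 := Real.neg_one_le_sin φ
  have h4 := Real.sin_le_one φ
  rw [h1, abs_le]
  constructor <;> nlinarith

/-- Moves a bound from the direction in which `m` is seen to one reference direction for the whole
leaf. The cost `d ‖m‖` is what turns the strip into a sector. -/
lemma abs_crossU_le_add (m : ℤ × ℤ) {α β d : ℝ} (h : |crossU m α| ≤ 1) (hd : |α - β| ≤ d) :
    |crossU m β| ≤ 1 + d * ‖latticePoint m‖ := by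
  have h1 := abs_crossU_sub_le' m α β
  have h2 : |crossU m β| ≤ |crossU m α| + |crossU m β - crossU m α| := by
    have := abs_add_le (crossU m α) (crossU m β - crossU m α)
    rwa [add_sub_cancel] at this
  rw [abs_sub_comm β] at h1
  have h3 : ‖latticePoint m‖ * |α - β| ≤ ‖latticePoint m‖ * d := by gcongr
  linarith

lemma pieceDisplacement_eq {ε : ℝ} {V : Set Cylinder} {x : Cylinder} {ℓ : ℤ × ℤ} (hx : x ∈ V)
    (h : ∀ y ∈ V, displacement ε y = ℓ) : pieceDisplacement ε V = ℓ := by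
  have h1 := Classical.epsilon_spec (p := fun ℓ : ℤ × ℤ => ∀ x ∈ V, displacement ε x = ℓ) ⟨ℓ, h⟩
  exact (h1 x hx).symm.trans (h x hx)

/-- The contribution of one piece to the growth sum. -/
lemma piece_term_le {ε r₀ ρ αs a η ν κ : ℝ} {k₀ N : ℕ} {I : Set ℝ} {w : ℝ → ℝ} {W : Set Cylinder}
    (hε0 : 0 < ε) (hε : ε ≤ κ) (hκ : κ < 1 / 2) (hG : IsStableGraph I w W) (hρ0 : 0 < ρ)
    (hρ : ρ ≤ (1 - 2 * ε) / 4) (hN : ∀ θ ∈ I, |θ - w θ - αs| ≤ N * ρ) (hr : 1 < r₀)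
    (hη : 0 < η) (ha : a = 1 - 1 / r₀ - η) (ha0 : 0 ≤ a) (ha1 : a ≤ 1)
    {x : Cylinder} (hx : x ∈ cutPreimage ε r₀ k₀ W) {s : Bool × ℕ} (hs : InStrip r₀ k₀ s x.snd) :
    ENNReal.ofReal (‖latticePoint (pieceDisplacement ε
        (connectedComponentIn (cutPreimage ε r₀ k₀ W) x))‖ ^ ν) *
      (length (billiardMap ε '' connectedComponentIn (cutPreimage ε r₀ k₀ W) x) /
        length (connectedComponentIn (cutPreimage ε r₀ k₀ W) x)) ≤
    ENNReal.ofReal ((2 * N + 1) * (2 / (1 - 2 * κ))) *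
      (ENNReal.ofReal (ε * ‖latticePoint (-displacement ε x)‖ ^ (ν - 1) *
        grazing ε ‖latticePoint (-displacement ε x)‖ ^ a) *
      ENNReal.ofReal (stripWeight η s.2)) := by
  have hε2 : ε < 1 / 2 := by linarith
  set V := connectedComponentIn (cutPreimage ε r₀ k₀ W) x with hVdef
  have hV : IsPreconnected V := isPreconnected_connectedComponentIn
  have hVW : V ⊆ cutPreimage ε r₀ k₀ W := connectedComponentIn_subset _ _
  have hxV : x ∈ V := mem_connectedComponentIn hx
  have hdisp : ∀ y ∈ V, displacement ε y = displacement ε x := fun y hy =>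
    displacement_eq_of_mem hε0 hε2 hV hVW hxV hy
  rw [pieceDisplacement_eq hxV hdisp, ← norm_latticePoint_neg]
  obtain ⟨m, hm⟩ : ∃ m, m = -displacement ε x := ⟨_, rfl⟩
  rw [← hm]
  have hdm : ∀ y ∈ V, displacement ε y = -m := fun y hy => by rw [hdisp y hy, hm, neg_neg]
  have hm0 : m ≠ 0 := by
    obtain ⟨θ, -, -, hv, -⟩ := cutPreimage_spec hε0 hε2 hG hx
    rw [hm]; exact hv.ne_zero
  have hL1 := one_le_norm_latticePoint hm0
  set L := ‖latticePoint m‖ with hL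
  have hL0 : 0 < L := by linarith
  have hg0 := grazing_nonneg ε L
  have hsw0 := stripWeight_nonneg η s.2
  set q := grazing ε L ^ a * stripWeight η s.2 with hq
  have hq0 : 0 ≤ q := by positivity
  have hcos : ∀ y ∈ V, Real.cos y.snd ≤ q := by
    intro y hy
    obtain ⟨θ, -, -, hv, -, hf, -⟩ := cutPreimage_spec hε0 hε2 hG (hVW hy)
    have h1 : Real.cos y.snd ≤ grazing ε L := by
      rw [hf, hdm y hy, neg_neg]
      rw [hdm y hy, neg_neg] at hv
      exact cos_backAngle_le_grazing hε0 hε2 hv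
    have h2 : Real.cos y.snd ≤ stripWidth r₀ s.2 :=
      cos_le_stripWidth hV (fun z hz => (hVW hz).1.1) (fun z hz h => (hVW hz).2 (Or.inr h)) hxV hy hs
    calc _ ≤ min (grazing ε L) (stripWidth r₀ s.2) := le_min h1 h2
      _ ≤ _ := min_le_rpow_mul_rpow hg0 (stripWidth_nonneg _ _) ha0 ha1
      _ ≤ q := by
        rw [hq]; gcongr
        exact stripWidth_rpow_le hr hη ha s.2
  have hlen := length_image_le hε0 hε2 hG hρ0 hρ hN hV hVW hdm hq0 hcos
  refine (mul_le_mul' le_rfl (ENNReal.div_le_of_le_mul hlen)).trans ?_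
  have hκ0 : 0 < 1 - 2 * κ := by linarith
  rw [← ENNReal.ofReal_mul (by positivity), ← ENNReal.ofReal_mul (by positivity),
    ← ENNReal.ofReal_mul (by positivity)]
  apply ENNReal.ofReal_le_ofReal
  rw [Real.rpow_sub_one hL0.ne']
  have h1 : 2 * ε * q / ((1 - 2 * ε) * L) ≤ 2 * ε * q / ((1 - 2 * κ) * L) := by
    gcongr
  calc L ^ ν * ((2 * N + 1) * (2 * ε * q / ((1 - 2 * ε) * L)))
      ≤ L ^ ν * ((2 * N + 1) * (2 * ε * q / ((1 - 2 * κ) * L))) := by gcongr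
    _ = _ := by rw [hq]; field_simp

/-! ### Assembly of the growth bound -/

/-- The data that determine a piece of the preimage of a stable leaf. -/
lemma exists_label {ε r₀ ρ αs : ℝ} {k₀ N : ℕ} {I : Set ℝ} {w : ℝ → ℝ} {W : Set Cylinder}
    (hε0 : 0 < ε) (hε : ε < 1 / 2) (hG : IsStableGraph I w W) (hρ0 : 0 < ρ)
    (hN : ∀ θ ∈ I, |θ - w θ - αs| ≤ N * ρ) (hr : 0 < r₀) (V : preimagePieces ε r₀ k₀ W) :
    ∃ (x : Cylinder) (θ : ℝ) (s : Bool × ℕ) (j : Finset.Icc (-(N : ℤ)) N),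
      x ∈ cutPreimage ε r₀ k₀ W ∧ (V : Set Cylinder) =
        connectedComponentIn (cutPreimage ε r₀ k₀ W) x ∧ θ ∈ I ∧
      Visible ε (w θ) (θ - w θ) (-displacement ε x) ∧
      x = backPoint ε θ (w θ) (-displacement ε x) ∧ w θ ∈ Ioo (-(π / 2)) (π / 2) ∧
      InStrip r₀ k₀ s x.snd ∧ ⌊(θ - w θ - αs) / ρ⌋ = (j : ℤ) := by
  obtain ⟨V, x, hx, hVx⟩ := V
  obtain ⟨θ, hθ, -, hv, hxb, -, hw⟩ := cutPreimage_spec hε0 hε hG hx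
  obtain ⟨s, hs⟩ := exists_inStrip hr hx.1.1 (fun h => hx.2 (Or.inl (Or.inl h)))
    fun h => hx.2 (Or.inr h)
  have h1 := abs_le.mp (hN θ hθ)
  refine ⟨x, θ, s, ⟨⌊(θ - w θ - αs) / ρ⌋, ?_⟩, hx, hVx, hθ, hv, hxb, hw, hs, rfl⟩
  rw [Finset.mem_Icc]
  constructor
  · rw [Int.le_floor, le_div_iff₀ hρ0]; push_cast; linarith
  · have : ((⌊(θ - w θ - αs) / ρ⌋ : ℤ) : ℝ) ≤ N :=
      (Int.floor_le _).trans ((div_le_iff₀ hρ0).mpr h1.2)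
    exact_mod_cast this

open Classical in
/-- The growth sum is at most the sum over visible scatterers and homogeneity strips. -/
lemma growthSum_le_tsum {ε r₀ ρ αs a η ν κ : ℝ} {k₀ N : ℕ} {I : Set ℝ} {w : ℝ → ℝ}
    {W : Set Cylinder} (hε0 : 0 < ε) (hε : ε ≤ κ) (hκ : κ < 1 / 2) (hk₀ : 1 ≤ k₀)
    (hG : IsStableGraph I w W) (hρ0 : 0 < ρ) (hρ : ρ ≤ (1 - 2 * ε) / 4)
    (hN : ∀ θ ∈ I, |θ - w θ - αs| ≤ N * ρ) (hr : 1 < r₀)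
    (hη : 0 < η) (ha : a = 1 - 1 / r₀ - η) (ha0 : 0 ≤ a) (ha1 : a ≤ 1) :
    growthSum ε r₀ ν k₀ W ≤ (2 * N + 1 : ℕ) * (ENNReal.ofReal ((2 * N + 1) * (2 / (1 - 2 * κ))) *
      ((∑' m, if ∃ θ ∈ I, Visible ε (w θ) (θ - w θ) m then ENNReal.ofReal
        (ε * ‖latticePoint m‖ ^ (ν - 1) * grazing ε ‖latticePoint m‖ ^ a) else 0) *
        (2 * (1 + zetaSum η)))) := by
  have hε2 : ε < 1 / 2 := by linarith
  have hr0 : 0 < r₀ := by linarith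
  choose X Θ S J hX hVX hΘ hvis hback hw hS hJ using
    exists_label (r₀ := r₀) (k₀ := k₀) (W := W) hε0 hε2 hG hρ0 hN hr0
  set F : ℤ × ℤ → ℝ≥0∞ := fun m => if ∃ θ ∈ I, Visible ε (w θ) (θ - w θ) m then ENNReal.ofReal
    (ε * ‖latticePoint m‖ ^ (ν - 1) * grazing ε ‖latticePoint m‖ ^ a) else 0 with hF
  set K := ENNReal.ofReal ((2 * N + 1) * (2 / (1 - 2 * κ))) with hK
  set H : Finset.Icc (-(N : ℤ)) N × (ℤ × ℤ) × (Bool × ℕ) → ℝ≥0∞ := fun p =>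
    K * (F p.2.1 * ENNReal.ofReal (stripWeight η p.2.2.2)) with hH
  set lab : preimagePieces ε r₀ k₀ W → Finset.Icc (-(N : ℤ)) N × (ℤ × ℤ) × (Bool × ℕ) :=
    fun V => (J V, -displacement ε (X V), S V) with hlab
  -- Two pieces with the same scatterer, strip and `α`-cell contain points whose images are at most
  -- `ρ` apart in `α`, so they are joined inside the cut preimage and coincide.
  have hinj : Function.Injective lab := by
    have key : ∀ V₁ V₂, lab V₁ = lab V₂ → Θ V₁ ≤ Θ V₂ → V₁ = V₂ := by
      intro V₁ V₂ h h12
      simp only [hlab, Prod.mk.injEq] at h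
      obtain ⟨hj, hm, hs⟩ := h
      have h1 : |(Θ V₁ - w (Θ V₁) - αs) / ρ - (Θ V₂ - w (Θ V₂) - αs) / ρ| < 1 :=
        Int.abs_sub_lt_one_of_floor_eq_floor (by rw [hJ, hJ, hj])
      rw [← sub_div, abs_div, abs_of_pos hρ0, div_lt_one hρ0] at h1
      have h2 := abs_lt.mp h1
      apply Subtype.ext
      rw [hVX V₁, hVX V₂]
      refine connectedComponentIn_eq_of_visible hε0 hε2 hr0 hk₀ hG hρ (hΘ V₁) (hΘ V₂) h12
        (by linarith) (hvis V₁) (hm ▸ hvis V₂) (hback V₁) (hm ▸ hback V₂) (hw V₁) (hw V₂)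
        (hS V₁) (hs ▸ hS V₂)
    intro V₁ V₂ h
    rcases le_total (Θ V₁) (Θ V₂) with h12 | h12
    · exact key V₁ V₂ h h12
    · exact (key V₂ V₁ h.symm h12).symm
  calc growthSum ε r₀ ν k₀ W ≤ ∑' V, H (lab V) := by
        refine ENNReal.tsum_le_tsum fun V => ?_
        have h1 := piece_term_le (ν := ν) hε0 hε hκ hG hρ0 hρ hN hr hη ha ha0 ha1 (hX V) (hS V)
        rw [← hVX V] at h1
        simp only [hH, hF, hlab]
        rwa [if_pos ⟨Θ V, hΘ V, hvis V⟩]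
    _ ≤ ∑' p, H p := ENNReal.tsum_comp_le_tsum_of_injective hinj H
    _ = (2 * N + 1 : ℕ) * (K * ((∑' m, F m) *
          ∑' s : Bool × ℕ, ENNReal.ofReal (stripWeight η s.2))) := by
        have h2 : ∑' p : (ℤ × ℤ) × (Bool × ℕ), F p.1 * ENNReal.ofReal (stripWeight η p.2.2) =
            (∑' m, F m) * ∑' s : Bool × ℕ, ENNReal.ofReal (stripWeight η s.2) := by
          rw [ENNReal.tsum_prod']
          simp only [ENNReal.tsum_mul_left, ENNReal.tsum_mul_right]
        rw [ENNReal.tsum_prod']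
        simp only [hH]
        rw [tsum_fintype, Finset.sum_const, nsmul_eq_mul, Finset.card_univ, Fintype.card_coe,
          Int.card_Icc, ENNReal.tsum_mul_left, h2]
        have : ((N : ℤ) + 1 - -(N : ℤ)).toNat = 2 * N + 1 := by omega
        rw [this]
    _ ≤ _ := by gcongr; exact tsum_stripWeight_le η

/-- The growth bound, for leaves of length at most `c ε ^ ν`. -/
lemma growthSum_le {η κ : ℝ} (hη : 0 < η) (hκ : κ < 1 / 2) : ∃ C : ℝ, 0 < C ∧
    ∀ (k₀ : ℕ) (B r₀ ν ε c : ℝ), 1 ≤ k₀ → 1 < r₀ → 0 ≤ ν → ν ≤ 1 / 2 - 1 / (2 * r₀) - η →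
      0 < ε → ε ≤ κ → 0 < c → ∀ W : Set Cylinder,
        IsAdmissibleStableLeaf ε r₀ k₀ B (leafSize c ε ν) W →
        growthSum ε r₀ ν k₀ W ≤ ENNReal.ofReal (C * (c + ε ^ (η / 2))) := by
  -- Taken from `κ` and not from `ε`, so that `ρ`, `N` and `M` are uniform in `ε ≤ κ`.
  set ρ := (1 - 2 * κ) / 4 with hρ
  have hρ0 : 0 < ρ := by rw [hρ]; linarith
  -- `w` varies by at most `π` and `α = θ - w θ` by at most twice as much, and `2π < 7`.
  set N := ⌈7 / ρ⌉₊ with hN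
  have hN7 : 7 ≤ N * ρ := (div_le_iff₀ hρ0).mp (Nat.le_ceil _)
  set M : ℝ≥0∞ := (2 * N + 1 : ℕ) * (ENNReal.ofReal ((2 * N + 1) * (2 / (1 - 2 * κ))) *
    (ENNReal.ofReal 61440 * (1 + zetaSum (η / 2)) * (2 * (1 + zetaSum η)))) with hM
  have hMtop : M ≠ ∞ := by
    have h1 := zetaSum_ne_top hη
    have h2 := zetaSum_ne_top (half_pos hη)
    finiteness
  refine ⟨M.toReal + 1, by positivity, ?_⟩
  intro k₀ B r₀ ν ε c hk₀ hr hν0 hν hε0 hε hc W hW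
  have hε2 : ε < 1 / 2 := by linarith
  have hδ : 0 ≤ leafSize c ε ν := by unfold leafSize; positivity
  obtain ⟨I, w, hI, ⟨θs, hθs⟩, hWI, hcont, hwI, hsub⟩ := hW.exists_graph hδ
  have hG : IsStableGraph I w W := ⟨hI, hWI, hcont, hwI, fun θ₁ h₁ θ₂ h₂ h => (hsub θ₁ h₁ θ₂ h₂ h).1⟩
  have hα : ∀ θ ∈ I, |θ - w θ - (θs - w θs)| ≤ 2 * |w θ - w θs| ∧ |w θ - w θs| ≤ leafSize c ε ν := by
    intro θ hθ
    rcases le_total θ θs with h | h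
    · obtain ⟨h1, h2⟩ := hsub θ hθ θs hθs h
      rw [abs_of_nonneg (by linarith : 0 ≤ w θ - w θs), abs_of_nonpos (by linarith)]
      constructor <;> linarith
    · obtain ⟨h1, h2⟩ := hsub θs hθs θ hθ h
      rw [abs_of_nonpos (by linarith : w θ - w θs ≤ 0), abs_of_nonneg (by linarith)]
      constructor <;> linarith
  have hαN : ∀ θ ∈ I, |θ - w θ - (θs - w θs)| ≤ N * ρ := by
    intro θ hθ
    have h1 := hwI θ hθ
    have h2 := hwI θs hθs
    have h3 : |w θ - w θs| ≤ π := by rw [abs_le]; constructor <;> linarith [h1.1, h1.2, h2.1, h2.2]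
    linarith [(hα θ hθ).1, Real.pi_lt_d2]
  have hαc : ∀ θ ∈ I, |θ - w θ - (θs - w θs)| ≤ 2 * c * ε ^ ν := by
    intro θ hθ
    have := hα θ hθ
    unfold leafSize at this
    linarith
  have hr1 : 0 < 1 / r₀ := by positivity
  have hr2 : 1 / (2 * r₀) = 1 / r₀ / 2 := by field_simp
  rw [hr2] at hν
  -- With this `a` the hypothesis on `ν` reads `2ν ≤ a - η`, which makes the exponent `σ = a/2 - ν`
  -- of the row sums at least `η/2`.
  obtain ⟨a, ha⟩ : ∃ a, a = 1 - 1 / r₀ - η := ⟨_, rfl⟩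
  have h1 := growthSum_le_tsum (ν := ν) (κ := κ) hε0 hε hκ hk₀ hG hρ0 (by rw [hρ]; linarith) hαN
    hr hη ha (by linarith) (by linarith)
  have h2 := weighted_count (α := θs - w θs) hε0 hε2 hν0 hη (a := a) (by linarith) (by linarith)
    hc (P := fun m => ∃ θ ∈ I, Visible ε (w θ) (θ - w θ) m) ?_ ?_
  · refine h1.trans ?_
    have h3 : 0 ≤ c + ε ^ (η / 2) := by positivity
    calc _ ≤ (2 * N + 1 : ℕ) * (ENNReal.ofReal ((2 * N + 1) * (2 / (1 - 2 * κ))) *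
          ((ENNReal.ofReal (61440 * (c + ε ^ (η / 2))) * (1 + zetaSum (η / 2))) *
            (2 * (1 + zetaSum η)))) := by gcongr
      _ = M * ENNReal.ofReal (c + ε ^ (η / 2)) := by
          rw [hM, ENNReal.ofReal_mul (p := 61440) (by norm_num)]; ring
      _ = ENNReal.ofReal (M.toReal * (c + ε ^ (η / 2))) := by
          rw [ENNReal.ofReal_mul ENNReal.toReal_nonneg, ENNReal.ofReal_toReal hMtop]
      _ ≤ _ := by
          apply ENNReal.ofReal_le_ofReal
          gcongr
          linarith
  · rintro m ⟨θ, hθ, hv⟩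
    exact ⟨hv.ne_zero, abs_crossU_le_add m (hv.abs_crossU_le_one hε0 hε2) (hαc θ hθ)⟩
  · rintro m ⟨θ, hθ, hv⟩ hfar
    obtain ⟨⟨e, he1, he2, he3⟩, -⟩ := far_visible hε0 hε2 hv hfar
    exact ⟨e, he1, he2, abs_crossU_le_add e he3 (hαc θ hθ)⟩

lemma rpow_neg_mul_leafSize {c ε ν : ℝ} (hε : 0 < ε) : ε ^ (-ν) * leafSize c ε ν = c := by
  rw [leafSize, mul_left_comm, ← Real.rpow_add hε, neg_add_cancel, Real.rpow_zero, mul_one]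

end LorentzGas

end

theorem mainTheorem6 (k₀ : ℕ) (hk₀ : 1 ≤ k₀) (B : ℝ) (η : ℝ) (hη : 0 < η) :
    (∀ (c : ℝ), 0 < c → ∀ (εmax : ℝ), εmax < 1 / 2 → ∃ C : ℝ, 0 < C ∧
      ∀ (r₀ ν ε : ℝ), 1 < r₀ → 0 ≤ ν → ν ≤ 1 / 2 - 1 / (2 * r₀) - η → 0 < ε → ε ≤ εmax →
        ∀ W : Set LorentzGas.Cylinder,
          LorentzGas.IsAdmissibleStableLeaf ε r₀ k₀ B (LorentzGas.leafSize c ε ν) W →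
          LorentzGas.growthSum ε r₀ ν k₀ W ≤
            ENNReal.ofReal (C * (ε + ε ^ (-ν) * LorentzGas.leafSize c ε ν))) ∧
    (∃ C : ℝ, 0 < C ∧ ∀ (c : ℝ), 0 < c → ∃ ε₀ : ℝ, 0 < ε₀ ∧ ε₀ < 1 / 2 ∧
      ∀ (r₀ ν ε : ℝ), 1 < r₀ → 0 ≤ ν → ν ≤ 1 / 2 - 1 / (2 * r₀) - η → 0 < ε → ε ≤ ε₀ →
        ∀ W : Set LorentzGas.Cylinder,
          LorentzGas.IsAdmissibleStableLeaf ε r₀ k₀ B (LorentzGas.leafSize c ε ν) W →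
          LorentzGas.growthSum ε r₀ ν k₀ W ≤
            ENNReal.ofReal (C * (ε + ε ^ (-ν) * LorentzGas.leafSize c ε ν))) := by
  constructor
  · intro c hc εmax hεmax
    obtain ⟨C, hC, h⟩ := LorentzGas.growthSum_le hη hεmax
    -- For fixed `c` the term `ε ^ (η/2) ≤ 1` is absorbed through `c + 1 = ((c + 1) / c) * c`.
    refine ⟨C * ((c + 1) / c), by positivity, ?_⟩
    intro r₀ ν ε hr hν0 hν hε0 hε W hW
    refine (h k₀ B r₀ ν ε c hk₀ hr hν0 hν hε0 hε hc W hW).trans ?_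
    rw [LorentzGas.rpow_neg_mul_leafSize hε0]
    apply ENNReal.ofReal_le_ofReal
    have h1 : ε ^ (η / 2) ≤ 1 := Real.rpow_le_one hε0.le (by linarith) (by positivity)
    rw [mul_assoc]
    gcongr
    calc c + ε ^ (η / 2) ≤ c + 1 := by linarith
      _ = (c + 1) / c * c := by field_simp
      _ ≤ _ := by gcongr; linarith
  · obtain ⟨C, hC, h⟩ := LorentzGas.growthSum_le hη (κ := 1 / 4) (by norm_num)
    refine ⟨C * 2, by positivity, ?_⟩
    intro c hc
    -- Below `c ^ (2 / η)` one has `ε ^ (η/2) ≤ c`, so the bound is at most `2 C c` with `C`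
    -- independent of `c`.
    refine ⟨min (1 / 4) (c ^ (2 / η)), by positivity, ?_, ?_⟩
    · exact (min_le_left _ _).trans_lt (by norm_num)
    intro r₀ ν ε hr hν0 hν hε0 hε W hW
    refine (h k₀ B r₀ ν ε c hk₀ hr hν0 hν hε0 (hε.trans (min_le_left _ _)) hc W hW).trans ?_
    rw [LorentzGas.rpow_neg_mul_leafSize hε0]
    apply ENNReal.ofReal_le_ofReal
    have h1 : ε ^ (η / 2) ≤ c := by
      calc ε ^ (η / 2) ≤ (c ^ (2 / η)) ^ (η / 2) := by
            gcongr
            exact hε.trans (min_le_right _ _)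
        _ = c := by
            rw [← Real.rpow_mul hc.le]
            have : 2 / η * (η / 2) = 1 := by field_simp
            rw [this, Real.rpow_one]
    rw [mul_assoc]
    gcongr
    linarith
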